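/- Let $U=U_q(\mathfrak{sl}_2)$ be the $\mathbb C(q)$-algebra generated by $e,f,k^{\pm1}$ with relations $kk^{-1}=k^{-1}k=1$, $kek^{-1}=q^2e$, $kfk^{-1}=q^{-2}f$, $ef-fe=\frac{k-k^{-1}}{q-q^{-1}}$; let $\Omega=fe+\frac{qk+q^{-1}k^{-1}}{(q-q^{-1})^2}$ be its Casimir element. Tensor products over $\mathbb C(q)$ of $U$-modules are $U$-modules via $\Delta(e)=e\otimes1+k\otimes e$, $\Delta(f)=f\otimes k^{-1}+1\otimes f$, $\Delta(k^{\pm1})=k^{\pm1}\otimes k^{\pm1}$. Let $\sigma$ be the antiautomorphism of $U$ with $\sigma(e)=f$, $\sigma(f)=e$, $\sigma(k)=k^{-1}$, $\sigma(q)=q^{-1}$ ($\mathbb C$-linear). For a $U$-module $M$ with weight spaces $M_r=\{m: km=q^rm\}$, let $M^\sigma$ be the space of functionals $\varphi\in\mathrm{Hom}_{\mathbb C(q)}(M,\mathbb C(q))$ vanishing on all but finitely many $M_r$, with action $(u\varphi)(m)=\varphi(\sigma(u)m)$, $u\in U$ (so a scalar $c(q)$ acts as multiplication by $c(q^{-1})$).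 For $s\in\mathbb Z$ let $M(s)$ be the Verma module, generated by $m_s$ with relations $em_s=0$, $km_s=q^sm_s$, and $V(s)$ its unique irreducible quotient. For $r\in\mathbb Z_{\ge0}$ let $T(r)$ be the $U$-module generated by $t_r$ with relations $e^{r+2}t_r=0$, $kt_r=q^{-r-2}t_r$, $\bigl(\Omega-\frac{q^{r+1}+q^{-r-1}}{(q-q^{-1})^2}\bigr)^2t_r=0$. Put $T(-1)=M(-1)$. Consider the family $\mathcal X$ of the modules $V(r)$, $T(r)$, $M(r)^\sigma$ ($r\ge0$) and $M(s)$ ($s\in\mathbb Z$). Every module in $\mathcal X$ is indecomposable. Each of the following tensor products $V$ is isomorphic to $\bigoplus_{X\in\mathcal X}X^{\oplus n_V(X)}$ with uniquely determined multiplicities $n_V(X)\in\mathbb Z_{\ge0}$, and these are as listed (always $p\in\mathbb Z_{\ge0}$; multiplicities not listed are $0$). 1. $V(r)\otimes V(s)\cong\bigoplus_{p=0}^{\min\{r,s\}}V(r+s-2p)$, for $r,s\ge0$. 2. $M(r)\otimes M(s)\cong\bigoplus_{p=0}^{\min\{r,s\}}M(r+s-2p)\ \oplus\bigoplus_{p=\min\{r,s\}+1}^{\lfloor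 (r+s+1)/2\rfloor}T(r+s-2p)\ \oplus\bigoplus_{p\ge\max\{r,s\}+1}M(r+s-2p)$, for $r,s\ge0$. 3. $V(r)\otimes M(s)\cong\bigoplus_{p=0}^{\min\{r,s\}}M(r+s-2p)\ \oplus\bigoplus_{p=s+1}^{\lfloor (r+s+1)/2\rfloor}T(r+s-2p)$, for $r,s\ge0$, where the second sum is $0$ if $r\le s$. 4. $V=V(r)\otimes M(s)$, $r\ge0>s$: $n_V(T(r+s-2p))=1$ if $2p\le r+s+1$; $n_V(M(r+s-2p))=1$ if $r+s+2\le p\le r$. 5. $V=M(r)\otimes M(s)$, $r,s\in\mathbb Z$ with $r<0$ or $s<0$: $n_V(T(r+s-2p))=1$ if $2p\le r+s+1$; $n_V(M(r+s-2p))=1$ if $p\ge r+s+2$. 6. $V=V(r)\otimes T(s)$, $r,s\ge0$: $n_V(T(r+s-2p))=1$ if $p\le\min\{r,s\}$, and $=2$ if $2s+2\le2p\le r+s+1$. 7. $V=M(r)\otimes M(s)^\sigma$, $r,s\in\mathbb Z$: $n_V(T(r+s-2p))=1$ if $2p\le r+s+1$; $n_V(M(r+s-2p))=1$ if $p\ge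 r+s+2$. 8. $V=T(r)\otimes M(s)$, $r\ge0$, $s\in\mathbb Z$: $n_V(T(r+s-2p))=1$ if $2p\le\min\{2r,r+s+1\}$, and $=2$ if $2r+2\le2p\le r+s+1$; moreover (a) if $s\ge0$: $n_V(M(r+s-2p))=1$ if $\max\{r,s\}+1\le p\le r+s+1$, and $=2$ if $p\ge r+s+2$; (b) if $s<0$: $n_V(M(r+s-2p))=1$ if $r+s+2\le p\le r$, and $=2$ if $p\ge r+1$. 9. $T(r)\otimes T(s)\cong T(r)\otimes M(s)\,\oplus\,T(r)\otimes M(-s-2)$, $r,s\ge0$, so its multiplicities are the sums of those given by 8(a) for $(r,s)$ and 8(b) for $(r,-s-2)$. The remaining tensor products of two members of $\mathcal X$ are obtained as follows. The duality $X\mapsto X^\sigma$ permutes $\mathcal X$ up to isomorphism: it exchanges $M(r)$ and $M(r)^\sigma$ for $r\ge0$ and fixes $V(r)$, $T(r)$ ($r\ge0$) and $M(s)$ ($s<0$). For all $X,Y\in\mathcal X$ one has $X\otimes Y\cong Y\otimes X$, and, if $X'$, $Y'$ are the members of $\mathcal X$ isomorphic to $X^\sigma$, $Y^\sigma$, then the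 multiplicity of $Z'$ in $X'\otimes Y'$ equals that of $Z$ in $X\otimes Y$ for every $Z\in\mathcal X$, where $Z'\in\mathcal X$, $Z'\cong Z^\sigma$. -/

import Mathlib

open scoped DirectSum TensorProduct

namespace QuantumSl2

noncomputable section

/-! ## The algebra `U_q(sl₂)` over `ℂ(q)` -/

/-- The field `ℂ(q)` of rational functions. -/
abbrev Kq : Type := RatFunc ℂ

/-- The indeterminate `q`. -/
def q : Kq := RatFunc.X

theorem q_ne_zero : q ≠ 0 := RatFunc.X_ne_zero

/-- The generators `e, f, k, k⁻¹`. -/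
inductive Gen : Type
  | e | f | k | kinv

open Gen in
/-- The defining relations of `U_q(sl₂)`. -/
inductive Rel : FreeAlgebra Kq Gen → FreeAlgebra Kq Gen → Prop
  | k_kinv : Rel (FreeAlgebra.ι Kq k * FreeAlgebra.ι Kq kinv) 1
  | kinv_k : Rel (FreeAlgebra.ι Kq kinv * FreeAlgebra.ι Kq k) 1
  | k_e : Rel (FreeAlgebra.ι Kq k * FreeAlgebra.ι Kq e * FreeAlgebra.ι Kq kinv)
      (q ^ (2 : ℤ) • FreeAlgebra.ι Kq e)
  | k_f : Rel (FreeAlgebra.ι Kq k * FreeAlgebra.ι Kq f * FreeAlgebra.ι Kq kinv)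
      (q ^ (-2 : ℤ) • FreeAlgebra.ι Kq f)
  | e_f : Rel (FreeAlgebra.ι Kq e * FreeAlgebra.ι Kq f - FreeAlgebra.ι Kq f * FreeAlgebra.ι Kq e)
      ((q - q⁻¹)⁻¹ • (FreeAlgebra.ι Kq k - FreeAlgebra.ι Kq kinv))

/-- The quantized enveloping algebra `U_q(sl₂)`. -/
def Uq : Type := RingQuot Rel

instance : Ring Uq := inferInstanceAs (Ring (RingQuot Rel))
instance : Algebra Kq Uq := inferInstanceAs (Algebra Kq (RingQuot Rel))

namespace Uq

/-- The image of a generator in `U_q(sl₂)`. -/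
def gen (g : Gen) : Uq := RingQuot.mkAlgHom Kq Rel (FreeAlgebra.ι Kq g)

def e : Uq := gen .e
def f : Uq := gen .f
def k : Uq := gen .k
def kinv : Uq := gen .kinv

theorem k_mul_kinv : k * kinv = 1 := by
  have h := RingQuot.mkAlgHom_rel Kq Rel.k_kinv
  rw [map_mul, map_one] at h; exact h

theorem kinv_mul_k : kinv * k = 1 := by
  have h := RingQuot.mkAlgHom_rel Kq Rel.kinv_k
  rw [map_mul, map_one] at h; exact h

theorem k_e_kinv : k * e * kinv = q ^ (2 : ℤ) • e := by
  have h := RingQuot.mkAlgHom_rel Kq Rel.k_e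
  rw [map_mul, map_mul, map_smul] at h; exact h

theorem k_f_kinv : k * f * kinv = q ^ (-2 : ℤ) • f := by
  have h := RingQuot.mkAlgHom_rel Kq Rel.k_f
  rw [map_mul, map_mul, map_smul] at h; exact h

theorem e_f_comm : e * f - f * e = (q - q⁻¹)⁻¹ • (k - kinv) := by
  have h := RingQuot.mkAlgHom_rel Kq Rel.e_f
  rw [map_sub, map_mul, map_mul, map_smul, map_sub] at h; exact h

theorem k_mul_e : k * e = q ^ (2 : ℤ) • (e * k) := by
  calc k * e = k * e * (kinv * k) := by rw [kinv_mul_k, mul_one]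
    _ = (k * e * kinv) * k := by simp only [mul_assoc]
    _ = _ := by rw [k_e_kinv, smul_mul_assoc]

theorem k_mul_f : k * f = q ^ (-2 : ℤ) • (f * k) := by
  calc k * f = k * f * (kinv * k) := by rw [kinv_mul_k, mul_one]
    _ = (k * f * kinv) * k := by simp only [mul_assoc]
    _ = _ := by rw [k_f_kinv, smul_mul_assoc]

theorem e_mul_kinv : e * kinv = q ^ (2 : ℤ) • (kinv * e) := by
  calc e * kinv = (kinv * k) * e * kinv := by rw [kinv_mul_k, one_mul]
    _ = kinv * (k * e * kinv) := by simp only [mul_assoc]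
    _ = _ := by rw [k_e_kinv, mul_smul_comm]

theorem f_mul_kinv : f * kinv = q ^ (-2 : ℤ) • (kinv * f) := by
  calc f * kinv = (kinv * k) * f * kinv := by rw [kinv_mul_k, one_mul]
    _ = kinv * (k * f * kinv) := by simp only [mul_assoc]
    _ = _ := by rw [k_f_kinv, mul_smul_comm]

/-- The universal property of `U_q(sl₂)`: images `E, F, L, L'` of `e, f, k, k⁻¹` in a
`ℂ(q)`-algebra that satisfy the relations define an algebra homomorphism. -/
def lift {A : Type*} [Ring A] [Algebra Kq A] (E F L L' : A) (h₁ : L * L' = 1) (h₂ : L' * L = 1)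
    (h₃ : L * E * L' = q ^ (2 : ℤ) • E) (h₄ : L * F * L' = q ^ (-2 : ℤ) • F)
    (h₅ : E * F - F * E = (q - q⁻¹)⁻¹ • (L - L')) : Uq →ₐ[Kq] A :=
  RingQuot.liftAlgHom Kq
    ⟨FreeAlgebra.lift Kq (fun g => match g with | .e => E | .f => F | .k => L | .kinv => L'), by
      intro x y hxy
      cases hxy <;> simp only [map_mul, map_one, map_smul, map_sub, FreeAlgebra.lift_ι_apply] <;>
        assumption⟩

section lift

variable {A : Type*} [Ring A] [Algebra Kq A] (E F L L' : A) (h₁ : L * L' = 1) (h₂ : L' * L = 1)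
    (h₃ : L * E * L' = q ^ (2 : ℤ) • E) (h₄ : L * F * L' = q ^ (-2 : ℤ) • F)
    (h₅ : E * F - F * E = (q - q⁻¹)⁻¹ • (L - L'))

theorem lift_gen (g : Gen) : lift E F L L' h₁ h₂ h₃ h₄ h₅ (gen g) =
    (match g with | .e => E | .f => F | .k => L | .kinv => L') := by
  refine (RingQuot.liftAlgHom_mkAlgHom_apply Kq _ _ _).trans ?_
  rw [FreeAlgebra.lift_ι_apply]

@[simp] theorem lift_e : lift E F L L' h₁ h₂ h₃ h₄ h₅ e = E := lift_gen E F L L' h₁ h₂ h₃ h₄ h₅ .e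
@[simp] theorem lift_f : lift E F L L' h₁ h₂ h₃ h₄ h₅ f = F := lift_gen E F L L' h₁ h₂ h₃ h₄ h₅ .f
@[simp] theorem lift_k : lift E F L L' h₁ h₂ h₃ h₄ h₅ k = L := lift_gen E F L L' h₁ h₂ h₃ h₄ h₅ .k
@[simp] theorem lift_kinv : lift E F L L' h₁ h₂ h₃ h₄ h₅ kinv = L' :=
  lift_gen E F L L' h₁ h₂ h₃ h₄ h₅ .kinv

end lift

/-- `U_q(sl₂)` is generated by `e, f, k, k⁻¹` as a `ℂ(q)`-algebra, as an induction principle. -/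
theorem induction {P : Uq → Prop} (hc : ∀ c : Kq, P (algebraMap Kq Uq c)) (he : P e) (hf : P f)
    (hk : P k) (hk' : P kinv) (hadd : ∀ a b, P a → P b → P (a + b))
    (hmul : ∀ a b, P a → P b → P (a * b)) (u : Uq) : P u := by
  obtain ⟨x, rfl⟩ := RingQuot.mkAlgHom_surjective Kq Rel u
  induction x using FreeAlgebra.induction with
  | grade0 c => rw [AlgHom.commutes]; exact hc c
  | grade1 g => cases g <;> assumption
  | mul a b ha hb => rw [map_mul]; exact hmul _ _ ha hb
  | add a b ha hb => rw [map_add]; exact hadd _ _ ha hb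

/-- The quantum Casimir element `Ω = f e + (q k + q⁻¹ k⁻¹) / (q - q⁻¹)²`. -/
def casimir : Uq := f * e + ((q - q⁻¹) ^ 2)⁻¹ • (q • k + q⁻¹ • kinv)

/-- The comultiplication
`Δ e = e ⊗ 1 + k ⊗ e`, `Δ f = f ⊗ k⁻¹ + 1 ⊗ f`, `Δ k = k ⊗ k`, `Δ k⁻¹ = k⁻¹ ⊗ k⁻¹`. -/
def comul : Uq →ₐ[Kq] Uq ⊗[Kq] Uq :=
  lift (e ⊗ₜ 1 + k ⊗ₜ e) (f ⊗ₜ kinv + 1 ⊗ₜ f) (k ⊗ₜ k) (kinv ⊗ₜ kinv)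
    (by simp only [Algebra.TensorProduct.tmul_mul_tmul, k_mul_kinv,
      Algebra.TensorProduct.one_def])
    (by simp only [Algebra.TensorProduct.tmul_mul_tmul, kinv_mul_k,
      Algebra.TensorProduct.one_def])
    (by simp only [mul_add, add_mul, Algebra.TensorProduct.tmul_mul_tmul, mul_one, k_e_kinv,
      mul_assoc k k kinv, k_mul_kinv, smul_add, ← TensorProduct.smul_tmul',
      TensorProduct.tmul_smul])
    (by simp only [mul_add, add_mul, Algebra.TensorProduct.tmul_mul_tmul, k_mul_kinv, k_f_kinv,
      mul_one, one_mul, smul_add, ← TensorProduct.smul_tmul', TensorProduct.tmul_smul])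
    (by
      have hcross : (k * f) ⊗ₜ[Kq] (e * kinv) = (f * k) ⊗ₜ[Kq] (kinv * e) := by
        rw [k_mul_f, e_mul_kinv, TensorProduct.smul_tmul, smul_smul,
          ← zpow_add₀ q_ne_zero]
        simp
      have h1 : (e * f - f * e) ⊗ₜ[Kq] kinv + k ⊗ₜ[Kq] (e * f - f * e) =
          (q - q⁻¹)⁻¹ • (k ⊗ₜ[Kq] k - kinv ⊗ₜ[Kq] kinv) := by
        rw [e_f_comm, TensorProduct.tmul_smul, ← TensorProduct.smul_tmul', ← smul_add]
        congr 1
        simp only [TensorProduct.sub_tmul, TensorProduct.tmul_sub]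
        abel
      rw [← h1]
      simp only [mul_add, add_mul, Algebra.TensorProduct.tmul_mul_tmul, mul_one, one_mul,
        TensorProduct.sub_tmul, TensorProduct.tmul_sub, hcross]
      abel)

end Uq

/-! ## Weight spaces, tensor products, restricted duals -/

section modules

variable (M N : Type) [AddCommGroup M] [Module Kq M] [Module Uq M] [IsScalarTower Kq Uq M]
  [AddCommGroup N] [Module Kq N] [Module Uq N] [IsScalarTower Kq Uq N]

/-- The weight space `M_r = {m | k m = q ^ r m}`. -/
def weightSpace (r : ℤ) : Submodule Kq M where
  carrier := {m | Uq.k • m = q ^ r • m}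
  zero_mem' := by simp
  add_mem' := by
    intro a b ha hb
    simp only [Set.mem_ofPred_eq] at *
    rw [smul_add, ha, hb, smul_add]
  smul_mem' := by
    intro c a ha
    simp only [Set.mem_ofPred_eq] at *
    rw [← algebraMap_smul Uq c a, ← mul_smul, ← Algebra.commutes, mul_smul, ha, algebraMap_smul,
      algebraMap_smul, smul_comm]

/-- The tensor product `M ⊗ N` over `ℂ(q)`, as a `U_q(sl₂)`-module through the
comultiplication. -/
def Tens : Type := M ⊗[Kq] N

instance : AddCommGroup (Tens M N) := inferInstanceAs (AddCommGroup (M ⊗[Kq] N))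
instance : Module Kq (Tens M N) := inferInstanceAs (Module Kq (M ⊗[Kq] N))

/-- The action of `U_q(sl₂)` on `M ⊗ N`: the action of `U ⊗ U`, composed with `Δ`. -/
def tensAction : Uq →ₐ[Kq] Module.End Kq (M ⊗[Kq] N) :=
  (Module.endTensorEndAlgHom (R := Kq) (S := Kq) (A := Kq) (M := M) (N := N)).comp
    ((Algebra.TensorProduct.map (Algebra.lsmul Kq Kq M) (Algebra.lsmul Kq Kq N)).comp Uq.comul)

instance : Module Uq (Tens M N) := Module.compHom (M ⊗[Kq] N) (tensAction M N).toRingHom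

variable {M N} in
/-- The element `m ⊗ n` of `M ⊗ N`. -/
def Tens.mk (m : M) (n : N) : Tens M N := m ⊗ₜ[Kq] n

theorem tens_smul_def (u : Uq) (x : Tens M N) : u • x = (tensAction M N u : M ⊗[Kq] N → _) x := rfl

instance : IsScalarTower Kq Uq (Tens M N) where
  smul_assoc c u x := by
    rw [tens_smul_def, tens_smul_def, map_smul]
    rfl

variable {M N}

theorem e_smul_tens (m : M) (n : N) :
    Uq.e • Tens.mk m n = Tens.mk (Uq.e • m) n + Tens.mk (Uq.k • m) (Uq.e • n) := by
  have h : tensAction M N Uq.e (m ⊗ₜ n) = (Uq.e • m) ⊗ₜ n + (Uq.k • m) ⊗ₜ (Uq.e • n) := by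
    simp [tensAction, Uq.comul]
    rfl
  exact h

theorem f_smul_tens (m : M) (n : N) :
    Uq.f • Tens.mk m n = Tens.mk (Uq.f • m) (Uq.kinv • n) + Tens.mk m (Uq.f • n) := by
  have h : tensAction M N Uq.f (m ⊗ₜ n) = (Uq.f • m) ⊗ₜ (Uq.kinv • n) + m ⊗ₜ (Uq.f • n) := by
    simp [tensAction, Uq.comul]
    rfl
  exact h

theorem k_smul_tens (m : M) (n : N) :
    Uq.k • Tens.mk m n = Tens.mk (Uq.k • m) (Uq.k • n) := by
  have h : tensAction M N Uq.k (m ⊗ₜ n) = (Uq.k • m) ⊗ₜ (Uq.k • n) := by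
    simp [tensAction, Uq.comul]
    rfl
  exact h

end modules

/-- The ring automorphism `q ↦ q⁻¹` of `ℂ(q)` over `ℂ`. -/
def bar : Kq →+* Kq :=
  RatFunc.liftRingHom (Polynomial.aeval (q⁻¹ : Kq)).toRingHom (by
    intro p hp
    rw [Submonoid.mem_comap, mem_nonZeroDivisors_iff_ne_zero]
    have ht : Transcendental ℂ (q⁻¹ : Kq) := by
      rw [Transcendental, IsAlgebraic.inv_iff]
      exact RatFunc.transcendental_X
    intro h0
    exact nonZeroDivisors.ne_zero hp ((transcendental_iff.mp ht) p h0))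

theorem bar_q : bar q = q⁻¹ := by
  have h := RatFunc.liftRingHom_apply_div (L := Kq) (K := ℂ)
    (Polynomial.aeval (q⁻¹ : Kq)).toRingHom (by
      intro p hp
      rw [Submonoid.mem_comap, mem_nonZeroDivisors_iff_ne_zero]
      have ht : Transcendental ℂ (q⁻¹ : Kq) := by
        rw [Transcendental, IsAlgebraic.inv_iff]
        exact RatFunc.transcendental_X
      intro h0
      exact nonZeroDivisors.ne_zero hp ((transcendental_iff.mp ht) p h0)) Polynomial.X 1
  simp only [map_one, div_one, RatFunc.algebraMap_X] at h
  exact h.trans (Polynomial.aeval_X _)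

/-- The opposite algebra of `U_q(sl₂)`, with `ℂ(q)` acting through `q ↦ q⁻¹`. -/
def BarOp : Type := Uqᵐᵒᵖ

instance : Ring BarOp := inferInstanceAs (Ring Uqᵐᵒᵖ)
instance : Algebra Kq BarOp := Algebra.compHom Uqᵐᵒᵖ bar

/-- The identity map `U_q(sl₂) → BarOp`. -/
def toBar (u : Uq) : BarOp := MulOpposite.op u

theorem toBar_mul (u v : Uq) : toBar u * toBar v = toBar (v * u) := rfl
theorem toBar_sub (u v : Uq) : toBar u - toBar v = toBar (u - v) := rfl
theorem toBar_one : toBar 1 = 1 := rfl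
theorem smul_toBar (c : Kq) (u : Uq) : c • toBar u = toBar (bar c • u) := rfl

namespace Uq

/-- The antiautomorphism `σ`, as a homomorphism to the opposite algebra:
`σ e = f`, `σ f = e`, `σ k = k⁻¹`, `σ q = q⁻¹`. -/
def sigmaHom : Uq →ₐ[Kq] BarOp :=
  lift (toBar f) (toBar e) (toBar kinv) (toBar k)
    (by rw [toBar_mul, k_mul_kinv, toBar_one])
    (by rw [toBar_mul, kinv_mul_k, toBar_one])
    (by rw [toBar_mul, toBar_mul, smul_toBar, map_zpow₀, bar_q, inv_zpow', ← k_f_kinv, mul_assoc])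
    (by rw [toBar_mul, toBar_mul, smul_toBar, map_zpow₀, bar_q, inv_zpow', neg_neg, ← k_e_kinv,
      mul_assoc])
    (by
      rw [toBar_mul, toBar_mul, toBar_sub, toBar_sub, smul_toBar, e_f_comm, map_inv₀, map_sub,
        map_inv₀, bar_q, inv_inv, ← neg_sub q, ← neg_sub k, inv_neg (a := q - q⁻¹), neg_smul,
        smul_neg, neg_neg])

/-- The involutive antiautomorphism `σ` of `U_q(sl₂)`. -/
def sigma (u : Uq) : Uq := MulOpposite.unop (sigmaHom u : Uqᵐᵒᵖ)

theorem sigma_e : sigma e = f := by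
  unfold sigma sigmaHom; rw [lift_e]; rfl
theorem sigma_f : sigma f = e := by
  unfold sigma sigmaHom; rw [lift_f]; rfl
theorem sigma_k : sigma k = kinv := by
  unfold sigma sigmaHom; rw [lift_k]; rfl
theorem sigma_kinv : sigma kinv = k := by
  unfold sigma sigmaHom; rw [lift_kinv]; rfl
theorem sigma_one : sigma 1 = 1 := by
  unfold sigma; rw [map_one]; rfl
theorem sigma_zero : sigma 0 = 0 := by
  unfold sigma; rw [map_zero]; rfl
theorem sigma_add (u v : Uq) : sigma (u + v) = sigma u + sigma v := by
  unfold sigma; rw [map_add]; rfl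
theorem sigma_mul (u v : Uq) : sigma (u * v) = sigma v * sigma u := by
  unfold sigma; rw [map_mul]; rfl
theorem sigma_smul (c : Kq) (u : Uq) : sigma (c • u) = bar c • sigma u := by
  unfold sigma; rw [map_smul]; rfl
theorem sigma_algebraMap (c : Kq) : sigma (algebraMap Kq Uq c) = algebraMap Kq Uq (bar c) := by
  rw [Algebra.algebraMap_eq_smul_one, sigma_smul, sigma_one, ← Algebra.algebraMap_eq_smul_one]

end Uq

section duals

variable (M : Type) [AddCommGroup M] [Module Kq M] [Module Uq M] [IsScalarTower Kq Uq M]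

/-- The full dual `M^* = Hom(M, ℂ(q))`, with `u ∈ U_q(sl₂)` acting by
`(u φ)(m) = φ (σ(u) m)`. Since `σ q = q⁻¹`, a scalar `c ∈ ℂ(q) ⊆ U_q(sl₂)` acts as multiplication
by `bar c`. -/
def FullDual : Type := Module.Dual Kq M

variable {M} in
/-- The underlying functional of an element of the dual. -/
def FullDual.ev (φ : FullDual M) : M →ₗ[Kq] Kq := φ

instance : AddCommGroup (FullDual M) := inferInstanceAs (AddCommGroup (Module.Dual Kq M))
instance : Module Kq (FullDual M) := Module.compHom (Module.Dual Kq M) bar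

instance : Module Uq (FullDual M) where
  smul u φ := LinearMap.comp φ.ev (Algebra.lsmul Kq Kq M (Uq.sigma u))
  one_smul φ := by
    refine LinearMap.ext fun m => ?_
    change φ.ev (Uq.sigma 1 • m) = φ.ev m
    rw [Uq.sigma_one, one_smul]
  mul_smul u v φ := by
    refine LinearMap.ext fun m => ?_
    change φ.ev (Uq.sigma (u * v) • m) =
      φ.ev (Uq.sigma v • Uq.sigma u • m)
    rw [Uq.sigma_mul, mul_smul]
  smul_zero u := rfl
  smul_add u φ ψ := rfl
  add_smul u v φ := by
    refine LinearMap.ext fun m => ?_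
    change φ.ev (Uq.sigma (u + v) • m) =
      φ.ev (Uq.sigma u • m) + φ.ev (Uq.sigma v • m)
    rw [Uq.sigma_add, add_smul, map_add]
  zero_smul φ := by
    refine LinearMap.ext fun m => ?_
    change φ.ev (Uq.sigma 0 • m) = 0
    rw [Uq.sigma_zero, zero_smul, map_zero]

theorem fullDual_smul_apply (u : Uq) (φ : FullDual M) (m : M) :
    (u • φ : FullDual M).ev m = φ.ev (Uq.sigma u • m) := rfl

theorem fullDual_scalar_apply (c : Kq) (φ : FullDual M) (m : M) :
    (c • φ : FullDual M).ev m = bar c * φ.ev m := rfl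

instance : IsScalarTower Kq Uq (FullDual M) where
  smul_assoc c u φ := by
    refine LinearMap.ext fun m => ?_
    change φ.ev (Uq.sigma (c • u) • m) =
      bar c * φ.ev (Uq.sigma u • m)
    rw [Uq.sigma_smul, smul_assoc, map_smul, smul_eq_mul]

variable {M}

/-- `φ` vanishes on all but finitely many weight spaces. -/
def FinSupp (φ : FullDual M) : Prop :=
  {r : ℤ | ∃ m ∈ weightSpace M r, φ.ev m ≠ 0}.Finite

theorem kinv_smul_mem {r : ℤ} {m : M} (hm : m ∈ weightSpace M r) :
    Uq.kinv • m = q ^ (-r) • m := by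
  have hk : Uq.k • m = q ^ r • m := hm
  have h : Uq.kinv • Uq.k • m = m := by rw [← mul_smul, Uq.kinv_mul_k, one_smul]
  rw [hk, ← algebraMap_smul Uq (q ^ r) m, ← mul_smul, ← Algebra.commutes, mul_smul,
    algebraMap_smul] at h
  conv_rhs => rw [← h, smul_smul, ← zpow_add₀ q_ne_zero]
  simp

theorem shift_mem {x : Uq} {d : ℤ} (hx : Uq.k * x = q ^ d • (x * Uq.k)) {r : ℤ} {m : M}
    (hm : m ∈ weightSpace M r) : x • m ∈ weightSpace M (r + d) := by
  have hk : Uq.k • m = q ^ r • m := hm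
  change Uq.k • x • m = q ^ (r + d) • x • m
  rw [← mul_smul, hx, smul_assoc, mul_smul, hk, ← algebraMap_smul Uq (q ^ r) m, ← mul_smul,
    ← Algebra.commutes, mul_smul, algebraMap_smul, smul_smul, ← zpow_add₀ q_ne_zero, add_comm]

theorem FinSupp.shift {φ : FullDual M} (hφ : FinSupp φ) {u : Uq} (d : ℤ)
    (h : ∀ r, ∀ m ∈ weightSpace M r, Uq.sigma u • m ∈ weightSpace M (r + d)) :
    FinSupp (u • φ) := by
  refine Set.Finite.subset (Set.Finite.preimage (f := fun r : ℤ => r + d)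
    (add_left_injective d).injOn hφ) ?_
  rintro r ⟨m, hm, hne⟩
  exact ⟨_, h r m hm, hne⟩

theorem FinSupp.add {φ ψ : FullDual M} (hφ : FinSupp φ) (hψ : FinSupp ψ) : FinSupp (φ + ψ) := by
  refine Set.Finite.subset (Set.Finite.union hφ hψ) ?_
  rintro r ⟨m, hm, hne⟩
  by_cases h : φ.ev m = 0
  · right
    refine ⟨m, hm, fun h' => hne ?_⟩
    change φ.ev m + ψ.ev m = 0
    rw [h, h', add_zero]
  · exact Or.inl ⟨m, hm, h⟩

theorem FinSupp.smul {φ : FullDual M} (hφ : FinSupp φ) (u : Uq) : FinSupp (u • φ) := by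
  induction u using Uq.induction generalizing φ with
  | hc c =>
    refine hφ.shift 0 fun r m hm => ?_
    rw [Uq.sigma_algebraMap, algebraMap_smul, add_zero]
    exact Submodule.smul_mem _ _ hm
  | he => exact hφ.shift (-2) fun r m hm => by rw [Uq.sigma_e]; exact shift_mem Uq.k_mul_f hm
  | hf => exact hφ.shift 2 fun r m hm => by rw [Uq.sigma_f]; exact shift_mem Uq.k_mul_e hm
  | hk =>
    refine hφ.shift 0 fun r m hm => ?_
    rw [Uq.sigma_k, add_zero, kinv_smul_mem hm]
    exact Submodule.smul_mem _ _ hm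
  | hk' =>
    refine hφ.shift 0 fun r m hm => ?_
    have hk : Uq.k • m = q ^ r • m := hm
    rw [Uq.sigma_kinv, add_zero, hk]
    exact Submodule.smul_mem _ _ hm
  | hadd a b ha hb => rw [add_smul]; exact (ha hφ).add (hb hφ)
  | hmul a b ha hb => rw [mul_smul]; exact ha (hb hφ)

variable (M)

/-- The restricted dual `M^σ`: the functionals that vanish on all but finitely many weight
spaces. -/
def RestrictedDual : Submodule Uq (FullDual M) where
  carrier := {φ | FinSupp φ}
  zero_mem' := by
    refine Set.Finite.subset Set.finite_empty ?_
    rintro r ⟨m, _, hne⟩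
    exact hne rfl
  add_mem' := FinSupp.add
  smul_mem' u _ hφ := FinSupp.smul hφ u

end duals

/-! ## The modules `M(s)`, `V(s)`, `T(r)` -/

/-- The left ideal of relations of the Verma module `M(s)`: `e m = 0`, `k m = q ^ s m`. -/
def vermaRel (s : ℤ) : Submodule Uq Uq :=
  Submodule.span Uq {Uq.e, Uq.k - algebraMap Kq Uq (q ^ s)}

/-- The Verma module `M(s)`. -/
abbrev Verma (s : ℤ) : Type := Uq ⧸ vermaRel s

/-- The sum of all proper submodules of `M(s)`, which is its largest proper submodule. -/
def vermaMax (s : ℤ) : Submodule Uq (Verma s) := sSup {N | N ≠ ⊤}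

/-- `V(s)`, the unique irreducible quotient of `M(s)`. -/
abbrev SimpleMod (s : ℤ) : Type := Verma s ⧸ vermaMax s

/-- The Casimir eigenvalue `(q ^ (r + 1) + q ^ (- r - 1)) (q - q⁻¹) ^ (-2)`. -/
def casimirValue (r : ℤ) : Kq := (q ^ (r + 1) + q ^ (-r - 1)) * (q - q⁻¹) ^ (-2 : ℤ)

/-- The left ideal of relations of `T(r)`:
`e ^ (r + 2) t = 0`, `k t = q ^ (- r - 2) t`, `(Ω - casimirValue r) ^ 2 t = 0`. -/
def tiltRel (r : ℕ) : Submodule Uq Uq :=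
  Submodule.span Uq {Uq.e ^ (r + 2), Uq.k - algebraMap Kq Uq (q ^ (-(r : ℤ) - 2)),
    (Uq.casimir - algebraMap Kq Uq (casimirValue r)) ^ 2}

/-- The module `T(r)`, `r ≥ 0`. -/
abbrev TiltMod (r : ℕ) : Type := Uq ⧸ tiltRel r

/-! ## Indecomposables and multiplicities -/

/-- A nonzero module that is not the direct sum of two nonzero submodules. -/
def IsIndecomposable (M : Type) [AddCommGroup M] [Module Uq M] : Prop :=
  Nontrivial M ∧ ∀ N₁ N₂ : Submodule Uq M, IsCompl N₁ N₂ → N₁ = ⊥ ∨ N₂ = ⊥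

/-- Labels of the modules `V(r)`, `M(s)`, `M(r)^σ`, `T(r)` with `r ∈ ℕ`, `s ∈ ℤ`. -/
inductive Label : Type
  | V (r : ℕ)
  | M (s : ℤ)
  | Mσ (r : ℕ)
  | T (r : ℕ)

namespace Label

/-- The module with a given label. -/
def Mod : Label → Type
  | V r => SimpleMod r
  | M s => Verma s
  | Mσ r => RestrictedDual (Verma r)
  | T r => TiltMod r

instance : ∀ l : Label, AddCommGroup l.Mod
  | V r => inferInstanceAs (AddCommGroup (SimpleMod r))
  | M s => inferInstanceAs (AddCommGroup (Verma s))
  | Mσ r => inferInstanceAs (AddCommGroup (RestrictedDual (Verma r)))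
  | T r => inferInstanceAs (AddCommGroup (TiltMod r))

instance : ∀ l : Label, Module Kq l.Mod
  | V r => inferInstanceAs (Module Kq (SimpleMod r))
  | M s => inferInstanceAs (Module Kq (Verma s))
  | Mσ r => inferInstanceAs (Module Kq (RestrictedDual (Verma r)))
  | T r => inferInstanceAs (Module Kq (TiltMod r))

instance : ∀ l : Label, Module Uq l.Mod
  | V r => inferInstanceAs (Module Uq (SimpleMod r))
  | M s => inferInstanceAs (Module Uq (Verma s))
  | Mσ r => inferInstanceAs (Module Uq (RestrictedDual (Verma r)))
  | T r => inferInstanceAs (Module Uq (TiltMod r))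

instance : ∀ l : Label, IsScalarTower Kq Uq l.Mod
  | V r => inferInstanceAs (IsScalarTower Kq Uq (SimpleMod r))
  | M s => inferInstanceAs (IsScalarTower Kq Uq (Verma s))
  | Mσ r => inferInstanceAs (IsScalarTower Kq Uq (RestrictedDual (Verma r)))
  | T r => inferInstanceAs (IsScalarTower Kq Uq (TiltMod r))

/-- The effect of the duality `σ` on labels: `M(r) ↔ M(r)^σ` for `r ≥ 0`; the modules `V(r)`,
`T(r)` and `M(s)`, `s < 0`, are self-dual. -/
def dual : Label → Label
  | V r => V r
  | M (.ofNat r) => Mσ r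
  | M (.negSucc r) => M (.negSucc r)
  | Mσ r => M r
  | T r => T r

end Label

/-- The direct sum `⨁ X^{⊕ n(X)}` over all labels. -/
abbrev LabelSum (n : Label → ℕ) : Type := ⨁ i : (Σ l : Label, Fin (n l)), i.1.Mod

/-- `V ≅ ⨁ X^{⊕ n(X)}`, and the multiplicities `n(X)` are uniquely determined by `V`. -/
def HasMultiplicities (V : Type) [AddCommGroup V] [Module Uq V] (n : Label → ℕ) : Prop :=
  Nonempty (V ≃ₗ[Uq] LabelSum n) ∧
    ∀ n' : Label → ℕ, Nonempty (V ≃ₗ[Uq] LabelSum n') → n' = n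

/-- The coefficient of the index `j` in the formal sum `∑_{p ≥ 0} a(p) [d - 2 p]`. -/
def coeff (d : ℤ) (a : ℕ → ℕ) (j : ℤ) : ℕ :=
  if j ≤ d ∧ Even (d - j) then a ((d - j) / 2).toNat else 0

/-- The multiplicities in `⨁_{p ≥ 0} V(d - 2 p)^{⊕ a(p)}`. -/
def sumV (d : ℤ) (a : ℕ → ℕ) : Label → ℕ
  | .V r => coeff d a r
  | _ => 0

/-- The multiplicities in `⨁_{p ≥ 0} M(d - 2 p)^{⊕ a(p)}`. -/
def sumM (d : ℤ) (a : ℕ → ℕ) : Label → ℕ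
  | .M s => coeff d a s
  | _ => 0

/-- The multiplicities in `⨁_{p ≥ 0, d - 2 p ≥ -1} T(d - 2 p)^{⊕ a(p)}`, where
`T(-1) = M(-1)`. -/
def sumT (d : ℤ) (a : ℕ → ℕ) : Label → ℕ
  | .T r => coeff d a r
  | .M s => if s = -1 then coeff d a (-1) else 0
  | _ => 0

/-- The multiplicities of the indecomposable summands of `T(r) ⊗ M(s)`. -/
def multTM (r : ℕ) (s : ℤ) : Label → ℕ :=
  sumT ((r : ℤ) + s) (fun p =>
    if 2 * (p : ℤ) ≤ min (2 * (r : ℤ)) ((r : ℤ) + s + 1) then 1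
    else if 2 * (r : ℤ) + 2 ≤ 2 * (p : ℤ) ∧ 2 * (p : ℤ) ≤ (r : ℤ) + s + 1 then 2
    else 0) +
  sumM ((r : ℤ) + s) (fun p =>
    if 0 ≤ s then
      (if max (r : ℤ) s + 1 ≤ (p : ℤ) ∧ (p : ℤ) ≤ (r : ℤ) + s + 1 then 1
      else if (r : ℤ) + s + 2 ≤ (p : ℤ) then 2
      else 0)
    else
      (if (r : ℤ) + s + 2 ≤ (p : ℤ) ∧ p ≤ r then 1
      else if r + 1 ≤ p then 2
      else 0))

end

end QuantumSl2

open QuantumSl2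

/-!
Every module in question lies in the category of `U`-modules that have a basis of weight vectors,
with integral weights that are bounded above and have finite multiplicities (`InCatO`), and this
category is closed under tensor products. The theorem follows from a classification of its objects
and from numerical invariants that determine multiplicities.

*Decomposition.* Write `c_r` for the eigenvalue of the Casimir element `Ω` on `M(r)`. On vectors of
weight `r` one has `f e = Ω - c_r`, so that `f ^ n e ^ n` is a polynomial in `Ω`, and `c_a = c_b`
only if `b = a` or `b = -a-2`. Hence a homomorphism out of an object is injective if it is so on
singular vectors (`injective_of_sing`), and a submodule is everything if it contains all vectors of
weight `r` killed by `(Ω - c_r)²`, for all `r` (`submodule_eq_top`); for `r ≥ -1` these vectors are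
singular. For `t ≥ 0` what matters is therefore the pair of maps `F = f ^ (t + 1)`,
`E = e ^ (t + 1)` between the singular vectors of weight `t` and the vectors of weight `-t-2`
killed by `(Ω - c_t)²`. As `E F = 0`, linear algebra splits the pair into indecomposables of five
kinds (`exists_normalForm`), which correspond to `V(t)`, `M(t)`, `M(t)^σ`, `T(t)` and `M(-t-2)`.
Through the universal properties of these modules, every object is a direct sum of members of the family
(`exists_decomposition`).

*Multiplicities.* The dimensions of the weight spaces, of the kernel of `f` and of the cokernel of
`e` are sums over the summands. They determine the multiplicities as long as, for each `t`, at most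
one of `V(t)`, `M(t)`, `M(t)^σ` occurs, which is so if `f` is injective, if `e` is surjective, or if
the module is finite-dimensional (`Rigid`, `hasMultiplicities_of`, `equiv_of_rigid`). The
Krull-Schmidt theorem is not needed.

*Tensor products.* If `f` is injective on one factor, then it is injective on the tensor product,
and likewise for surjectivity of `e` (`FInj.tens_left`, `ESurj.tens_left`). Now `f` is injective on
`M(s)`, on `T(r)` and on `M(r)^σ / V(r)`, and `e` is surjective on `M(r)^σ`, on `T(r)` and on `M(s)`
for `s < 0`, in particular on the kernel `M(-r-2)` of `M(r) → V(r)`. So the kernel of `f` and the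
cokernel of `e` on `X ⊗ Y` vanish, or they are those of a tensor product `V(r) ⊗ V(s)`
(`tens_lowDim`, `tens_coDim`). In particular every `X ⊗ Y` satisfies `Rigid`, and what remains is to
count weights: `M(r) ⊗ N` has the weights that result from shifting those of `N` by
`r, r - 2, r - 4, …` (`wt_verma_tens`). The isomorphism `X ⊗ Y ≅ Y ⊗ X` and the statement on duals follow from the
symmetries of these dimensions (`tens_comm`, `tens_dual`).

*Indecomposability.* Every member of the family has a smallest nonzero submodule, generated by a
singular vector (`Label.exists_socle`).
-/

open scoped DirectSum TensorProduct
open QuantumSl2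

set_option linter.unusedSectionVars false

namespace QuantumSl2

noncomputable section

open Polynomial

/-! ### Powers of `q` and Casimir eigenvalues -/

theorem q_zpow_eq_one_iff {n : ℤ} : q ^ n = 1 ↔ n = 0 := by
  have hpos : ∀ m : ℕ, q ^ m = 1 → m = 0 := by
    intro m hm
    by_contra h0
    have ht : Transcendental ℂ (q : Kq) := RatFunc.transcendental_X
    refine ht ⟨X ^ m - 1, ?_, by simp [hm]⟩
    exact (monic_X_pow_sub_C (1 : ℂ) h0).ne_zero
  constructor
  · intro h
    obtain ⟨m, rfl | rfl⟩ := n.eq_nat_or_neg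
    · rw [zpow_natCast] at h; simp [hpos m h]
    · rw [zpow_neg, zpow_natCast, inv_eq_one] at h; simp [hpos m h]
  · rintro rfl; simp

theorem q_zpow_injective : Function.Injective fun n : ℤ => q ^ n := by
  intro a b h
  have h' : q ^ (a - b) = 1 := by
    rw [zpow_sub₀ q_ne_zero, div_eq_one_iff_eq (zpow_ne_zero _ q_ne_zero)]; exact h
  have := q_zpow_eq_one_iff.mp h'
  omega

theorem q_sub_inv_ne_zero : q - q⁻¹ ≠ 0 := by
  intro h
  have h1 : q ^ (1 : ℤ) = q ^ (-1 : ℤ) := by simpa [sub_eq_zero] using h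
  exact absurd (q_zpow_injective h1) (by norm_num)

/-- Casimir eigenvalues coincide exactly on the linkage classes `{a, -a - 2}`. -/
theorem casimirValue_eq_iff {a b : ℤ} : casimirValue a = casimirValue b ↔ a = b ∨ a = -b - 2 := by
  have hq := q_ne_zero
  have hne : (q - q⁻¹) ^ (-2 : ℤ) ≠ 0 := zpow_ne_zero _ q_sub_inv_ne_zero
  unfold casimirValue
  rw [mul_left_inj' hne]
  -- `x + x⁻¹ = y + y⁻¹` factors as `(x - y) (x y - 1) = 0`
  have key : q ^ (a + 1) + q ^ (-a - 1) = q ^ (b + 1) + q ^ (-b - 1) ↔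
      (q ^ (a + 1) - q ^ (b + 1)) * (q ^ (a + 1) * q ^ (b + 1) - 1) = 0 := by
    rw [show -a - 1 = -(a + 1) by ring, show -b - 1 = -(b + 1) by ring, zpow_neg, zpow_neg]
    have hx : q ^ (a + 1) ≠ 0 := zpow_ne_zero _ hq
    have hy : q ^ (b + 1) ≠ 0 := zpow_ne_zero _ hq
    generalize q ^ (a + 1) = x at *
    generalize q ^ (b + 1) = y at *
    field_simp
    constructor
    · intro h; linear_combination h
    · intro h; linear_combination h
  rw [key, mul_eq_zero, sub_eq_zero, sub_eq_zero, ← zpow_add₀ hq, q_zpow_eq_one_iff]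
  constructor
  · rintro (h | h)
    · have := q_zpow_injective h; omega
    · omega
  · rintro (h | h)
    · left; rw [h]
    · right; omega

theorem casimirValue_neg (a : ℤ) : casimirValue (-a - 2) = casimirValue a :=
  casimirValue_eq_iff.mpr (Or.inr rfl)

theorem casimirValue_sub (a : ℤ) :
    casimirValue a - casimirValue (a - 2) = (q - q⁻¹)⁻¹ * (q ^ a - q ^ (-a)) := by
  have hq := q_ne_zero
  have h2 := q_sub_inv_ne_zero
  have ha : q ^ a ≠ 0 := zpow_ne_zero _ hq
  unfold casimirValue
  rw [show -a - 1 = -a + -1 by ring, show a - 2 + 1 = a + -1 by ring,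
    show -(a - 2) - 1 = -a + 1 by ring, zpow_add₀ hq a, zpow_add₀ hq a, zpow_add₀ hq (-a),
    zpow_add₀ hq (-a), zpow_one, zpow_neg_one, zpow_neg _ (2 : ℤ), zpow_ofNat]
  generalize q ^ a = x at *
  generalize q ^ (-a) = y at *
  have h3 : (q - q⁻¹)⁻¹ = ((q - q⁻¹) ^ 2)⁻¹ * (q - q⁻¹) := by field_simp
  rw [h3]
  ring

/-! ### The Casimir element -/

namespace Uq

theorem k_mul_f_mul_e : k * (f * e) = f * e * k := by
  rw [← mul_assoc, k_mul_f, smul_mul_assoc, mul_assoc, k_mul_e, mul_smul_comm, smul_smul,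
    ← zpow_add₀ q_ne_zero, mul_assoc]
  simp

theorem kinv_mul_e : kinv * e = q ^ (-2 : ℤ) • (e * kinv) := by
  rw [e_mul_kinv, smul_smul, ← zpow_add₀ q_ne_zero]; simp

theorem kinv_mul_f : kinv * f = q ^ (2 : ℤ) • (f * kinv) := by
  rw [f_mul_kinv, smul_smul, ← zpow_add₀ q_ne_zero]; simp

/-- The second expression for the Casimir element,
`Ω = e f + (q⁻¹ k + q k⁻¹) / (q - q⁻¹)²`. -/
theorem casimir_eq : casimir = e * f + ((q - q⁻¹) ^ 2)⁻¹ • (q⁻¹ • k + q • kinv) := by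
  have h : e * f = f * e + (q - q⁻¹)⁻¹ • (k - kinv) := by rw [← e_f_comm]; abel
  have h2 := q_sub_inv_ne_zero
  have h3 : (q - q⁻¹)⁻¹ = ((q - q⁻¹) ^ 2)⁻¹ * (q - q⁻¹) := by
    field_simp
  rw [casimir, h, h3]
  simp only [smul_add, smul_sub, smul_smul, mul_sub, sub_smul]
  abel

theorem casimir_mul_e : casimir * e = e * casimir := by
  have h1 : casimir * e = e * f * e + ((q - q⁻¹) ^ 2)⁻¹ • (q • (e * k) + q⁻¹ • (e * kinv)) := by
    have hq := q_ne_zero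
    rw [casimir_eq, add_mul, smul_mul_assoc, add_mul, smul_mul_assoc, smul_mul_assoc, k_mul_e,
      kinv_mul_e, smul_smul, smul_smul]
    congr 4
    · rw [zpow_ofNat]; field_simp
    · rw [zpow_neg, zpow_ofNat]; field_simp
  rw [h1, casimir, mul_add, mul_smul_comm, mul_add, mul_smul_comm, mul_smul_comm, mul_assoc]

theorem casimir_mul_f : casimir * f = f * casimir := by
  have h1 : casimir * f = f * e * f + ((q - q⁻¹) ^ 2)⁻¹ • (q⁻¹ • (f * k) + q • (f * kinv)) := by
    have hq := q_ne_zero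
    rw [casimir, add_mul, smul_mul_assoc, add_mul, smul_mul_assoc, smul_mul_assoc, k_mul_f,
      kinv_mul_f, smul_smul, smul_smul]
    congr 4
    · rw [zpow_neg, zpow_ofNat]; field_simp
    · rw [zpow_ofNat]; field_simp
  rw [h1, casimir_eq, mul_add, mul_smul_comm, mul_add, mul_smul_comm, mul_smul_comm, mul_assoc]

theorem casimir_mul_k : casimir * k = k * casimir := by
  rw [casimir, add_mul, mul_add, k_mul_f_mul_e, smul_mul_assoc, mul_smul_comm, add_mul, mul_add]
  simp only [smul_mul_assoc, mul_smul_comm, k_mul_kinv, kinv_mul_k]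

theorem commute_kinv {u : Uq} (h : u * k = k * u) : u * kinv = kinv * u := by
  calc u * kinv = kinv * (k * u) * kinv := by rw [← mul_assoc, kinv_mul_k, one_mul]
    _ = kinv * u * (k * kinv) := by rw [← h]; simp only [mul_assoc]
    _ = _ := by rw [k_mul_kinv, mul_one]

theorem casimir_central (u : Uq) : casimir * u = u * casimir := by
  induction u using Uq.induction with
  | hc c => exact (Algebra.commutes c casimir).symm
  | he => exact casimir_mul_e
  | hf => exact casimir_mul_f
  | hk => exact casimir_mul_k
  | hk' => exact commute_kinv casimir_mul_k
  | hadd a b ha hb => rw [mul_add, add_mul, ha, hb]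
  | hmul a b ha hb => rw [← mul_assoc, ha, mul_assoc, hb, mul_assoc]

/-- Polynomials in the Casimir element are central. -/
theorem aeval_casimir_central (p : Kq[X]) (u : Uq) :
    aeval casimir p * u = u * aeval casimir p := by
  induction p using Polynomial.induction_on' with
  | add p r hp hr => rw [map_add, add_mul, mul_add, hp, hr]
  | monomial n c =>
    have h : Commute (casimir ^ n) u := (show Commute casimir u from casimir_central u).pow_left n
    rw [aeval_monomial, mul_assoc, h.eq, ← mul_assoc, Algebra.commutes, mul_assoc]

end Uq

/-! ### Weight vectors -/

section weights

variable {M N : Type} [AddCommGroup M] [Module Kq M] [Module Uq M] [IsScalarTower Kq Uq M]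
  [AddCommGroup N] [Module Kq N] [Module Uq N] [IsScalarTower Kq Uq N]

theorem mem_weightSpace {r : ℤ} {m : M} : m ∈ weightSpace M r ↔ Uq.k • m = q ^ r • m := Iff.rfl

theorem e_mem {r : ℤ} {m : M} (hm : m ∈ weightSpace M r) : Uq.e • m ∈ weightSpace M (r + 2) :=
  shift_mem Uq.k_mul_e hm

theorem f_mem {r : ℤ} {m : M} (hm : m ∈ weightSpace M r) : Uq.f • m ∈ weightSpace M (r - 2) :=
  shift_mem Uq.k_mul_f hm

theorem e_pow_mem {r : ℤ} {m : M} (hm : m ∈ weightSpace M r) (n : ℕ) :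
    Uq.e ^ n • m ∈ weightSpace M (r + 2 * n) := by
  induction n with
  | zero => simpa using hm
  | succ n ih =>
    rw [pow_succ', mul_smul]
    have := e_mem ih
    rwa [show r + 2 * (n : ℤ) + 2 = r + 2 * ((n + 1 : ℕ) : ℤ) by push_cast; ring] at this

theorem f_pow_mem {r : ℤ} {m : M} (hm : m ∈ weightSpace M r) (n : ℕ) :
    Uq.f ^ n • m ∈ weightSpace M (r - 2 * n) := by
  induction n with
  | zero => simpa using hm
  | succ n ih =>
    rw [pow_succ', mul_smul]
    have := f_mem ih
    rwa [show r - 2 * (n : ℤ) - 2 = r - 2 * ((n + 1 : ℕ) : ℤ) by push_cast; ring] at this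

theorem map_mem (φ : M →ₗ[Uq] N) {r : ℤ} {m : M} (hm : m ∈ weightSpace M r) :
    φ m ∈ weightSpace N r := by
  rw [mem_weightSpace] at *
  rw [← map_smul, hm]
  exact (φ.restrictScalars Kq).map_smul _ _

theorem central_mem {u : Uq} (hu : Uq.k * u = u * Uq.k) {r : ℤ} {m : M}
    (hm : m ∈ weightSpace M r) : u • m ∈ weightSpace M r := by
  rw [mem_weightSpace] at *
  rw [← mul_smul, hu, mul_smul, hm, smul_comm]

theorem aeval_casimir_mem (p : Kq[X]) {r : ℤ} {m : M} (hm : m ∈ weightSpace M r) :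
    aeval Uq.casimir p • m ∈ weightSpace M r :=
  central_mem (Uq.aeval_casimir_central p _).symm hm

/-- On vectors of weight `r` the operator `f e` is the Casimir element minus a scalar. -/
theorem f_e_smul {r : ℤ} {m : M} (hm : m ∈ weightSpace M r) :
    Uq.f • Uq.e • m = Uq.casimir • m - casimirValue r • m := by
  have hq := q_ne_zero
  have hk := mem_weightSpace.mp hm
  rw [Uq.casimir, add_smul, mul_smul, smul_assoc, add_smul, smul_assoc, smul_assoc,
    kinv_smul_mem hm, hk, smul_smul q, smul_smul q⁻¹, ← add_smul (q * _), smul_smul _ (_ + _) m]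
  have : ((q - q⁻¹) ^ 2)⁻¹ * (q * q ^ r + q⁻¹ * q ^ (-r)) = casimirValue r := by
    rw [casimirValue, zpow_add₀ hq, sub_eq_add_neg (-r), zpow_add₀ hq, zpow_neg _ (2 : ℤ),
      zpow_one, zpow_neg_one, zpow_ofNat]
    ring
  rw [this, add_sub_cancel_right]

theorem e_f_smul {r : ℤ} {m : M} (hm : m ∈ weightSpace M r) :
    Uq.e • Uq.f • m = Uq.casimir • m - casimirValue (r - 2) • m := by
  have h1 : Uq.e • Uq.f • m = Uq.f • Uq.e • m + (q - q⁻¹)⁻¹ • (q ^ r • m - q ^ (-r) • m) := by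
    rw [← mem_weightSpace.mp hm, ← kinv_smul_mem hm, ← sub_smul, ← smul_assoc _ (_ - _),
      ← Uq.e_f_comm, sub_smul, mul_smul, mul_smul]
    abel
  rw [h1, f_e_smul hm, ← sub_smul, smul_smul, ← casimirValue_sub, sub_smul]
  abel

theorem casimir_smul_comm (u : Uq) (m : M) : Uq.casimir • u • m = u • Uq.casimir • m := by
  rw [← mul_smul, Uq.casimir_central, mul_smul]

theorem aeval_smul_comm (p : Kq[X]) (u : Uq) (m : M) :
    aeval Uq.casimir p • u • m = u • aeval Uq.casimir p • m := by
  rw [← mul_smul, Uq.aeval_casimir_central, mul_smul]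

theorem e_smul_kq (c : Kq) (m : M) (u : Uq) : u • c • m = c • u • m := smul_comm u c m

theorem X_sub_C_smul (c : Kq) (m : M) :
    aeval Uq.casimir (X - C c) • m = Uq.casimir • m - c • m := by
  rw [map_sub, aeval_X, aeval_C, sub_smul, algebraMap_smul]

/-- The polynomial with roots `c_r, c_{r+2}, …, c_{r+2(n-1)}`. -/
def casimirPoly (r : ℤ) (n : ℕ) : Kq[X] :=
  ∏ j ∈ Finset.range n, (X - C (casimirValue (r + 2 * j)))

/-- On vectors of weight `r` the operator `f ^ n e ^ n` is a polynomial in the Casimir element. -/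
theorem f_pow_e_pow {r : ℤ} {m : M} (hm : m ∈ weightSpace M r) (n : ℕ) :
    Uq.f ^ n • Uq.e ^ n • m = aeval Uq.casimir (casimirPoly r n) • m := by
  induction n with
  | zero => simp [casimirPoly]
  | succ n ih =>
    rw [pow_succ, pow_succ', mul_smul, mul_smul, f_e_smul (e_pow_mem hm n), ← X_sub_C_smul,
      ← aeval_smul_comm, ih, ← mul_smul, ← map_mul, mul_comm, casimirPoly, casimirPoly,
      Finset.prod_range_succ]

/-- If coprime polynomials in the Casimir element kill `x`, then `x = 0`. -/
theorem eq_zero_of_aeval {p : Kq[X]} {c : Kq} (hp : p.eval c ≠ 0) {x : M}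
    (h1 : aeval Uq.casimir p • x = 0) {m : ℕ} (h2 : aeval Uq.casimir ((X - C c) ^ m) • x = 0) :
    x = 0 := by
  have hco : IsCoprime p ((X - C c) ^ m) := by
    refine IsCoprime.pow_right ?_
    obtain ⟨g, hg⟩ := X_sub_C_dvd_sub_C_eval (a := c) (p := p)
    refine ⟨C (p.eval c)⁻¹, -(C (p.eval c)⁻¹ * g), ?_⟩
    have h1 : C (p.eval c)⁻¹ * C (p.eval c) = 1 := by rw [← C_mul, inv_mul_cancel₀ hp, C_1]
    linear_combination h1 + C (p.eval c)⁻¹ * hg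
  obtain ⟨a, b, hab⟩ := hco
  have := congrArg (fun r => aeval Uq.casimir r • x) hab
  simp only [map_add, map_mul, add_smul, mul_smul, h1, h2, smul_zero, add_zero, map_one,
    one_smul] at this
  exact this.symm

theorem casimirPoly_eval_ne_zero {r : ℤ} {n : ℕ} {c : Kq}
    (h : ∀ j < n, casimirValue (r + 2 * j) ≠ c) : (casimirPoly r n).eval c ≠ 0 := by
  rw [casimirPoly, eval_prod, Finset.prod_ne_zero_iff]
  intro j hj
  rw [eval_sub, eval_X, eval_C, sub_ne_zero]
  exact (h j (Finset.mem_range.mp hj)).symm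

/-- A weight vector that is killed by a power of `e` and lies in a generalized eigenspace of the
Casimir element vanishes unless the eigenvalue is one of those that its weight allows. -/
theorem eq_zero_of_e_pow {r : ℤ} {n m : ℕ} {c : Kq} {x : M} (hx : x ∈ weightSpace M r)
    (he : Uq.e ^ n • x = 0) (hc : aeval Uq.casimir ((X - C c) ^ m) • x = 0)
    (h : ∀ j < n, casimirValue (r + 2 * j) ≠ c) : x = 0 := by
  refine eq_zero_of_aeval (casimirPoly_eval_ne_zero h) ?_ hc
  rw [← f_pow_e_pow hx, he, smul_zero]

/-- A weight vector killed by `e`. -/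
def IsSing (r : ℤ) (x : M) : Prop := x ∈ weightSpace M r ∧ Uq.e • x = 0

theorem IsSing.casimir {r : ℤ} {x : M} (hx : IsSing r x) :
    Uq.casimir • x = casimirValue r • x := by
  have := f_e_smul hx.1
  rw [hx.2, smul_zero] at this
  exact (sub_eq_zero.mp this.symm)

theorem IsSing.map (φ : M →ₗ[Uq] N) {r : ℤ} {x : M} (hx : IsSing r x) : IsSing r (φ x) :=
  ⟨map_mem φ hx.1, by rw [← map_smul, hx.2, map_zero]⟩

theorem IsSing.e_f_pow {r : ℤ} {x : M} (hx : IsSing r x) (n : ℕ) :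
    Uq.e • Uq.f ^ (n + 1) • x =
      (casimirValue r - casimirValue (r - 2 * (n + 1))) • Uq.f ^ n • x := by
  rw [pow_succ', mul_smul, e_f_smul (f_pow_mem hx.1 n), casimir_smul_comm, hx.casimir,
    smul_comm, sub_smul]
  congr 3
  ring_nf

/-- The singular vector that generates `M(-r-2)` in `M(r)`. -/
theorem IsSing.f_pow {r : ℕ} {x : M} (hx : IsSing (r : ℤ) x) :
    IsSing (-(r : ℤ) - 2) (Uq.f ^ (r + 1) • x) := by
  refine ⟨?_, ?_⟩
  · have := f_pow_mem hx.1 (r + 1)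
    rwa [show (r : ℤ) - 2 * ((r + 1 : ℕ) : ℤ) = -r - 2 by push_cast; ring] at this
  · rw [hx.e_f_pow, show (r : ℤ) - 2 * (r + 1) = -r - 2 by ring, casimirValue_neg, sub_self,
      zero_smul]

theorem IsSing.e_pow_f_pow {r : ℤ} {x : M} (hx : IsSing r x) (n : ℕ) :
    Uq.e ^ n • Uq.f ^ n • x =
      (∏ j ∈ Finset.range n, (casimirValue r - casimirValue (r - 2 * (j + 1)))) • x := by
  induction n with
  | zero => simp
  | succ n ih =>
    rw [pow_succ, mul_smul, hx.e_f_pow, smul_comm, ih, smul_smul, Finset.prod_range_succ]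
    congr 1; ring

/-! ### Decomposition into weight vectors -/

theorem weightSpace_eq_eigenspace (r : ℤ) :
    weightSpace M r = Module.End.eigenspace (Algebra.lsmul Kq Kq M Uq.k) (q ^ r) := by
  ext m
  rw [Module.End.mem_eigenspace_iff]
  rfl

theorem iSupIndep_weightSpace : iSupIndep (weightSpace M) := by
  have h := (Module.End.eigenspaces_iSupIndep (Algebra.lsmul Kq Kq M Uq.k)).comp q_zpow_injective
  convert h using 1
  ext1 r
  exact weightSpace_eq_eigenspace r

theorem eq_zero_of_sum_weight {s : Finset ℤ} {y : ℤ → M} (hy : ∀ r, y r ∈ weightSpace M r)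
    (h : ∑ r ∈ s, y r = 0) : ∀ r ∈ s, y r = 0 :=
  fun r hr => (iSupIndep_iff_finsetSum_eq_zero_imp_eq_zero (weightSpace M)).mp
    iSupIndep_weightSpace s (fun r => y r) (fun r _ => hy r) h r hr

/-- Every element is a sum of weight vectors. -/
def WeightSpanned (M : Type) [AddCommGroup M] [Module Kq M] [Module Uq M] [IsScalarTower Kq Uq M] :
    Prop := ⨆ r, weightSpace M r = ⊤

theorem WeightSpanned.exists_sum (h : WeightSpanned M) (x : M) :
    ∃ (s : Finset ℤ) (y : ℤ → M), (∀ r, y r ∈ weightSpace M r) ∧ x = ∑ r ∈ s, y r := by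
  have hx : x ∈ ⨆ r, weightSpace M r := by rw [show ⨆ r, weightSpace M r = ⊤ from h]; trivial
  obtain ⟨g, hg, hs⟩ := (Submodule.mem_iSup_iff_exists_finsupp _ _).mp hx
  exact ⟨g.support, g, hg, hs.symm⟩

/-- Every element is killed by a power of `e`. -/
def ENilpotent (M : Type) [AddCommGroup M] [Module Uq M] : Prop := ∀ x : M, ∃ n, Uq.e ^ n • x = 0

/-- Below a nonzero weight vector lies a nonzero singular vector: apply `e` until the next
application gives zero. -/
theorem exists_last_e {P : M → Prop} {x : M} {n : ℕ} (hx : ¬ P x) (hn : P (Uq.e ^ n • x)) :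
    ∃ j, ¬ P (Uq.e ^ j • x) ∧ P (Uq.e • Uq.e ^ j • x) := by
  classical
  have hex : ∃ n, P (Uq.e ^ n • x) := ⟨n, hn⟩
  have h0 : Nat.find hex ≠ 0 := by
    intro h0
    have := Nat.find_spec hex
    rw [h0, pow_zero, one_smul] at this
    exact hx this
  obtain ⟨j, hj⟩ := Nat.exists_eq_succ_of_ne_zero h0
  refine ⟨j, Nat.find_min hex (by omega), ?_⟩
  have := Nat.find_spec hex
  rwa [hj, Nat.succ_eq_add_one, pow_succ', mul_smul] at this

/-- A submodule that contains no nonzero singular vector is zero. -/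
theorem submodule_eq_bot (hs : WeightSpanned M) (he : ENilpotent M) (P : Submodule Uq M)
    (h : ∀ r x, IsSing r x → x ∈ P → x = 0) : P = ⊥ := by
  rw [eq_bot_iff]
  intro x hx
  obtain ⟨s, y, hy, rfl⟩ := hs.exists_sum x
  -- the weight components of `x` lie in `P`, since they do so modulo `P`
  have hyP : ∀ r ∈ s, y r ∈ P := by
    intro r hr
    rw [← Submodule.Quotient.mk_eq_zero]
    refine eq_zero_of_sum_weight (M := M ⧸ P) (s := s) (y := fun r => P.mkQ (y r))
      (fun r => map_mem _ (hy r)) ?_ r hr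
    rw [← map_sum]
    exact (Submodule.Quotient.mk_eq_zero P).mpr hx
  refine Submodule.sum_mem _ fun r hr => ?_
  by_contra hne
  obtain ⟨n, hn⟩ := he (y r)
  obtain ⟨j, hj, hj'⟩ := exists_last_e (P := fun x => x = 0) hne hn
  exact hj (h _ _ ⟨e_pow_mem (hy r) j, hj'⟩ (P.smul_mem _ (hyP r hr)))

/-- A homomorphism is injective if it is so on singular vectors. -/
theorem injective_of_sing (hs : WeightSpanned M) (he : ENilpotent M) (φ : M →ₗ[Uq] N)
    (h : ∀ r x, IsSing r x → φ x = 0 → x = 0) : Function.Injective φ :=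
  LinearMap.ker_eq_bot.mp (submodule_eq_bot hs he _ fun r x hx hφ => h r x hx hφ)

/-- The vectors of weight `r` that `(Ω - c_r)²` kills, where `c_r` is the Casimir eigenvalue on
`M(r)`. In category `𝒪` they are the images of the generator of `M(r)` if `r ≥ -1`, of `T(-r-2)` if
`r ≤ -2`. -/
def IsGen (r : ℤ) (x : M) : Prop :=
  x ∈ weightSpace M r ∧ aeval Uq.casimir ((X - C (casimirValue r)) ^ 2) • x = 0

/-- A submodule that contains all the generators `IsGen` is everything: a weight vector outside of
it can be moved by `e` to one that is singular modulo the submodule, and a polynomial in the Casimir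
element turns this one into a generator. -/
theorem submodule_eq_top (hs : WeightSpanned M) (he : ENilpotent M) (P : Submodule Uq M)
    (h : ∀ r x, IsGen r x → x ∈ P) : P = ⊤ := by
  classical
  have hw : ∀ r x, x ∈ weightSpace M r → x ∈ P := by
    intro r x hx
    by_contra hne
    obtain ⟨n, hn⟩ := he x
    obtain ⟨j, hj, hj'⟩ := exists_last_e (P := fun x => x ∈ P) hne
      (show Uq.e ^ n • x ∈ P by rw [hn]; exact P.zero_mem)
    have hy : Uq.e ^ j • x ∈ weightSpace M (r + 2 * j) := e_pow_mem hx j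
    generalize Uq.e ^ j • x = y at hj hj' hy
    generalize r + 2 * (j : ℤ) = μ at hy
    obtain ⟨N, hN⟩ := he y
    -- modulo `P` the Casimir element acts on `y` by `c`, where `c = c_μ`
    set c := casimirValue μ with hc
    have hmod : ∀ p : Kq[X], aeval Uq.casimir p • y - p.eval c • y ∈ P := by
      intro p
      obtain ⟨g, hg⟩ := X_sub_C_dvd_sub_C_eval (a := c) (p := p)
      have h1 : aeval Uq.casimir p • y - p.eval c • y =
          aeval Uq.casimir g • (Uq.casimir • y - c • y) := by
        rw [← X_sub_C_smul, ← mul_smul, ← map_mul, mul_comm, ← hg, map_sub, aeval_C, sub_smul,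
          algebraMap_smul]
      rw [h1, ← f_e_smul hy]
      exact P.smul_mem _ (P.smul_mem _ hj')
    -- remove the factors with a root other than `c`; at most two factors remain
    set A := (Finset.range N).filter fun i : ℕ => casimirValue (μ + 2 * i) ≠ c with hA
    set B := (Finset.range N).filter fun i : ℕ => ¬ casimirValue (μ + 2 * i) ≠ c with hB
    set g : Kq[X] := ∏ i ∈ A, (X - C (casimirValue (μ + 2 * i))) with hgdef
    have hg0 : g.eval c ≠ 0 := by
      rw [hgdef, eval_prod, Finset.prod_ne_zero_iff]
      intro i hi
      rw [eval_sub, eval_X, eval_C, sub_ne_zero]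
      exact (Finset.mem_filter.mp hi).2.symm
    have hBc : B.card ≤ 2 := by
      have hsub : B ⊆ {0, (-μ - 1).toNat} := by
        intro i hi
        have h2 := (Finset.mem_filter.mp hi).2
        rw [not_not, hc, casimirValue_eq_iff] at h2
        simp only [Finset.mem_insert, Finset.mem_singleton]
        omega
      exact (Finset.card_le_card hsub).trans Finset.card_le_two
    have hprod : casimirPoly μ N = (X - C c) ^ B.card * g := by
      rw [casimirPoly, ← Finset.prod_filter_mul_prod_filter_not (Finset.range N)
        (fun i : ℕ => casimirValue (μ + 2 * i) ≠ c), mul_comm]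
      congr 1
      rw [← Finset.prod_const]
      refine Finset.prod_congr rfl fun i hi => ?_
      rw [not_not.mp (Finset.mem_filter.mp hi).2]
    have hgen : IsGen μ (aeval Uq.casimir g • y) := by
      refine ⟨aeval_casimir_mem g hy, ?_⟩
      rw [← mul_smul, ← map_mul,
        show (X - C (casimirValue μ)) ^ 2 * g =
          (X - C c) ^ (2 - B.card) * casimirPoly μ N by
            rw [hprod, ← mul_assoc, ← pow_add]; congr 2; exact (Nat.sub_add_cancel hBc).symm,
        map_mul, mul_smul, ← f_pow_e_pow hy, hN, smul_zero, smul_zero]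
    have h1 := h _ _ hgen
    have h2 : g.eval c • y ∈ P := by
      have := P.sub_mem h1 (hmod g)
      rwa [sub_sub_cancel] at this
    apply hj
    have h3 := P.smul_mem (algebraMap Kq Uq (g.eval c)⁻¹) h2
    rwa [algebraMap_smul, smul_smul, inv_mul_cancel₀ hg0, one_smul] at h3
  rw [eq_top_iff]
  intro x _
  obtain ⟨s, y, hy, rfl⟩ := hs.exists_sum x
  exact Submodule.sum_mem _ fun r _ => hw r _ (hy r)

/-- For `r ≥ -1` the generators `IsGen` are singular. -/
theorem IsGen.isSing (he : ENilpotent M) {r : ℤ} (hr : -1 ≤ r) {x : M} (hx : IsGen r x) :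
    IsSing r x := by
  refine ⟨hx.1, ?_⟩
  obtain ⟨n, hn⟩ := he (Uq.e • x)
  refine eq_zero_of_e_pow (e_mem hx.1) hn (c := casimirValue r) (m := 2) ?_ ?_
  · rw [aeval_smul_comm, hx.2, smul_zero]
  · intro j _
    rw [Ne, casimirValue_eq_iff]
    omega

theorem IsGen.e_pow (he : ENilpotent M) {t : ℕ} {x : M} (hx : IsGen (-(t : ℤ) - 2) x) :
    Uq.e ^ (t + 2) • x = 0 := by
  obtain ⟨n, hn⟩ := he (Uq.e ^ (t + 2) • x)
  refine eq_zero_of_e_pow (e_pow_mem hx.1 _) hn (c := casimirValue (-(t : ℤ) - 2)) (m := 2) ?_ ?_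
  · rw [aeval_smul_comm, hx.2, smul_zero]
  · intro j _
    rw [Ne, casimirValue_eq_iff]
    push_cast
    omega

/-- A generator of weight `-t-2` killed by `e ^ (t + 1)` is already killed by `e`. -/
theorem IsGen.isSing_of_e_pow {t : ℕ} {x : M} (hx : IsGen (-(t : ℤ) - 2) x)
    (h : Uq.e ^ (t + 1) • x = 0) : IsSing (-(t : ℤ) - 2) x := by
  refine ⟨hx.1, ?_⟩
  rw [pow_succ, mul_smul] at h
  refine eq_zero_of_e_pow (e_mem hx.1) h (c := casimirValue (-(t : ℤ) - 2)) (m := 2) ?_ ?_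
  · rw [aeval_smul_comm, hx.2, smul_zero]
  · intro j hj
    rw [Ne, casimirValue_eq_iff]
    omega

theorem IsSing.isGen {r : ℤ} {x : M} (hx : IsSing r x) : IsGen r x := by
  refine ⟨hx.1, ?_⟩
  rw [pow_succ, map_mul, mul_smul, X_sub_C_smul, hx.casimir, sub_self, smul_zero]

end weights

/-! ### Bases of weight vectors -/

section bases

variable {M N : Type} [AddCommGroup M] [Module Kq M] [Module Uq M] [IsScalarTower Kq Uq M]
  [AddCommGroup N] [Module Kq N] [Module Uq N] [IsScalarTower Kq Uq N]

/-- `b` consists of weight vectors, of weights `w`. -/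
def IsWeightBasis {ι : Type} (b : Module.Basis ι Kq M) (w : ι → ℤ) : Prop :=
  ∀ i, b i ∈ weightSpace M (w i)

/-- The weights `w` are bounded above and have finite multiplicities. -/
structure Admissible {ι : Type} (w : ι → ℤ) : Prop where
  finite : ∀ r, Finite {i // w i = r}
  bdd : ∃ N, ∀ i, w i ≤ N

theorem zpow_smul_eq {r s : ℤ} {c : Kq} (h : q ^ r * c = q ^ s * c) (hrs : r ≠ s) : c = 0 := by
  by_contra hc
  exact hrs (q_zpow_injective (mul_right_cancel₀ hc h))

theorem lsmul_apply' (u : Uq) (x : M) : Algebra.lsmul Kq Kq M u x = u • x := rfl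

namespace IsWeightBasis

variable {ι : Type} {b : Module.Basis ι Kq M} {w : ι → ℤ}

theorem repr_k (hb : IsWeightBasis b w) (x : M) (i : ι) :
    b.repr (Uq.k • x) i = q ^ w i * b.repr x i := by
  have h : (b.coord i).comp (Algebra.lsmul Kq Kq M Uq.k) = q ^ w i • b.coord i := by
    classical
    refine b.ext fun j => ?_
    rw [LinearMap.comp_apply, lsmul_apply', mem_weightSpace.mp (hb j), map_smul,
      LinearMap.smul_apply, Module.Basis.coord_apply, b.repr_self, Finsupp.single_apply]
    split_ifs with hij
    · rw [hij]
    · simp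
  exact LinearMap.congr_fun h x

theorem repr_eq_zero (hb : IsWeightBasis b w) {r : ℤ} {x : M} (hx : x ∈ weightSpace M r) {i : ι}
    (hi : w i ≠ r) : b.repr x i = 0 := by
  have h := hb.repr_k x i
  rw [mem_weightSpace.mp hx, map_smul, Finsupp.smul_apply, smul_eq_mul] at h
  exact zpow_smul_eq h.symm hi

theorem spanned (hb : IsWeightBasis b w) : WeightSpanned M := by
  rw [WeightSpanned, eq_top_iff, ← b.span_eq, Submodule.span_le]
  rintro _ ⟨i, rfl⟩
  exact Submodule.mem_iSup_of_mem (w i) (hb i)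

theorem eNilpotent (hb : IsWeightBasis b w) (hw : Admissible w) : ENilpotent M := by
  obtain ⟨N, hN⟩ := hw.bdd
  intro x
  induction b.mem_span x using Submodule.span_induction with
  | zero => exact ⟨0, smul_zero _⟩
  | smul c x _ h =>
    obtain ⟨n, hn⟩ := h
    exact ⟨n, by rw [smul_comm, hn, smul_zero]⟩
  | add x y _ _ hx hy =>
    obtain ⟨n, hn⟩ := hx
    obtain ⟨m, hm⟩ := hy
    refine ⟨n + m, ?_⟩
    rw [smul_add, pow_add, mul_smul _ _ y, hm, smul_zero, add_zero, ← pow_add, add_comm, pow_add,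
      mul_smul, hn, smul_zero]
  | mem x hx =>
    obtain ⟨i, rfl⟩ := hx
    refine ⟨(N - w i).toNat + 1, ?_⟩
    have h := e_pow_mem (hb i) ((N - w i).toNat + 1)
    refine b.ext_elem fun j => ?_
    rw [hb.repr_eq_zero h, map_zero, Finsupp.zero_apply]
    have := hN j
    have := hN i
    push_cast
    omega

theorem mem_of_eq (hb : IsWeightBasis b w) {r : ℤ} {i : ι} (h : w i = r) :
    b i ∈ weightSpace M r := h ▸ hb i

/-- The weight vectors of weight `r` in the basis form a basis of the weight space. -/
def weightBasis (hb : IsWeightBasis b w) (r : ℤ) :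
    Module.Basis {i // w i = r} Kq (weightSpace M r) :=
  Module.Basis.mk (v := fun i : {i // w i = r} => ⟨b i, hb.mem_of_eq i.2⟩)
    (by
      refine LinearIndependent.of_comp (weightSpace M r).subtype ?_
      exact b.linearIndependent.comp _ Subtype.val_injective)
    (by
      rintro ⟨x, hx⟩ -
      have hsum := b.linearCombination_repr x
      rw [Finsupp.linearCombination_apply, Finsupp.sum] at hsum
      have hs : ∀ i ∈ (b.repr x).support, w i = r := fun i hi => by
        by_contra h
        exact (Finsupp.mem_support_iff.mp hi) (hb.repr_eq_zero hx h)
      have : (⟨x, hx⟩ : weightSpace M r) = ∑ i : (b.repr x).support,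
          b.repr x i • (⟨b i, hb.mem_of_eq (hs i i.2)⟩ : weightSpace M r) := by
        ext
        rw [AddSubmonoidClass.coe_finsetSum]
        exact hsum.symm.trans (Finset.sum_coe_sort (b.repr x).support
          (fun i => b.repr x i • b i)).symm
      rw [this]
      exact Submodule.sum_mem _ fun i _ => Submodule.smul_mem _ _
        (Submodule.subset_span ⟨⟨i, hs i i.2⟩, rfl⟩))

/-- In a submodule, the components with respect to a multiplicity free weight basis lie in the
submodule. -/
theorem repr_smul_mem (hb : IsWeightBasis b w) (hw : Function.Injective w) (P : Submodule Uq M)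
    {x : M} (hx : x ∈ P) (i : ι) : b.repr x i • b i ∈ P := by
  have hind := (iSupIndep_weightSpace (M := M ⧸ P)).comp hw
  by_cases hi : i ∈ (b.repr x).support
  · rw [← Submodule.Quotient.mk_eq_zero]
    refine (iSupIndep_iff_finsetSum_eq_zero_imp_eq_zero _).mp hind (b.repr x).support
      (fun i => P.mkQ (b.repr x i • b i))
      (fun j _ => map_mem _ (Submodule.smul_mem _ _ (hb j))) ?_ i hi
    rw [← map_sum]
    refine (Submodule.Quotient.mk_eq_zero P).mpr ?_
    have hsum := b.linearCombination_repr x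
    rw [Finsupp.linearCombination_apply, Finsupp.sum] at hsum
    rwa [hsum]
  · rw [Finsupp.notMem_support_iff.mp hi, zero_smul]
    exact P.zero_mem

end IsWeightBasis

/-- The dimension of a weight space. -/
def wt (M : Type) [AddCommGroup M] [Module Kq M] [Module Uq M] [IsScalarTower Kq Uq M] (r : ℤ) :
    ℕ := Module.finrank Kq (weightSpace M r)

/-- The multiplicity of the weight `r` in the family `w` of weights. -/
def cnt {ι : Type} (w : ι → ℤ) (r : ℤ) : ℕ := Nat.card {i // w i = r}

theorem IsWeightBasis.wt_eq {ι : Type} {b : Module.Basis ι Kq M} {w : ι → ℤ}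
    (hb : IsWeightBasis b w) : wt M = cnt w :=
  funext fun r => Module.finrank_eq_nat_card_basis (hb.weightBasis r)

/-- `M` has a basis of weight vectors of weights `w`, and these are bounded above with finite
multiplicities. -/
def HasWeights (M : Type) [AddCommGroup M] [Module Kq M] [Module Uq M] [IsScalarTower Kq Uq M]
    {ι : Type} (w : ι → ℤ) : Prop :=
  Admissible w ∧ ∃ b : Module.Basis ι Kq M, IsWeightBasis b w

/-- The modules of category `𝒪` with integral weights and finite-dimensional weight spaces. -/
def InCatO (M : Type) [AddCommGroup M] [Module Kq M] [Module Uq M] [IsScalarTower Kq Uq M] :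
    Prop := ∃ (ι : Type) (w : ι → ℤ), HasWeights M w

theorem HasWeights.wt_eq {ι : Type} {w : ι → ℤ} (h : HasWeights M w) : wt M = cnt w := by
  obtain ⟨_, b, hb⟩ := h
  exact hb.wt_eq

theorem HasWeights.inCatO {ι : Type} {w : ι → ℤ} (h : HasWeights M w) : InCatO M := ⟨ι, w, h⟩

theorem InCatO.spanned (h : InCatO M) : WeightSpanned M := by
  obtain ⟨_, _, _, b, hb⟩ := h
  exact hb.spanned

theorem InCatO.eNilpotent (h : InCatO M) : ENilpotent M := by
  obtain ⟨_, _, hw, b, hb⟩ := h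
  exact hb.eNilpotent hw

theorem InCatO.finite (h : InCatO M) (r : ℤ) : FiniteDimensional Kq (weightSpace M r) := by
  obtain ⟨_, _, hw, b, hb⟩ := h
  have := hw.finite r
  exact Module.Finite.of_basis (hb.weightBasis r)

/-- The map on weight spaces that a homomorphism induces. -/
def weightMap (φ : M →ₗ[Uq] N) (r : ℤ) : weightSpace M r →ₗ[Kq] weightSpace N r :=
  (φ.restrictScalars Kq).restrict fun _ hx => map_mem φ hx

theorem weightMap_apply (φ : M →ₗ[Uq] N) (r : ℤ) (x : weightSpace M r) :
    (weightMap φ r x : N) = φ x := rfl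

theorem wt_congr (φ : M ≃ₗ[Uq] N) : wt M = wt N := by
  funext r
  refine LinearEquiv.finrank_eq (LinearEquiv.ofBijective (weightMap φ.toLinearMap r) ⟨?_, ?_⟩)
  · intro x y h
    have := congrArg Subtype.val h
    exact Subtype.ext (φ.injective this)
  · intro y
    exact ⟨⟨φ.symm y, map_mem φ.symm.toLinearMap y.2⟩, Subtype.ext (φ.apply_symm_apply _)⟩

/-- An injective homomorphism between modules with the same finite weight multiplicities is
bijective. -/
theorem bijective_of_wt_eq (hN : InCatO N) (hwt : wt M = wt N) (φ : M →ₗ[Uq] N)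
    (hφ : Function.Injective φ) : Function.Bijective φ := by
  refine ⟨hφ, ?_⟩
  have hw : ∀ r (y : N), y ∈ weightSpace N r → y ∈ LinearMap.range φ := by
    intro r y hy
    have hinj : Function.Injective (weightMap φ r) := fun x x' h =>
      Subtype.ext (hφ (congrArg Subtype.val h))
    have := hN.finite r
    have hfin : FiniteDimensional Kq (weightSpace M r) := Module.Finite.of_injective _ hinj
    obtain ⟨x, hx⟩ := (LinearMap.injective_iff_surjective_of_finrank_eq_finrank
      (congrFun hwt r)).mp hinj ⟨y, hy⟩
    exact ⟨x, congrArg Subtype.val hx⟩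
  intro y
  obtain ⟨s, z, hz, rfl⟩ := hN.spanned.exists_sum y
  exact Submodule.sum_mem (LinearMap.range φ) fun r _ => hw r _ (hz r)

/-- A `ℂ(q)`-subspace that is stable under the generators of `U` is stable under `U`. -/
theorem smul_mem_of_stable (W : Submodule Kq M) (he : ∀ x ∈ W, Uq.e • x ∈ W)
    (hf : ∀ x ∈ W, Uq.f • x ∈ W) (hk : ∀ x ∈ W, Uq.k • x ∈ W) (hk' : ∀ x ∈ W, Uq.kinv • x ∈ W)
    (u : Uq) : ∀ x ∈ W, u • x ∈ W := by
  induction u using Uq.induction with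
  | hc c => intro x hx; rw [algebraMap_smul]; exact W.smul_mem c hx
  | he => exact he
  | hf => exact hf
  | hk => exact hk
  | hk' => exact hk'
  | hadd a b ha hb => intro x hx; rw [add_smul]; exact W.add_mem (ha x hx) (hb x hx)
  | hmul a b ha hb => intro x hx; rw [mul_smul]; exact ha _ (hb x hx)

/-- The span of a family of weight vectors is stable under `u` as soon as the images of the family
under `e` and `f` lie in it. -/
theorem smul_mem_span {ι : Type} {v : ι → M} {w : ι → ℤ} (hw : ∀ i, v i ∈ weightSpace M (w i))
    (he : ∀ i, Uq.e • v i ∈ Submodule.span Kq (Set.range v))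
    (hf : ∀ i, Uq.f • v i ∈ Submodule.span Kq (Set.range v)) (u : Uq) {x : M}
    (hx : x ∈ Submodule.span Kq (Set.range v)) : u • x ∈ Submodule.span Kq (Set.range v) := by
  have key : ∀ u : Uq, (∀ i, u • v i ∈ Submodule.span Kq (Set.range v)) →
      ∀ x ∈ Submodule.span Kq (Set.range v), u • x ∈ Submodule.span Kq (Set.range v) := by
    intro u hu x hx
    have : Submodule.span Kq (Set.range v) ≤
        (Submodule.span Kq (Set.range v)).comap (Algebra.lsmul Kq Kq M u) := by
      rw [Submodule.span_le]
      rintro _ ⟨i, rfl⟩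
      exact hu i
    exact this hx
  refine smul_mem_of_stable _ (key _ he) (key _ hf) (key _ fun i => ?_) (key _ fun i => ?_) u x hx
  · rw [mem_weightSpace.mp (hw i)]
    exact Submodule.smul_mem _ _ (Submodule.subset_span ⟨i, rfl⟩)
  · rw [kinv_smul_mem (hw i)]
    exact Submodule.smul_mem _ _ (Submodule.subset_span ⟨i, rfl⟩)

end bases

/-! ### Modules with prescribed action on a basis -/

section models

variable {ι : Type} (w : ι → ℤ) (E F : (ι →₀ Kq) →ₗ[Kq] (ι →₀ Kq))

/-- The diagonal operator with eigenvalues `q ^ w i`. -/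
def diagOp : (ι →₀ Kq) →ₗ[Kq] (ι →₀ Kq) :=
  Finsupp.linearCombination Kq fun i => q ^ w i • Finsupp.single i (1 : Kq)

theorem diagOp_single (i : ι) :
    diagOp w (Finsupp.single i 1) = q ^ w i • Finsupp.single i (1 : Kq) := by
  rw [diagOp, Finsupp.linearCombination_single, one_smul]

theorem diagOp_mul_neg : diagOp w * diagOp (fun i => -w i) = 1 := by
  refine Finsupp.lhom_ext' fun i => LinearMap.ext_ring ?_
  simp only [LinearMap.comp_apply, Finsupp.lsingle_apply, Module.End.mul_apply, diagOp_single,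
    map_smul, smul_smul, ← zpow_add₀ q_ne_zero]
  simp

theorem diagOp_neg_mul : diagOp (fun i => -w i) * diagOp w = 1 := by
  simpa using diagOp_mul_neg fun i => -w i

/-- Operators `E`, `F` on the space with basis `ι` define a representation in which the basis
vectors have weights `w`, if they shift weights by `2`, `-2` and their commutator is the right
one. -/
def modelRep
    (hE : ∀ i, diagOp w (E (Finsupp.single i 1)) = q ^ (w i + 2) • E (Finsupp.single i 1))
    (hF : ∀ i, diagOp w (F (Finsupp.single i 1)) = q ^ (w i - 2) • F (Finsupp.single i 1))
    (hEF : ∀ i, E (F (Finsupp.single i 1)) - F (E (Finsupp.single i 1)) =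
      (casimirValue (w i) - casimirValue (w i - 2)) • Finsupp.single i 1) :
    Uq →ₐ[Kq] Module.End Kq (ι →₀ Kq) :=
  Uq.lift E F (diagOp w) (diagOp fun i => -w i) (diagOp_mul_neg w) (diagOp_neg_mul w)
    (by
      refine Finsupp.lhom_ext' fun i => LinearMap.ext_ring ?_
      simp only [LinearMap.comp_apply, Finsupp.lsingle_apply, Module.End.mul_apply, diagOp_single,
        map_smul, hE, smul_smul, ← zpow_add₀ q_ne_zero, LinearMap.smul_apply]
      congr 2; ring)
    (by
      refine Finsupp.lhom_ext' fun i => LinearMap.ext_ring ?_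
      simp only [LinearMap.comp_apply, Finsupp.lsingle_apply, Module.End.mul_apply, diagOp_single,
        map_smul, hF, smul_smul, ← zpow_add₀ q_ne_zero, LinearMap.smul_apply]
      congr 2; ring)
    (by
      refine Finsupp.lhom_ext' fun i => LinearMap.ext_ring ?_
      simp only [LinearMap.comp_apply, Finsupp.lsingle_apply, Module.End.mul_apply, diagOp_single,
        LinearMap.smul_apply, LinearMap.sub_apply, hEF, casimirValue_sub]
      rw [← sub_smul, smul_smul])

/-- The space of a representation, as a module. A type synonym, so that the action of `U` does not
become an instance on the space itself. -/
def RepMod {V : Type} [AddCommGroup V] [Module Kq V] (_ : Uq →ₐ[Kq] Module.End Kq V) : Type := V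

variable {V : Type} [AddCommGroup V] [Module Kq V] (ρ : Uq →ₐ[Kq] Module.End Kq V)

instance : AddCommGroup (RepMod ρ) := inferInstanceAs (AddCommGroup V)
instance : Module Kq (RepMod ρ) := inferInstanceAs (Module Kq V)
instance : Module Uq (RepMod ρ) := Module.compHom V ρ.toRingHom

theorem repMod_smul (u : Uq) (x : RepMod ρ) : u • x = (ρ u : V → V) x := rfl

instance : IsScalarTower Kq Uq (RepMod ρ) where
  smul_assoc c u x := by
    rw [repMod_smul, repMod_smul, map_smul]
    rfl

end models

section verma

variable {M : Type} [AddCommGroup M] [Module Kq M] [Module Uq M] [IsScalarTower Kq Uq M]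

/-! ### Verma modules -/

/-- The coefficient in `e fⁿ m_s = (c_s - c_{s-2n}) fⁿ⁻¹ m_s`. -/
def stringCoeff (s : ℤ) (n : ℕ) : Kq := casimirValue s - casimirValue (s - 2 * n)

theorem stringCoeff_zero (s : ℤ) : stringCoeff s 0 = 0 := by simp [stringCoeff]

theorem stringCoeff_eq_zero {s : ℤ} {n : ℕ} : stringCoeff s n = 0 ↔ n = 0 ∨ (n : ℤ) = s + 1 := by
  rw [stringCoeff, sub_eq_zero, casimirValue_eq_iff]
  omega

theorem IsSing.e_f_pow' {s : ℤ} {x : M} (hx : IsSing s x) (n : ℕ) :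
    Uq.e • Uq.f ^ n • x = stringCoeff s n • Uq.f ^ (n - 1) • x := by
  cases n with
  | zero => rw [stringCoeff_zero, zero_smul, pow_zero, one_smul, hx.2]
  | succ n =>
    rw [hx.e_f_pow, stringCoeff]
    push_cast
    rfl

/-- The weights of the Verma module `M(s)`. -/
def mw (s : ℤ) (n : ℕ) : ℤ := s - 2 * n

/-- The weights of the simple module `V(r)`. -/
def vw (r : ℕ) (n : Fin (r + 1)) : ℤ := r - 2 * n

theorem mw_injective (s : ℤ) : Function.Injective (mw s) := fun a b h => by
  unfold mw at h; omega

theorem vw_injective (r : ℕ) : Function.Injective (vw r) := fun a b h => by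
  unfold vw at h; omega

theorem admissible_of_injective {ι : Type} {w : ι → ℤ} (hw : Function.Injective w) {N : ℤ}
    (hN : ∀ i, w i ≤ N) : Admissible w :=
  ⟨fun _ => @Finite.of_subsingleton _ ⟨fun a b => Subtype.ext (hw (a.2.trans b.2.symm))⟩, N, hN⟩

theorem admissible_mw (s : ℤ) : Admissible (mw s) :=
  admissible_of_injective (mw_injective s) (N := s) fun n => by unfold mw; omega

theorem admissible_vw (r : ℕ) : Admissible (vw r) :=
  admissible_of_injective (vw_injective r) (N := r) fun n => by unfold vw; omega

/-- The operator `f` of the model of the Verma module. -/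
def vermaF : (ℕ →₀ Kq) →ₗ[Kq] (ℕ →₀ Kq) :=
  Finsupp.linearCombination Kq fun n => Finsupp.single (n + 1) (1 : Kq)

/-- The operator `e` of the model of the Verma module. -/
def vermaE (s : ℤ) : (ℕ →₀ Kq) →ₗ[Kq] (ℕ →₀ Kq) :=
  Finsupp.linearCombination Kq fun n => stringCoeff s n • Finsupp.single (n - 1) (1 : Kq)

theorem vermaF_single (n : ℕ) :
    vermaF (Finsupp.single n 1) = Finsupp.single (n + 1) (1 : Kq) := by
  rw [vermaF, Finsupp.linearCombination_single, one_smul]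

theorem vermaE_single (s : ℤ) (n : ℕ) :
    vermaE s (Finsupp.single n 1) = stringCoeff s n • Finsupp.single (n - 1) (1 : Kq) := by
  rw [vermaE, Finsupp.linearCombination_single, one_smul]

theorem stringCoeff_succ_sub (s : ℤ) (n : ℕ) :
    stringCoeff s (n + 1) - stringCoeff s n =
      casimirValue (s - 2 * n) - casimirValue (s - 2 * n - 2) := by
  simp only [stringCoeff, sub_sub_sub_cancel_left]
  congr 2
  push_cast; ring

/-- The model of the Verma module `M(s)`, with basis `fⁿ m_s`. -/
def vermaRep (s : ℤ) : Uq →ₐ[Kq] Module.End Kq (ℕ →₀ Kq) :=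
  modelRep (mw s) (vermaE s) vermaF
    (by
      intro n
      rw [vermaE_single, map_smul, diagOp_single, smul_comm]
      rcases Nat.eq_zero_or_pos n with rfl | hn
      · rw [stringCoeff_zero, zero_smul, smul_zero, smul_zero]
      · congr 2
        unfold mw; omega)
    (by
      intro n
      rw [vermaF_single, diagOp_single]
      congr 2
      unfold mw; push_cast; ring)
    (by
      intro n
      rw [vermaF_single, vermaE_single, vermaE_single, map_smul, vermaF_single, mw,
        ← stringCoeff_succ_sub, sub_smul, Nat.add_sub_cancel]
      rcases Nat.eq_zero_or_pos n with rfl | hn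
      · rw [stringCoeff_zero, zero_smul, zero_smul]
      · rw [Nat.sub_add_cancel hn])

/-- The generator `m_s` of `M(s)`. -/
def vermaGen (s : ℤ) : Verma s := (vermaRel s).mkQ 1

theorem vermaGen_sing (s : ℤ) : IsSing s (vermaGen s) := by
  have h : ∀ u ∈ vermaRel s, u • vermaGen s = 0 := by
    intro u hu
    rw [vermaGen, ← map_smul, smul_eq_mul, mul_one]
    exact (Submodule.Quotient.mk_eq_zero _).mpr hu
  constructor
  · have := h _ (Submodule.subset_span (show Uq.k - algebraMap Kq Uq (q ^ s) ∈ _ by simp))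
    rwa [sub_smul, algebraMap_smul, sub_eq_zero] at this
  · exact h _ (Submodule.subset_span (by simp))

theorem verma_smul_gen (s : ℤ) (u : Uq) : u • vermaGen s = (vermaRel s).mkQ u := by
  rw [vermaGen, ← map_smul, smul_eq_mul, mul_one]

/-- The universal property of the Verma module. -/
def vermaLift {s : ℤ} {x : M} (hx : IsSing s x) : Verma s →ₗ[Uq] M :=
  (vermaRel s).liftQ (LinearMap.toSpanSingleton Uq M x) (by
    rw [vermaRel, Submodule.span_le]
    rintro u (rfl | rfl)
    · simpa using hx.2
    · have := mem_weightSpace.mp hx.1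
      simp [sub_smul, this])

theorem vermaLift_gen {s : ℤ} {x : M} (hx : IsSing s x) : vermaLift hx (vermaGen s) = x := by
  simp [vermaLift, vermaGen]

theorem verma_hom_ext {s : ℤ} {φ ψ : Verma s →ₗ[Uq] M}
    (h : φ (vermaGen s) = ψ (vermaGen s)) : φ = ψ := by
  refine LinearMap.ext fun x => ?_
  obtain ⟨u, rfl⟩ := (vermaRel s).mkQ_surjective x
  rw [← verma_smul_gen, map_smul, map_smul, h]

theorem span_f_pow_eq_top (s : ℤ) :
    Submodule.span Kq (Set.range fun n => Uq.f ^ n • vermaGen s) = ⊤ := by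
  rw [eq_top_iff]
  intro x _
  obtain ⟨u, rfl⟩ := (vermaRel s).mkQ_surjective x
  rw [← verma_smul_gen]
  refine smul_mem_span (w := mw s) (fun n => f_pow_mem (vermaGen_sing s).1 n) (fun n => ?_)
    (fun n => ?_) u (Submodule.subset_span ⟨0, by simp⟩)
  · rw [(vermaGen_sing s).e_f_pow']
    exact Submodule.smul_mem _ _ (Submodule.subset_span ⟨n - 1, rfl⟩)
  · exact Submodule.subset_span ⟨n + 1, by simp only [pow_succ', mul_smul]⟩

/-- The basis vector of a model. -/
def modelVec {ι : Type} (ρ : Uq →ₐ[Kq] Module.End Kq (ι →₀ Kq)) (i : ι) : RepMod ρ :=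
  Finsupp.single i (1 : Kq)

theorem modelVec_independent {ι : Type} (ρ : Uq →ₐ[Kq] Module.End Kq (ι →₀ Kq)) :
    LinearIndependent Kq (modelVec ρ) := by
  have h := (Finsupp.basisSingleOne (R := Kq) (ι := ι)).linearIndependent
  rw [Finsupp.coe_basisSingleOne] at h
  exact h

theorem verma_f_modelVec (s : ℤ) (n : ℕ) :
    Uq.f • modelVec (vermaRep s) n = modelVec (vermaRep s) (n + 1) := by
  change (vermaRep s Uq.f : _ → _) (Finsupp.single n 1) = _
  rw [vermaRep, modelRep, Uq.lift_f, vermaF_single]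
  rfl

theorem verma_modelVec_sing (s : ℤ) : IsSing s (modelVec (vermaRep s) 0) := by
  constructor
  · change (vermaRep s Uq.k : _ → _) (Finsupp.single 0 1) = q ^ s • Finsupp.single 0 (1 : Kq)
    rw [vermaRep, modelRep, Uq.lift_k, diagOp_single]
    simp [mw]
  · change (vermaRep s Uq.e : _ → _) (Finsupp.single 0 1) = 0
    rw [vermaRep, modelRep, Uq.lift_e, vermaE_single, stringCoeff_zero, zero_smul]

theorem f_pow_independent (s : ℤ) :
    LinearIndependent Kq fun n : ℕ => Uq.f ^ n • vermaGen s := by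
  refine LinearIndependent.of_comp ((vermaLift (verma_modelVec_sing s)).restrictScalars Kq) ?_
  have h : ∀ n, Uq.f ^ n • modelVec (vermaRep s) 0 = modelVec (vermaRep s) n := by
    intro n
    induction n with
    | zero => simp
    | succ n ih => rw [pow_succ', mul_smul, ih, verma_f_modelVec]
  have h' : (vermaLift (verma_modelVec_sing s)).restrictScalars Kq ∘
      (fun n : ℕ => Uq.f ^ n • vermaGen s) = modelVec (vermaRep s) := by
    funext n
    simp [vermaLift_gen, h]
  rw [h']
  exact modelVec_independent (vermaRep s)

/-- The basis `fⁿ m_s` of the Verma module `M(s)`. -/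
def vermaBasis (s : ℤ) : Module.Basis ℕ Kq (Verma s) :=
  Module.Basis.mk (f_pow_independent s) (span_f_pow_eq_top s).ge

theorem vermaBasis_apply (s : ℤ) (n : ℕ) : vermaBasis s n = Uq.f ^ n • vermaGen s := by
  simp [vermaBasis]

theorem vermaBasis_isWeightBasis (s : ℤ) : IsWeightBasis (vermaBasis s) (mw s) := fun n => by
  rw [vermaBasis_apply]; exact f_pow_mem (vermaGen_sing s).1 n

theorem f_vermaBasis (s : ℤ) (n : ℕ) : Uq.f • vermaBasis s n = vermaBasis s (n + 1) := by
  rw [vermaBasis_apply, vermaBasis_apply, pow_succ', mul_smul]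

theorem e_vermaBasis (s : ℤ) (n : ℕ) :
    Uq.e • vermaBasis s n = stringCoeff s n • vermaBasis s (n - 1) := by
  rw [vermaBasis_apply, vermaBasis_apply, (vermaGen_sing s).e_f_pow']

theorem verma_hasWeights (s : ℤ) : HasWeights (Verma s) (mw s) :=
  ⟨admissible_mw s, _, vermaBasis_isWeightBasis s⟩

/-! ### The simple modules `V(r)` -/

/-- A nonzero multiple of `m_s` is obtained from `fⁿ m_s`, `n ≤ s`, by applying `eⁿ`. -/
theorem prod_stringCoeff_ne_zero {s : ℤ} {n : ℕ} (h : s < 0 ∨ n ≤ s) :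
    ∏ j ∈ Finset.range n, (casimirValue s - casimirValue (s - 2 * (j + 1))) ≠ 0 := by
  rw [Finset.prod_ne_zero_iff]
  intro j hj
  have := Finset.mem_range.mp hj
  rw [sub_ne_zero, Ne, casimirValue_eq_iff]
  omega

/-- The kernel of `M(r) → V(r)` consists of the vectors without components `fⁿ m_r`, `n ≤ r`. -/
theorem mem_vermaMax {r : ℕ} {x : Verma (r : ℤ)} :
    x ∈ vermaMax (r : ℤ) ↔ ∀ n ≤ r, (vermaBasis r).repr x n = 0 := by
  set b := vermaBasis (r : ℤ) with hb
  have hproper : ∀ N : Submodule Uq (Verma (r : ℤ)), N ≠ ⊤ → ∀ x ∈ N, ∀ n ≤ r, b.repr x n = 0 := by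
    intro N hN x hx n hn
    by_contra hc
    apply hN
    have h1 := (vermaBasis_isWeightBasis (r : ℤ)).repr_smul_mem (mw_injective _) N hx n
    have h2 := N.smul_mem (Uq.e ^ n) h1
    rw [← hb, smul_comm, hb, vermaBasis_apply, (vermaGen_sing (r : ℤ)).e_pow_f_pow, smul_smul,
      ← hb] at h2
    have hne := mul_ne_zero hc (prod_stringCoeff_ne_zero (s := r) (n := n) (Or.inr (by omega)))
    have h3 := N.smul_mem (algebraMap Kq Uq (b.repr x n * ∏ j ∈ Finset.range n,
      (casimirValue r - casimirValue (r - 2 * (j + 1))))⁻¹) h2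
    rw [algebraMap_smul, smul_smul, inv_mul_cancel₀ hne, one_smul] at h3
    rw [eq_top_iff]
    intro y _
    obtain ⟨u, rfl⟩ := (vermaRel (r : ℤ)).mkQ_surjective y
    rw [← verma_smul_gen]
    exact N.smul_mem _ h3
  -- the span of `fⁿ m_r` for `n > r` is a submodule
  let v : ℕ → Verma (r : ℤ) := fun n => b (r + 1 + n)
  have hsmul : ∀ u : Uq, ∀ y ∈ Submodule.span Kq (Set.range v),
      u • y ∈ Submodule.span Kq (Set.range v) := by
    intro u y hy
    refine smul_mem_span (w := fun n => mw r (r + 1 + n))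
      (fun n => vermaBasis_isWeightBasis (r : ℤ) _) (fun n => ?_) (fun n => ?_) u hy
    · change Uq.e • vermaBasis (r : ℤ) (r + 1 + n) ∈ _
      rw [e_vermaBasis]
      rcases Nat.eq_zero_or_pos n with rfl | hn
      · rw [stringCoeff_eq_zero.mpr (Or.inr (by push_cast; ring)), zero_smul]
        exact Submodule.zero_mem _
      · refine Submodule.smul_mem _ _ (Submodule.subset_span ⟨n - 1, ?_⟩)
        change b (r + 1 + (n - 1)) = b (r + 1 + n - 1)
        congr 1; omega
    · change Uq.f • vermaBasis (r : ℤ) (r + 1 + n) ∈ _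
      rw [f_vermaBasis]
      exact Submodule.subset_span ⟨n + 1, rfl⟩
  let P : Submodule Uq (Verma (r : ℤ)) :=
    { Submodule.span Kq (Set.range v) with smul_mem' := fun u y hy => hsmul u y hy }
  have hP : ∀ y, y ∈ P ↔ ∀ n ≤ r, b.repr y n = 0 := by
    intro y
    constructor
    · intro hy n hn
      have : Submodule.span Kq (Set.range v) ≤ LinearMap.ker (b.coord n) := by
        rw [Submodule.span_le]
        rintro _ ⟨m, rfl⟩
        change b.coord n (b (r + 1 + m)) = 0
        rw [b.coord_apply, b.repr_self, Finsupp.single_apply, if_neg (by omega)]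
      exact this hy
    · intro hy
      change y ∈ Submodule.span Kq (Set.range v)
      rw [← b.linearCombination_repr y, Finsupp.linearCombination_apply]
      refine Submodule.sum_mem _ fun n hn => Submodule.smul_mem _ _ (Submodule.subset_span ?_)
      refine ⟨n - (r + 1), ?_⟩
      have : ¬ n ≤ r := fun h => (Finsupp.mem_support_iff.mp hn) (hy n h)
      change b (r + 1 + (n - (r + 1))) = b n
      congr 1; omega
  have hPtop : P ≠ ⊤ := by
    intro h
    have h1 : b 0 ∈ P := by rw [h]; trivial
    have := (hP _).mp h1 0 (Nat.zero_le _)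
    simp at this
  have hmax : vermaMax (r : ℤ) = P :=
    le_antisymm (sSup_le fun N hN x hx => (hP x).mpr (hproper N hN x hx)) (le_sSup hPtop)
  rw [hmax]
  exact hP x

/-- The generator of `V(s)`. -/
def simpleGen (s : ℤ) : SimpleMod s := (vermaMax s).mkQ (vermaGen s)

theorem simpleGen_sing (s : ℤ) : IsSing s (simpleGen s) := (vermaGen_sing s).map _

theorem f_pow_simpleGen {s : ℤ} (n : ℕ) :
    Uq.f ^ n • simpleGen s = (vermaMax s).mkQ (vermaBasis s n) := by
  rw [vermaBasis_apply, map_smul]; rfl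

theorem f_pow_simpleGen_eq_zero {r n : ℕ} (h : r < n) :
    Uq.f ^ n • simpleGen (r : ℤ) = 0 := by
  rw [f_pow_simpleGen]
  refine (Submodule.Quotient.mk_eq_zero _).mpr (mem_vermaMax.mpr fun m hm => ?_)
  rw [Module.Basis.repr_self, Finsupp.single_apply, if_neg (by omega)]

/-- The basis `fⁿ v_r`, `n ≤ r`, of `V(r)`. -/
def simpleBasis (r : ℕ) : Module.Basis (Fin (r + 1)) Kq (SimpleMod (r : ℤ)) :=
  Module.Basis.mk (v := fun n : Fin (r + 1) => Uq.f ^ (n : ℕ) • simpleGen (r : ℤ))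
    (by
      rw [Fintype.linearIndependent_iff]
      intro g hg i
      have h0 : (vermaMax (r : ℤ)).mkQ (∑ n : Fin (r + 1), g n • vermaBasis r n) = 0 := by
        rw [map_sum, ← hg]
        refine Finset.sum_congr rfl fun n _ => ?_
        rw [f_pow_simpleGen]
        rfl
      have h1 := mem_vermaMax.mp ((Submodule.Quotient.mk_eq_zero _).mp h0) i (by omega)
      rw [map_sum, Finset.sum_apply'] at h1
      simpa [Finsupp.single_apply, Fin.val_inj] using h1)
    (by
      intro x _
      obtain ⟨y, rfl⟩ := (vermaMax (r : ℤ)).mkQ_surjective x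
      rw [← (vermaBasis r).linearCombination_repr y, Finsupp.linearCombination_apply,
        Finsupp.sum, map_sum]
      refine Submodule.sum_mem _ fun n _ => ?_
      change (vermaBasis r).repr y n • (vermaMax (r : ℤ)).mkQ (vermaBasis r n) ∈ _
      refine Submodule.smul_mem _ _ ?_
      rw [← f_pow_simpleGen]
      by_cases hn : n < r + 1
      · exact Submodule.subset_span ⟨⟨n, hn⟩, rfl⟩
      · rw [f_pow_simpleGen_eq_zero (by omega)]
        exact Submodule.zero_mem _)

theorem simpleBasis_apply (r : ℕ) (n : Fin (r + 1)) :
    simpleBasis r n = Uq.f ^ (n : ℕ) • simpleGen (r : ℤ) := by simp [simpleBasis]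

theorem simpleBasis_isWeightBasis (r : ℕ) : IsWeightBasis (simpleBasis r) (vw r) := fun n => by
  rw [simpleBasis_apply]; exact f_pow_mem (simpleGen_sing _).1 n

theorem simple_hasWeights (r : ℕ) : HasWeights (SimpleMod (r : ℤ)) (vw r) :=
  ⟨admissible_vw r, _, simpleBasis_isWeightBasis r⟩

/-- The universal property of `V(r)`. -/
def simpleLift {r : ℕ} {x : M} (hx : IsSing (r : ℤ) x) (h : Uq.f ^ (r + 1) • x = 0) :
    SimpleMod (r : ℤ) →ₗ[Uq] M :=
  (vermaMax (r : ℤ)).liftQ (vermaLift hx) (by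
    intro y hy
    rw [LinearMap.mem_ker, ← (vermaBasis r).linearCombination_repr y,
      Finsupp.linearCombination_apply, Finsupp.sum, map_sum]
    refine Finset.sum_eq_zero fun n hn => ?_
    have hn' : r + 1 ≤ n := by
      by_contra h
      exact Finsupp.mem_support_iff.mp hn (mem_vermaMax.mp hy n (by omega))
    obtain ⟨m, rfl⟩ := Nat.exists_eq_add_of_le' hn'
    rw [vermaBasis_apply]
    change ((vermaLift hx).restrictScalars Kq) _ = 0
    rw [map_smul]
    change _ • vermaLift hx _ = 0
    rw [map_smul, vermaLift_gen, pow_add, mul_smul, h, smul_zero, smul_zero])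

theorem simpleLift_gen {r : ℕ} {x : M} (hx : IsSing (r : ℤ) x) (h : Uq.f ^ (r + 1) • x = 0) :
    simpleLift hx h (simpleGen (r : ℤ)) = x := vermaLift_gen hx

end verma

section tilt

variable {M : Type} [AddCommGroup M] [Module Kq M] [Module Uq M] [IsScalarTower Kq Uq M]

/-! ### The modules `T(r)` -/

/-- The weights of `T(r)`: those of `M(r)` and of `M(-r-2)`. -/
def tw (r : ℕ) : ℕ ⊕ ℕ → ℤ := Sum.elim (mw r) (mw (-(r : ℤ) - 2))

theorem Admissible.sum {ι κ : Type} {w : ι → ℤ} {w' : κ → ℤ} (h : Admissible w)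
    (h' : Admissible w') : Admissible (Sum.elim w w') := by
  constructor
  · intro r
    have : Finite {a // Sum.elim w w' (Sum.inl a) = r} := h.finite r
    have : Finite {a // Sum.elim w w' (Sum.inr a) = r} := h'.finite r
    exact Finite.of_equiv _ (Equiv.subtypeSum (p := fun i => Sum.elim w w' i = r)).symm
  · obtain ⟨N, hN⟩ := h.bdd
    obtain ⟨N', hN'⟩ := h'.bdd
    exact ⟨max N N', Sum.rec (fun i => (hN i).trans (le_max_left _ _))
      fun i => (hN' i).trans (le_max_right _ _)⟩

theorem admissible_tw (r : ℕ) : Admissible (tw r) := (admissible_mw _).sum (admissible_mw _)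

/-- The operator `f` of the model of `T(r)`. -/
def tiltF : (ℕ ⊕ ℕ →₀ Kq) →ₗ[Kq] (ℕ ⊕ ℕ →₀ Kq) :=
  Finsupp.linearCombination Kq (Sum.elim (fun n => Finsupp.single (Sum.inl (n + 1)) (1 : Kq))
    (fun n => Finsupp.single (Sum.inr (n + 1)) (1 : Kq)))

/-- The operator `e` of the model of `T(r)`. -/
def tiltE (r : ℕ) : (ℕ ⊕ ℕ →₀ Kq) →ₗ[Kq] (ℕ ⊕ ℕ →₀ Kq) :=
  Finsupp.linearCombination Kq (Sum.elim
    (fun n => stringCoeff r n • Finsupp.single (Sum.inl (n - 1)) (1 : Kq))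
    (fun n => stringCoeff (-(r : ℤ) - 2) n • Finsupp.single (Sum.inr (n - 1)) (1 : Kq) +
      Finsupp.single (Sum.inl (r + n)) (1 : Kq)))

theorem tiltF_inl (n : ℕ) : tiltF (Finsupp.single (Sum.inl n) 1) =
    Finsupp.single (Sum.inl (n + 1)) (1 : Kq) := by
  rw [tiltF, Finsupp.linearCombination_single, one_smul]; rfl

theorem tiltF_inr (n : ℕ) : tiltF (Finsupp.single (Sum.inr n) 1) =
    Finsupp.single (Sum.inr (n + 1)) (1 : Kq) := by
  rw [tiltF, Finsupp.linearCombination_single, one_smul]; rfl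

theorem tiltE_inl (r n : ℕ) : tiltE r (Finsupp.single (Sum.inl n) 1) =
    stringCoeff r n • Finsupp.single (Sum.inl (n - 1)) (1 : Kq) := by
  rw [tiltE, Finsupp.linearCombination_single, one_smul]; rfl

theorem tiltE_inr (r n : ℕ) : tiltE r (Finsupp.single (Sum.inr n) 1) =
    stringCoeff (-(r : ℤ) - 2) n • Finsupp.single (Sum.inr (n - 1)) (1 : Kq) +
      Finsupp.single (Sum.inl (r + n)) (1 : Kq) := by
  rw [tiltE, Finsupp.linearCombination_single, one_smul]; rfl

/-- The model of `T(r)`: the direct sum of `M(r)` and `M(-r-2)`, with bases `aₙ`, `tₙ`, except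
that `a_{r+n}` is added to the image of `tₙ` under `e`. -/
def tiltRep (r : ℕ) : Uq →ₐ[Kq] Module.End Kq (ℕ ⊕ ℕ →₀ Kq) :=
  modelRep (tw r) (tiltE r) tiltF
    (by
      rintro (n | n)
      · rw [tiltE_inl, map_smul, diagOp_single, smul_comm]
        rcases Nat.eq_zero_or_pos n with rfl | hn
        · rw [stringCoeff_zero, zero_smul, smul_zero, smul_zero]
        · congr 2
          simp only [tw, Sum.elim_inl, mw]; omega
      · rw [tiltE_inr, map_add, map_smul, diagOp_single, diagOp_single, smul_comm, smul_add]
        congr 1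
        · rcases Nat.eq_zero_or_pos n with rfl | hn
          · rw [stringCoeff_zero, zero_smul, smul_zero, smul_zero]
          · congr 2
            simp only [tw, Sum.elim_inr, mw]; omega
        · congr 2
          simp only [tw, Sum.elim_inr, Sum.elim_inl, mw]; push_cast; ring)
    (by
      rintro (n | n)
      · rw [tiltF_inl, diagOp_single]
        congr 2
        simp only [tw, Sum.elim_inl, mw]; push_cast; ring
      · rw [tiltF_inr, diagOp_single]
        congr 2
        simp only [tw, Sum.elim_inr, mw]; push_cast; ring)
    (by
      rintro (n | n)
      · rw [tiltF_inl, tiltE_inl, tiltE_inl, map_smul, tiltF_inl, tw, Sum.elim_inl, mw,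
          ← stringCoeff_succ_sub, sub_smul, Nat.add_sub_cancel]
        rcases Nat.eq_zero_or_pos n with rfl | hn
        · rw [stringCoeff_zero, zero_smul, zero_smul]
        · rw [Nat.sub_add_cancel hn]
      · rw [tiltF_inr, tiltE_inr, tiltE_inr, map_add, map_smul, tiltF_inr, tiltF_inl, tw,
          Sum.elim_inr, mw, ← stringCoeff_succ_sub, sub_smul, Nat.add_sub_cancel, ← add_assoc r,
          add_sub_add_right_eq_sub]
        rcases Nat.eq_zero_or_pos n with rfl | hn
        · rw [stringCoeff_zero, zero_smul, zero_smul]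
        · rw [Nat.sub_add_cancel hn])

/-- The generator `t_r` of `T(r)`. -/
def tiltGen (r : ℕ) : TiltMod r := (tiltRel r).mkQ 1

theorem tilt_smul_gen (r : ℕ) (u : Uq) : u • tiltGen r = (tiltRel r).mkQ u := by
  rw [tiltGen, ← map_smul, smul_eq_mul, mul_one]

theorem aeval_sq (c : Kq) :
    aeval Uq.casimir ((X - C c) ^ 2) = (Uq.casimir - algebraMap Kq Uq c) ^ 2 := by
  rw [map_pow, map_sub, aeval_X, aeval_C]

theorem tiltGen_isGen (r : ℕ) : IsGen (-(r : ℤ) - 2) (tiltGen r) := by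
  have h : ∀ u ∈ tiltRel r, u • tiltGen r = 0 := by
    intro u hu
    rw [tilt_smul_gen]
    exact (Submodule.Quotient.mk_eq_zero _).mpr hu
  constructor
  · have := h _ (Submodule.subset_span
      (show Uq.k - algebraMap Kq Uq (q ^ (-(r : ℤ) - 2)) ∈ _ by simp))
    rwa [sub_smul, algebraMap_smul, sub_eq_zero] at this
  · rw [casimirValue_neg, aeval_sq]
    exact h _ (Submodule.subset_span (by simp))

theorem e_pow_tiltGen (r : ℕ) : Uq.e ^ (r + 2) • tiltGen r = 0 := by
  rw [tilt_smul_gen]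
  exact (Submodule.Quotient.mk_eq_zero _).mpr (Submodule.subset_span (by simp))

/-- The universal property of `T(r)`. -/
def tiltLift {r : ℕ} {x : M} (hx : IsGen (-(r : ℤ) - 2) x) (h : Uq.e ^ (r + 2) • x = 0) :
    TiltMod r →ₗ[Uq] M :=
  (tiltRel r).liftQ (LinearMap.toSpanSingleton Uq M x) (by
    rw [tiltRel, Submodule.span_le]
    rintro u (rfl | rfl | rfl)
    · simpa using h
    · have := mem_weightSpace.mp hx.1
      simp [sub_smul, this]
    · have := hx.2
      rw [casimirValue_neg, aeval_sq] at this
      simpa using this)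

theorem tiltLift_gen {r : ℕ} {x : M} (hx : IsGen (-(r : ℤ) - 2) x)
    (h : Uq.e ^ (r + 2) • x = 0) : tiltLift hx h (tiltGen r) = x := by
  simp [tiltLift, tiltGen]

/-- The singular vector `e ^ (r + 1) t_r` of weight `r`. -/
def tiltTop (r : ℕ) : TiltMod r := Uq.e ^ (r + 1) • tiltGen r

theorem tiltTop_sing (r : ℕ) : IsSing (r : ℤ) (tiltTop r) := by
  constructor
  · have := e_pow_mem (tiltGen_isGen r).1 (r + 1)
    rwa [show -(r : ℤ) - 2 + 2 * ((r + 1 : ℕ) : ℤ) = r by push_cast; ring] at this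
  · rw [tiltTop, ← mul_smul, ← pow_succ', e_pow_tiltGen]

/-- In `T(r)` the vector `e t_r` is a nonzero multiple of `f ^ r e ^ (r + 1) t_r`. -/
theorem exists_e_tiltGen (r : ℕ) :
    ∃ c : Kq, c ≠ 0 ∧ Uq.e • tiltGen r = c • Uq.f ^ r • tiltTop r := by
  have hw := (tiltGen_isGen r).1
  have hev : ∀ j < r, casimirValue (-(r : ℤ) - 2 + 2 + 2 * j) ≠ casimirValue r := by
    intro j hj
    rw [Ne, casimirValue_eq_iff]
    omega
  -- `z = (Ω - c) t` is singular
  have hz : aeval Uq.casimir (X - C (casimirValue r)) • Uq.e • tiltGen r = 0 := by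
    refine eq_zero_of_e_pow (n := r) (m := 1) (c := casimirValue r)
      (aeval_casimir_mem _ (e_mem hw)) ?_ ?_ hev
    · rw [← aeval_smul_comm, ← mul_smul (Uq.e ^ r), ← pow_succ, X_sub_C_smul]
      exact sub_eq_zero.mpr (tiltTop_sing r).casimir
    · rw [pow_one, ← mul_smul, ← map_mul, ← sq, aeval_smul_comm]
      have := (tiltGen_isGen r).2
      rw [casimirValue_neg] at this
      rw [this, smul_zero]
  have h1 := f_pow_e_pow (e_mem hw) r
  obtain ⟨g, hg⟩ := X_sub_C_dvd_sub_C_eval (a := casimirValue r)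
    (p := casimirPoly (-(r : ℤ) - 2 + 2) r)
  have h2 : casimirPoly (-(r : ℤ) - 2 + 2) r =
      C ((casimirPoly (-(r : ℤ) - 2 + 2) r).eval (casimirValue r)) +
        g * (X - C (casimirValue r)) := by
    rw [mul_comm g, ← hg]; ring
  rw [← mul_smul (Uq.e ^ r), ← pow_succ, h2, map_add, add_smul, map_mul, mul_smul, hz, smul_zero,
    add_zero, aeval_C, algebraMap_smul] at h1
  have hne := casimirPoly_eval_ne_zero hev
  refine ⟨((casimirPoly (-(r : ℤ) - 2 + 2) r).eval (casimirValue r))⁻¹, inv_ne_zero hne, ?_⟩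
  rw [tiltTop, h1, smul_smul, inv_mul_cancel₀ hne, one_smul]

/-- The family `aₙ = fⁿ e ^ (r + 1) t_r`, `tₙ = fⁿ t_r`. -/
def tiltVec (r : ℕ) : ℕ ⊕ ℕ → TiltMod r :=
  Sum.elim (fun n => Uq.f ^ n • tiltTop r) (fun n => Uq.f ^ n • tiltGen r)

theorem tiltVec_mem (r : ℕ) (i : ℕ ⊕ ℕ) : tiltVec r i ∈ weightSpace (TiltMod r) (tw r i) := by
  rcases i with n | n
  · exact f_pow_mem (tiltTop_sing r).1 n
  · exact f_pow_mem (tiltGen_isGen r).1 n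

theorem exists_e_tiltVec_inr (r : ℕ) : ∃ c : Kq, c ≠ 0 ∧ ∀ n,
    Uq.e • tiltVec r (Sum.inr n) =
      stringCoeff (-(r : ℤ) - 2) n • tiltVec r (Sum.inr (n - 1)) +
        c • tiltVec r (Sum.inl (r + n)) := by
  obtain ⟨c, hc, h⟩ := exists_e_tiltGen r
  refine ⟨c, hc, fun n => ?_⟩
  have hcas : Uq.casimir • tiltGen r =
      casimirValue r • tiltGen r + c • Uq.f ^ (r + 1) • tiltTop r := by
    have h1 := f_e_smul (tiltGen_isGen r).1
    rw [h, smul_comm, ← mul_smul, ← pow_succ', casimirValue_neg, eq_sub_iff_add_eq] at h1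
    rw [← h1, add_comm]
  cases n with
  | zero => simpa [tiltVec, stringCoeff_zero] using h
  | succ n =>
    simp only [tiltVec, Sum.elim_inr, Sum.elim_inl, Nat.add_sub_cancel]
    rw [pow_succ', mul_smul, e_f_smul (f_pow_mem (tiltGen_isGen r).1 n), casimir_smul_comm, hcas,
      smul_add, smul_comm _ c, ← mul_smul (Uq.f ^ n), ← pow_add, smul_comm (Uq.f ^ n),
      stringCoeff, casimirValue_neg, sub_smul, show n + (r + 1) = r + (n + 1) by ring,
      show -(r : ℤ) - 2 - 2 * ((n + 1 : ℕ) : ℤ) = -r - 2 - 2 * n - 2 by push_cast; ring]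
    abel

theorem e_tiltVec_inl (r n : ℕ) :
    Uq.e • tiltVec r (Sum.inl n) = stringCoeff r n • tiltVec r (Sum.inl (n - 1)) :=
  (tiltTop_sing r).e_f_pow' n

theorem f_tiltVec_inl (r n : ℕ) :
    Uq.f • tiltVec r (Sum.inl n) = tiltVec r (Sum.inl (n + 1)) := by
  simp only [tiltVec, Sum.elim_inl, pow_succ', mul_smul]

theorem f_tiltVec_inr (r n : ℕ) :
    Uq.f • tiltVec r (Sum.inr n) = tiltVec r (Sum.inr (n + 1)) := by
  simp only [tiltVec, Sum.elim_inr, pow_succ', mul_smul]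

theorem span_tiltVec (r : ℕ) : Submodule.span Kq (Set.range (tiltVec r)) = ⊤ := by
  rw [eq_top_iff]
  intro x _
  obtain ⟨u, rfl⟩ := (tiltRel r).mkQ_surjective x
  rw [← tilt_smul_gen]
  have hs : ∀ i, tiltVec r i ∈ Submodule.span Kq (Set.range (tiltVec r)) := fun i =>
    Submodule.subset_span ⟨i, rfl⟩
  refine smul_mem_span (tiltVec_mem r) ?_ ?_ u (Submodule.subset_span ⟨Sum.inr 0, by
    simp [tiltVec]⟩)
  · rintro (n | n)
    · rw [e_tiltVec_inl]
      exact Submodule.smul_mem _ _ (hs _)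
    · obtain ⟨c, _, h⟩ := exists_e_tiltVec_inr r
      rw [h]
      exact Submodule.add_mem _ (Submodule.smul_mem _ _ (hs _)) (Submodule.smul_mem _ _ (hs _))
  · rintro (n | n)
    · rw [f_tiltVec_inl]; exact hs _
    · rw [f_tiltVec_inr]; exact hs _

theorem tilt_f_modelVec_inl (r n : ℕ) :
    Uq.f ^ n • modelVec (tiltRep r) (Sum.inl 0) = modelVec (tiltRep r) (Sum.inl n) := by
  induction n with
  | zero => simp
  | succ n ih =>
    rw [pow_succ', mul_smul, ih]
    change (tiltRep r Uq.f : _ → _) (Finsupp.single (Sum.inl n) 1) = _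
    rw [tiltRep, modelRep, Uq.lift_f, tiltF_inl]
    rfl

theorem tilt_f_modelVec_inr (r n : ℕ) :
    Uq.f ^ n • modelVec (tiltRep r) (Sum.inr 0) = modelVec (tiltRep r) (Sum.inr n) := by
  induction n with
  | zero => simp
  | succ n ih =>
    rw [pow_succ', mul_smul, ih]
    change (tiltRep r Uq.f : _ → _) (Finsupp.single (Sum.inr n) 1) = _
    rw [tiltRep, modelRep, Uq.lift_f, tiltF_inr]
    rfl

theorem tilt_modelVec_mem (r : ℕ) (i : ℕ ⊕ ℕ) :
    modelVec (tiltRep r) i ∈ weightSpace (RepMod (tiltRep r)) (tw r i) := by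
  change (tiltRep r Uq.k : _ → _) (Finsupp.single i 1) = q ^ tw r i • Finsupp.single i (1 : Kq)
  rw [tiltRep, modelRep, Uq.lift_k, diagOp_single]

theorem tilt_modelVec_sing (r : ℕ) : IsSing (r : ℤ) (modelVec (tiltRep r) (Sum.inl 0)) := by
  constructor
  · simpa [tw, mw] using tilt_modelVec_mem r (Sum.inl 0)
  · change (tiltRep r Uq.e : _ → _) (Finsupp.single (Sum.inl 0) 1) = 0
    rw [tiltRep, modelRep, Uq.lift_e, tiltE_inl, stringCoeff_zero, zero_smul]

theorem tilt_e_modelVec (r : ℕ) :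
    Uq.e • modelVec (tiltRep r) (Sum.inr 0) = modelVec (tiltRep r) (Sum.inl r) := by
  change (tiltRep r Uq.e : _ → _) (Finsupp.single (Sum.inr 0) 1) = _
  rw [tiltRep, modelRep, Uq.lift_e, tiltE_inr, stringCoeff_zero, zero_smul, zero_add]
  rfl

theorem tilt_e_pow_modelVec (r : ℕ) : ∃ c : Kq, c ≠ 0 ∧
    Uq.e ^ (r + 1) • modelVec (tiltRep r) (Sum.inr 0) = c • modelVec (tiltRep r) (Sum.inl 0) := by
  refine ⟨_, prod_stringCoeff_ne_zero (s := r) (n := r) (Or.inr le_rfl), ?_⟩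
  rw [pow_succ, mul_smul, tilt_e_modelVec, ← tilt_f_modelVec_inl,
    (tilt_modelVec_sing r).e_pow_f_pow]

theorem tilt_modelVec_isGen (r : ℕ) :
    IsGen (-(r : ℤ) - 2) (modelVec (tiltRep r) (Sum.inr 0)) := by
  have hw : modelVec (tiltRep r) (Sum.inr 0) ∈ weightSpace _ (-(r : ℤ) - 2) := by
    simpa [tw, mw] using tilt_modelVec_mem r (Sum.inr 0)
  refine ⟨hw, ?_⟩
  rw [sq, map_mul, mul_smul, X_sub_C_smul _ (modelVec _ _), ← f_e_smul hw, tilt_e_modelVec,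
    aeval_smul_comm, ← tilt_f_modelVec_inl, aeval_smul_comm, X_sub_C_smul,
    (tilt_modelVec_sing r).casimir, casimirValue_neg, sub_self, smul_zero, smul_zero]

theorem tiltVec_independent (r : ℕ) : LinearIndependent Kq (tiltVec r) := by
  obtain ⟨c, hc, h⟩ := tilt_e_pow_modelVec r
  have h' : Uq.e ^ (r + 2) • modelVec (tiltRep r) (Sum.inr 0) = 0 := by
    rw [pow_succ', mul_smul, h, smul_comm, (tilt_modelVec_sing r).2, smul_zero]
  set φ := tiltLift (tilt_modelVec_isGen r) h' with hφ
  refine LinearIndependent.of_comp (φ.restrictScalars Kq) ?_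
  let u : ℕ ⊕ ℕ → Kqˣ := Sum.elim (fun _ => Units.mk0 c hc) (fun _ => 1)
  have : φ.restrictScalars Kq ∘ tiltVec r = u • modelVec (tiltRep r) := by
    funext i
    rcases i with n | n
    · change φ (Uq.f ^ n • Uq.e ^ (r + 1) • tiltGen r) = c • modelVec (tiltRep r) (Sum.inl n)
      rw [map_smul, map_smul, hφ, tiltLift_gen, h, smul_comm, tilt_f_modelVec_inl]
    · change φ (Uq.f ^ n • tiltGen r) = (1 : Kq) • modelVec (tiltRep r) (Sum.inr n)
      rw [map_smul, hφ, tiltLift_gen, tilt_f_modelVec_inr, one_smul]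
  rw [this]
  exact (modelVec_independent _).units_smul u

/-- The basis `fⁿ e ^ (r + 1) t_r`, `fⁿ t_r` of `T(r)`. -/
def tiltBasis (r : ℕ) : Module.Basis (ℕ ⊕ ℕ) Kq (TiltMod r) :=
  Module.Basis.mk (tiltVec_independent r) (span_tiltVec r).ge

theorem tiltBasis_apply (r : ℕ) (i : ℕ ⊕ ℕ) : tiltBasis r i = tiltVec r i := by simp [tiltBasis]

theorem tiltBasis_isWeightBasis (r : ℕ) : IsWeightBasis (tiltBasis r) (tw r) := fun i => by
  rw [tiltBasis_apply]; exact tiltVec_mem r i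

theorem tilt_hasWeights (r : ℕ) : HasWeights (TiltMod r) (tw r) :=
  ⟨admissible_tw r, _, tiltBasis_isWeightBasis r⟩

end tilt

section duals

variable {M N : Type} [AddCommGroup M] [Module Kq M] [Module Uq M] [IsScalarTower Kq Uq M]
  [AddCommGroup N] [Module Kq N] [Module Uq N] [IsScalarTower Kq Uq N]

/-! ### Restricted duals -/

/-- The automorphism `q ↦ q⁻¹` of `ℂ(q)` on polynomials. -/
theorem bar_algebraMap (p : ℂ[X]) : bar (algebraMap ℂ[X] Kq p) = aeval (q⁻¹ : Kq) p := by
  have h := RatFunc.liftRingHom_apply_div (L := Kq) (K := ℂ) (aeval (q⁻¹ : Kq)).toRingHom (by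
      intro p hp
      rw [Submonoid.mem_comap, mem_nonZeroDivisors_iff_ne_zero]
      have ht : Transcendental ℂ (q⁻¹ : Kq) := by
        rw [Transcendental, IsAlgebraic.inv_iff]
        exact RatFunc.transcendental_X
      exact fun h0 => nonZeroDivisors.ne_zero hp ((transcendental_iff.mp ht) p h0)) p 1
  simp only [map_one, div_one] at h
  exact h

theorem bar_bar (c : Kq) : bar (bar c) = c := by
  have hC : ∀ a : ℂ, bar (algebraMap ℂ[X] Kq (C a)) = algebraMap ℂ[X] Kq (C a) := by
    intro a
    rw [bar_algebraMap, Polynomial.aeval_C]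
    rfl
  have hX : bar (algebraMap ℂ[X] Kq X) = q⁻¹ := by
    rw [RatFunc.algebraMap_X]; exact bar_q
  have h : (bar.comp bar).comp (algebraMap ℂ[X] Kq) = algebraMap ℂ[X] Kq := by
    refine Polynomial.ringHom_ext (fun a => ?_) ?_
    · simp only [RingHom.comp_apply, hC]
    · rw [RingHom.comp_apply, RingHom.comp_apply, hX, map_inv₀, bar_q, inv_inv,
        RatFunc.algebraMap_X]
      rfl
  have h2 : bar.comp bar = RingHom.id Kq :=
    IsLocalization.ringHom_ext (nonZeroDivisors ℂ[X]) (by rw [h, RingHom.id_comp])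
  exact RingHom.congr_fun h2 c

theorem bar_zpow (n : ℤ) : bar (q ^ n) = q ^ (-n) := by
  rw [map_zpow₀, bar_q, inv_zpow']

/-- The functional that an element of the restricted dual is. -/
def ev (φ : RestrictedDual M) : M →ₗ[Kq] Kq := (φ : FullDual M).ev

theorem ev_smul (u : Uq) (φ : RestrictedDual M) (m : M) : ev (u • φ) m = ev φ (Uq.sigma u • m) :=
  rfl

theorem ev_add (φ ψ : RestrictedDual M) (m : M) : ev (φ + ψ) m = ev φ m + ev ψ m := rfl

theorem ev_zero (m : M) : ev (0 : RestrictedDual M) m = 0 := rfl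

theorem ev_kq_smul (c : Kq) (φ : RestrictedDual M) (m : M) : ev (c • φ) m = bar c * ev φ m := rfl

theorem ev_injective {φ ψ : RestrictedDual M} (h : ev φ = ev ψ) : φ = ψ := Subtype.ext h

variable {ι : Type} {b : Module.Basis ι Kq M} {w : ι → ℤ}

theorem IsWeightBasis.ev_support_finite (hb : IsWeightBasis b w) (hw : Admissible w)
    (φ : RestrictedDual M) : {i | bar (ev φ (b i)) ≠ 0}.Finite := by
  have h : FinSupp (φ : FullDual M) := φ.2
  refine ((h.biUnion (t := fun r => {i | w i = r}) fun r _ => ?_)).subset ?_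
  · have : Finite {i | w i = r} := hw.finite r
    exact Set.toFinite _
  · intro i hi
    refine Set.mem_biUnion (x := w i) ⟨b i, hb i, fun h0 => hi ?_⟩ rfl
    change bar ((φ : FullDual M).ev (b i)) = 0
    rw [h0, map_zero]

/-- The functional with prescribed, finitely many nonzero, values on a weight basis. The values are
conjugated by `q ↦ q⁻¹`, so that they depend linearly on the functional. -/
def dualMk (hb : IsWeightBasis b w) (c : ι →₀ Kq) : RestrictedDual M :=
  ⟨(b.constr Kq fun i => bar (c i) : M →ₗ[Kq] Kq), by
    refine (c.support.finite_toSet.image w).subset ?_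
    rintro r ⟨m, hm, hne⟩
    by_contra hr
    apply hne
    change (b.constr Kq fun i => bar (c i) : M →ₗ[Kq] Kq) m = 0
    rw [b.constr_apply, Finsupp.sum]
    refine Finset.sum_eq_zero fun i hi => ?_
    have hwi : w i = r := by
      by_contra h
      exact Finsupp.mem_support_iff.mp hi (hb.repr_eq_zero hm h)
    have : c i = 0 := by
      by_contra h
      exact hr ⟨i, by simpa using h, hwi⟩
    rw [this, map_zero, smul_zero]⟩

theorem ev_dualMk (hb : IsWeightBasis b w) (c : ι →₀ Kq) (i : ι) :
    ev (dualMk hb c) (b i) = bar (c i) := b.constr_basis Kq _ i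

/-- The basis of the restricted dual that is dual to a weight basis. -/
def dualBasis (hb : IsWeightBasis b w) (hw : Admissible w) :
    Module.Basis ι Kq (RestrictedDual M) :=
  Module.Basis.ofRepr
    { toFun := fun φ => Finsupp.ofSupportFinite (fun i => bar (ev φ (b i)))
        (hb.ev_support_finite hw φ)
      map_add' := fun φ ψ => by
        ext i
        change bar (ev (φ + ψ) (b i)) = bar (ev φ (b i)) + bar (ev ψ (b i))
        rw [ev_add, map_add]
      map_smul' := fun c φ => by
        ext i
        change bar (ev (c • φ) (b i)) = c * bar (ev φ (b i))
        rw [ev_kq_smul, map_mul, bar_bar]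
      invFun := dualMk hb
      left_inv := fun φ => by
        refine ev_injective (b.ext fun i => ?_)
        rw [ev_dualMk]
        exact bar_bar _
      right_inv := fun c => by
        ext i
        change bar (ev (dualMk hb c) (b i)) = c i
        rw [ev_dualMk, bar_bar] }

theorem dualBasis_repr (hb : IsWeightBasis b w) (hw : Admissible w) (φ : RestrictedDual M)
    (i : ι) : (dualBasis hb hw).repr φ i = bar (ev φ (b i)) := rfl

theorem ev_dualBasis [DecidableEq ι] (hb : IsWeightBasis b w) (hw : Admissible w) (i j : ι) :
    ev (dualBasis hb hw i) (b j) = if i = j then 1 else 0 := by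
  have h := dualBasis_repr hb hw (dualBasis hb hw i) j
  rw [Module.Basis.repr_self, Finsupp.single_apply] at h
  rw [← bar_bar (ev _ _), ← h]
  split_ifs <;> simp

theorem dualBasis_isWeightBasis (hb : IsWeightBasis b w) (hw : Admissible w) :
    IsWeightBasis (dualBasis hb hw) w := by
  classical
  intro i
  rw [mem_weightSpace]
  refine ev_injective (b.ext fun j => ?_)
  rw [ev_smul, ev_kq_smul, Uq.sigma_k, kinv_smul_mem (hb j), map_smul, ev_dualBasis, bar_zpow,
    smul_eq_mul]
  split_ifs with h
  · rw [h]
  · simp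

theorem HasWeights.dual (h : HasWeights M w) : HasWeights (RestrictedDual M) w := by
  obtain ⟨hw, b, hb⟩ := h
  exact ⟨hw, _, dualBasis_isWeightBasis hb hw⟩

theorem InCatO.dual (h : InCatO M) : InCatO (RestrictedDual M) := by
  obtain ⟨ι, w, h⟩ := h
  exact h.dual.inCatO

theorem wt_dual (h : InCatO M) : wt (RestrictedDual M) = wt M := by
  obtain ⟨ι, w, h⟩ := h
  rw [h.wt_eq, h.dual.wt_eq]

/-- `e` acts surjectively. -/
def ESurj (M : Type) [AddCommGroup M] [Module Uq M] : Prop :=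
  Function.Surjective fun x : M => Uq.e • x

/-- `f` acts injectively. -/
def FInj (M : Type) [AddCommGroup M] [Module Uq M] : Prop := ∀ x : M, Uq.f • x = 0 → x = 0

theorem ESurj.dual (h : ESurj M) : FInj (RestrictedDual M) := by
  intro φ hφ
  refine ev_injective (LinearMap.ext fun m => ?_)
  obtain ⟨x, rfl⟩ := h m
  have := ev_smul Uq.f φ x
  rw [hφ, Uq.sigma_f] at this
  exact this.symm

/-- The operator `e` between weight spaces. -/
def eMap (M : Type) [AddCommGroup M] [Module Kq M] [Module Uq M] [IsScalarTower Kq Uq M] (r : ℤ) :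
    weightSpace M r →ₗ[Kq] weightSpace M (r + 2) :=
  (Algebra.lsmul Kq Kq M Uq.e).restrict fun _ hx => e_mem hx

/-- If every weight vector is in the image of `e`, then so is every vector. -/
theorem eSurj_of_basis (h : ∀ i, ∃ y : M, Uq.e • y = b i) : ESurj M := by
  have : LinearMap.range (Algebra.lsmul Kq Kq M Uq.e) = ⊤ := by
    rw [eq_top_iff, ← b.span_eq, Submodule.span_le]
    rintro _ ⟨i, rfl⟩
    exact h i
  exact LinearMap.range_eq_top.mp this

/-- `f` acts injectively if it permutes the basis vectors injectively. -/
theorem fInj_of_basis {s : ι → ι} (hs : Function.Injective s) (h : ∀ i, Uq.f • b i = b (s i)) :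
    FInj M := by
  have hind : LinearIndependent Kq (Algebra.lsmul Kq Kq M Uq.f ∘ b) := by
    have : Algebra.lsmul Kq Kq M Uq.f ∘ b = b ∘ s := funext h
    rw [this]
    exact b.linearIndependent.comp s hs
  intro x hx
  have hinj : Function.Injective (Algebra.lsmul Kq Kq M Uq.f) :=
    LinearMap.ker_eq_bot.mp (LinearMap.ker_eq_bot'.mpr fun y hy => by
      rw [← b.linearCombination_repr y, Finsupp.linearCombination_apply, Finsupp.sum,
        map_sum] at hy
      simp_rw [map_smul] at hy
      have h0 := linearIndependent_iff'.mp hind (b.repr y).support (b.repr y) hy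
      refine b.ext_elem fun i => ?_
      rw [map_zero, Finsupp.zero_apply]
      by_contra hi
      exact hi (h0 i (Finsupp.mem_support_iff.mpr hi)))
  exact hinj (hx.trans (map_zero _).symm)

/-- Duality turns injectivity of `f` into surjectivity of `e`, since `σ(e) = f`. -/
theorem FInj.dual (h : FInj M) (hM : InCatO M) : ESurj (RestrictedDual M) := by
  obtain ⟨ι, w, hw, b, hb⟩ := hM
  refine eSurj_of_basis (b := dualBasis hb hw) fun i => ?_
  -- extend the functional `f x ↦ φ x` from the image of `f`
  classical
  set φ := dualBasis hb hw i with hφ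
  have hfin := InCatO.finite ⟨ι, w, hw, b, hb⟩ (w i - 2)
  have hinj : Function.Injective (Algebra.lsmul Kq Kq M Uq.f) :=
    (injective_iff_map_eq_zero _).mpr h
  obtain ⟨g, hg⟩ := LinearMap.exists_leftInverse_of_injective _ (LinearMap.ker_eq_bot.mpr hinj)
  -- keep only the values in the weight `w i - 2`
  have hfi : ({j | w j = w i - 2} : Set ι).Finite := by
    have : Finite {j | w j = w i - 2} := hw.finite (w i - 2)
    exact Set.toFinite _
  let c : ι →₀ Kq := Finsupp.ofSupportFinite
    (fun j => if w j = w i - 2 then bar (ev φ (g (b j))) else 0)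
    (hfi.subset fun j hj => by
      by_contra h0
      exact hj (if_neg h0))
  refine ⟨dualMk hb c, ev_injective (b.ext fun j => ?_)⟩
  rw [ev_smul, Uq.sigma_e]
  have hval : ∀ y ∈ weightSpace M (w i - 2), ev (dualMk hb c) y = ev φ (g y) := by
    intro y hy
    have hy2 := b.linearCombination_repr y
    rw [Finsupp.linearCombination_apply, Finsupp.sum] at hy2
    rw [← hy2, map_sum, map_sum, map_sum]
    refine Finset.sum_congr rfl fun l hl => ?_
    rw [map_smul, map_smul, map_smul, ev_dualMk]
    have hwl : w l = w i - 2 := by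
      by_contra h
      exact Finsupp.mem_support_iff.mp hl (hb.repr_eq_zero hy h)
    change _ • bar (if w l = w i - 2 then bar (ev φ (g (b l))) else 0) = _
    rw [if_pos hwl, bar_bar]
  by_cases hj : w j = w i
  · have := f_mem (hb j)
    rw [hj] at this
    rw [hval _ this]
    exact congrArg (ev φ) (LinearMap.congr_fun hg (b j))
  · have hij : i ≠ j := fun h0 => hj (by rw [h0])
    rw [hφ, ev_dualBasis, if_neg hij]
    have hy2 := b.linearCombination_repr (Uq.f • b j)
    rw [Finsupp.linearCombination_apply, Finsupp.sum] at hy2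
    rw [← hy2, map_sum]
    refine Finset.sum_eq_zero fun l hl => ?_
    have hwl : w l = w j - 2 := by
      by_contra h
      exact Finsupp.mem_support_iff.mp hl (hb.repr_eq_zero (f_mem (hb j)) h)
    rw [map_smul, ev_dualMk]
    change _ • bar (if w l = w i - 2 then bar (ev φ (g (b l))) else 0) = _
    rw [if_neg (by omega), map_zero, smul_zero]

end duals

section tables

variable {M N : Type} [AddCommGroup M] [Module Kq M] [Module Uq M] [IsScalarTower Kq Uq M]
  [AddCommGroup N] [Module Kq N] [Module Uq N] [IsScalarTower Kq Uq N]

/-! ### The action of `e` and `f` on the members of the family -/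

theorem verma_fInj (s : ℤ) : FInj (Verma s) :=
  fInj_of_basis (b := vermaBasis s) (s := fun n => n + 1) (add_left_injective 1)
    (f_vermaBasis s)

theorem verma_eSurj {s : ℤ} (hs : s < 0) : ESurj (Verma s) :=
  eSurj_of_basis (b := vermaBasis s) fun n => by
    have hne : stringCoeff s (n + 1) ≠ 0 := by
      rw [Ne, stringCoeff_eq_zero]; omega
    refine ⟨(stringCoeff s (n + 1))⁻¹ • vermaBasis s (n + 1), ?_⟩
    rw [smul_comm, e_vermaBasis, smul_smul, inv_mul_cancel₀ hne, one_smul, Nat.add_sub_cancel]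

theorem tilt_fInj (r : ℕ) : FInj (TiltMod r) := by
  refine fInj_of_basis (b := tiltBasis r) (s := Sum.map (· + 1) (· + 1))
    ((add_left_injective 1).sumMap (add_left_injective 1)) ?_
  rintro (n | n)
  · rw [tiltBasis_apply, tiltBasis_apply, f_tiltVec_inl]; rfl
  · rw [tiltBasis_apply, tiltBasis_apply, f_tiltVec_inr]; rfl

theorem tilt_eSurj (r : ℕ) : ESurj (TiltMod r) := by
  obtain ⟨c, hc, h⟩ := exists_e_tiltVec_inr r
  have hinl : ∀ n, ∃ y, Uq.e • y = tiltVec r (Sum.inl n) := by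
    intro n
    by_cases hn : n = r
    · refine ⟨c⁻¹ • tiltVec r (Sum.inr 0), ?_⟩
      rw [smul_comm, h, stringCoeff_zero, zero_smul, zero_add, smul_smul, inv_mul_cancel₀ hc,
        one_smul, add_zero, hn]
    · have hne : stringCoeff r (n + 1) ≠ 0 := by
        rw [Ne, stringCoeff_eq_zero]; omega
      refine ⟨(stringCoeff r (n + 1))⁻¹ • tiltVec r (Sum.inl (n + 1)), ?_⟩
      rw [smul_comm, e_tiltVec_inl, smul_smul, inv_mul_cancel₀ hne, one_smul, Nat.add_sub_cancel]
  refine eSurj_of_basis (b := tiltBasis r) ?_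
  simp only [tiltBasis_apply]
  rintro (n | n)
  · exact hinl n
  · obtain ⟨y, hy⟩ := hinl (r + (n + 1))
    have hne : stringCoeff (-(r : ℤ) - 2) (n + 1) ≠ 0 := by
      rw [Ne, stringCoeff_eq_zero]; omega
    refine ⟨(stringCoeff (-(r : ℤ) - 2) (n + 1))⁻¹ • (tiltVec r (Sum.inr (n + 1)) - c • y), ?_⟩
    rw [smul_comm, smul_sub, smul_comm Uq.e c, hy, h, add_sub_cancel_right, smul_smul,
      inv_mul_cancel₀ hne, one_smul, Nat.add_sub_cancel]

/-- The basis of `M(r)^σ` dual to `fⁿ m_r`. -/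
def coBasis (r : ℤ) : Module.Basis ℕ Kq (RestrictedDual (Verma r)) :=
  dualBasis (vermaBasis_isWeightBasis r) (admissible_mw r)

theorem coBasis_isWeightBasis (r : ℤ) : IsWeightBasis (coBasis r) (mw r) :=
  dualBasis_isWeightBasis _ _

theorem ev_coBasis (r : ℤ) (i j : ℕ) :
    ev (coBasis r i) (vermaBasis r j) = if i = j then 1 else 0 := ev_dualBasis _ _ i j

theorem bar_casimirValue (r : ℤ) : bar (casimirValue r) = casimirValue r := by
  have h : (q⁻¹ - q) ^ 2 = (q - q⁻¹) ^ 2 := by ring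
  rw [casimirValue, map_mul, map_add, bar_zpow, bar_zpow, map_zpow₀, map_sub, map_inv₀, bar_q,
    inv_inv, zpow_neg _ (2 : ℤ), zpow_neg _ (2 : ℤ), zpow_ofNat, zpow_ofNat, h, add_comm]
  congr 3 <;> ring

theorem bar_stringCoeff (r : ℤ) (n : ℕ) : bar (stringCoeff r n) = stringCoeff r n := by
  rw [stringCoeff, map_sub, bar_casimirValue, bar_casimirValue]

theorem e_coBasis (r : ℤ) (n : ℕ) : Uq.e • coBasis r (n + 1) = coBasis r n := by
  refine ev_injective ((vermaBasis r).ext fun j => ?_)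
  rw [ev_smul, Uq.sigma_e, f_vermaBasis, ev_coBasis, ev_coBasis]
  simp

theorem e_coBasis_zero (r : ℤ) : Uq.e • coBasis r 0 = 0 := by
  refine ev_injective ((vermaBasis r).ext fun j => ?_)
  rw [ev_smul, Uq.sigma_e, f_vermaBasis, ev_coBasis, ev_zero, if_neg (by omega)]

theorem f_coBasis (r : ℤ) (n : ℕ) :
    Uq.f • coBasis r n = stringCoeff r (n + 1) • coBasis r (n + 1) := by
  refine ev_injective ((vermaBasis r).ext fun j => ?_)
  rw [ev_smul, Uq.sigma_f, e_vermaBasis, map_smul, ev_kq_smul, ev_coBasis, ev_coBasis,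
    bar_stringCoeff, smul_eq_mul]
  rcases j with _ | j
  · simp [stringCoeff_zero]
  · by_cases h : n = j
    · simp [h]
    · simp [h]

theorem e_pow_coBasis (r : ℤ) (n m : ℕ) : Uq.e ^ n • coBasis r (m + n) = coBasis r m := by
  induction n with
  | zero => simp
  | succ n ih => rw [pow_succ, mul_smul, ← add_assoc, e_coBasis, ih]

theorem coBasis_sing (r : ℤ) : IsSing r (coBasis r 0) := by
  refine ⟨?_, e_coBasis_zero r⟩
  have := coBasis_isWeightBasis r 0
  simpa [mw] using this

theorem f_pow_coBasis (r : ℤ) (m n : ℕ) : Uq.f ^ n • coBasis r m =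
    (∏ j ∈ Finset.range n, stringCoeff r (m + j + 1)) • coBasis r (m + n) := by
  induction n with
  | zero => simp
  | succ n ih =>
    rw [pow_succ', mul_smul, ih, smul_comm, f_coBasis, smul_smul, Finset.prod_range_succ]
    rfl

theorem verma_dual_eSurj (s : ℤ) : ESurj (RestrictedDual (Verma s)) :=
  (verma_fInj s).dual (verma_hasWeights s).inCatO

theorem verma_dual_hasWeights (s : ℤ) : HasWeights (RestrictedDual (Verma s)) (mw s) :=
  (verma_hasWeights s).dual

/-! ### Singular vectors of the members of the family -/

theorem IsWeightBasis.eq_smul {ι : Type} {b : Module.Basis ι Kq M} {w : ι → ℤ}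
    (hb : IsWeightBasis b w) (hw : Function.Injective w) {r : ℤ} {x : M}
    (hx : x ∈ weightSpace M r) (h0 : x ≠ 0) :
    ∃ (i : ι) (c : Kq), c ≠ 0 ∧ w i = r ∧ x = c • b i := by
  classical
  have hex : ∃ i, b.repr x i ≠ 0 := by
    by_contra! h
    exact h0 (b.ext_elem fun i => by rw [h i, map_zero, Finsupp.zero_apply])
  obtain ⟨i, hi⟩ := hex
  have hwi : w i = r := by
    by_contra h
    exact hi (hb.repr_eq_zero hx h)
  refine ⟨i, b.repr x i, hi, hwi, b.ext_elem fun j => ?_⟩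
  rw [map_smul, b.repr_self, Finsupp.smul_apply, Finsupp.single_apply]
  split_ifs with hij
  · simp [hij]
  · rw [smul_zero]
    exact hb.repr_eq_zero hx fun h => hij (hw (hwi.trans h.symm))

theorem verma_sing {s r : ℤ} {x : Verma s} (hx : IsSing r x) (h0 : x ≠ 0) :
    (r = s ∧ ∃ c : Kq, x = c • vermaGen s) ∨
      (0 ≤ s ∧ r = -s - 2 ∧ ∃ c : Kq, x = c • Uq.f ^ (s + 1).toNat • vermaGen s) := by
  obtain ⟨n, c, hc, hn, rfl⟩ := (vermaBasis_isWeightBasis s).eq_smul (mw_injective s) hx.1 h0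
  have h := hx.2
  rw [smul_comm, e_vermaBasis, smul_smul] at h
  have hco : stringCoeff s n = 0 := by
    rcases mul_eq_zero.mp ((smul_eq_zero.mp h).resolve_right ((vermaBasis s).ne_zero _)) with h | h
    · exact absurd h hc
    · exact h
  unfold mw at hn
  rcases Nat.eq_zero_or_pos n with rfl | hpos
  · left
    exact ⟨by simpa using hn.symm, c, by rw [vermaBasis_apply, pow_zero, one_smul]⟩
  · right
    have h1 := (stringCoeff_eq_zero.mp hco).resolve_left hpos.ne'
    refine ⟨by omega, by omega, c, ?_⟩
    rw [vermaBasis_apply, ← h1, Int.toNat_natCast]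

theorem simple_sing {s : ℕ} {r : ℤ} {x : SimpleMod (s : ℤ)} (hx : IsSing r x) (h0 : x ≠ 0) :
    r = s ∧ ∃ c : Kq, x = c • simpleGen (s : ℤ) := by
  obtain ⟨n, c, hc, hn, rfl⟩ := (simpleBasis_isWeightBasis s).eq_smul (vw_injective s) hx.1 h0
  have h := hx.2
  rw [smul_comm, simpleBasis_apply, (simpleGen_sing _).e_f_pow', smul_smul] at h
  have hne : Uq.f ^ ((n : ℕ) - 1) • simpleGen (s : ℤ) ≠ 0 := by
    have := (simpleBasis s).ne_zero ⟨(n : ℕ) - 1, by omega⟩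
    rwa [simpleBasis_apply] at this
  have hco : stringCoeff s n = 0 := by
    rcases mul_eq_zero.mp ((smul_eq_zero.mp h).resolve_right hne) with h | h
    · exact absurd h hc
    · exact h
  unfold vw at hn
  rcases stringCoeff_eq_zero.mp hco with h1 | h1
  · exact ⟨by omega, c, by rw [simpleBasis_apply, h1, pow_zero, one_smul]⟩
  · omega

theorem coVerma_sing {s r : ℤ} {x : RestrictedDual (Verma s)} (hx : IsSing r x)
    (h0 : x ≠ 0) : r = s ∧ ∃ c : Kq, x = c • coBasis s 0 := by
  obtain ⟨n, c, hc, hn, rfl⟩ := (coBasis_isWeightBasis s).eq_smul (mw_injective s) hx.1 h0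
  unfold mw at hn
  rcases n with _ | n
  · exact ⟨by simpa using hn.symm, c, rfl⟩
  · exfalso
    have h := hx.2
    rw [smul_comm, e_coBasis] at h
    exact (smul_ne_zero hc ((coBasis s).ne_zero n)) h

theorem tilt_repr_e (s : ℕ) : ∃ c : Kq, c ≠ 0 ∧ ∀ (x : TiltMod s) (m : ℕ),
    (tiltBasis s).repr (Uq.e • x) (Sum.inr m) =
      stringCoeff (-(s : ℤ) - 2) (m + 1) * (tiltBasis s).repr x (Sum.inr (m + 1)) ∧
    (tiltBasis s).repr (Uq.e • x) (Sum.inl m) =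
      stringCoeff s (m + 1) * (tiltBasis s).repr x (Sum.inl (m + 1)) +
        if s ≤ m then c * (tiltBasis s).repr x (Sum.inr (m - s)) else 0 := by
  obtain ⟨c, hc, h⟩ := exists_e_tiltVec_inr s
  have h1 : ∀ n m, (tiltBasis s).repr (tiltVec s n) m = if n = m then 1 else 0 := by
    intro n m
    rw [← tiltBasis_apply, Module.Basis.repr_self, Finsupp.single_apply]
  refine ⟨c, hc, fun x m => ⟨?_, ?_⟩⟩
  · have : ((tiltBasis s).coord (Sum.inr m)).comp (Algebra.lsmul Kq Kq _ Uq.e) =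
        stringCoeff (-(s : ℤ) - 2) (m + 1) • (tiltBasis s).coord (Sum.inr (m + 1)) := by
      refine (tiltBasis s).ext ?_
      rintro (n | n)
      · simp only [LinearMap.comp_apply, lsmul_apply', tiltBasis_apply, e_tiltVec_inl, map_smul,
          LinearMap.smul_apply, Module.Basis.coord_apply, h1, reduceCtorEq, if_false, smul_zero]
      · simp only [LinearMap.comp_apply, lsmul_apply', tiltBasis_apply, h, map_smul, map_add,
          LinearMap.smul_apply, Module.Basis.coord_apply, h1, reduceCtorEq, if_false, smul_zero,
          add_zero, Sum.inr.injEq]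
        rcases n with _ | n
        · simp [stringCoeff_zero]
        · by_cases hn : n = m <;> simp [hn]
    exact LinearMap.congr_fun this x
  · have : ((tiltBasis s).coord (Sum.inl m)).comp (Algebra.lsmul Kq Kq _ Uq.e) =
        stringCoeff s (m + 1) • (tiltBasis s).coord (Sum.inl (m + 1)) +
          (if s ≤ m then c else 0) • (tiltBasis s).coord (Sum.inr (m - s)) := by
      refine (tiltBasis s).ext ?_
      rintro (n | n)
      · simp only [LinearMap.comp_apply, lsmul_apply', tiltBasis_apply, e_tiltVec_inl, map_smul,
          LinearMap.add_apply, LinearMap.smul_apply, Module.Basis.coord_apply, h1, reduceCtorEq,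
          if_false, smul_zero, add_zero, Sum.inl.injEq]
        rcases n with _ | n
        · simp [stringCoeff_zero]
        · by_cases hn : n = m <;> simp [hn]
      · simp only [LinearMap.comp_apply, lsmul_apply', tiltBasis_apply, h, map_smul, map_add,
          LinearMap.add_apply, LinearMap.smul_apply, Module.Basis.coord_apply, h1, reduceCtorEq,
          if_false, Sum.inr.injEq, Sum.inl.injEq, smul_eq_mul, mul_zero, zero_add]
        by_cases h2 : s + n = m
        · rw [if_pos h2, if_pos (by omega), if_pos (by omega)]
        · rw [if_neg h2]
          by_cases h3 : s ≤ m
          · rw [if_neg (show ¬ n = m - s by omega)]; simp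
          · simp [h3]
    have h2 := LinearMap.congr_fun this x
    refine h2.trans ?_
    split_ifs <;> simp

theorem tilt_sing {s : ℕ} {r : ℤ} {x : TiltMod s} (hx : IsSing r x) (h0 : x ≠ 0) :
    (r = s ∧ ∃ c : Kq, x = c • tiltTop s) ∨
      (r = -s - 2 ∧ ∃ c : Kq, x = c • Uq.f ^ (s + 1) • tiltTop s) := by
  set b := tiltBasis s with hb
  obtain ⟨c, hc, h⟩ := tilt_repr_e s
  have he := hx.2
  have hinr : ∀ n, b.repr x (Sum.inr n) = 0 := by
    intro n
    rcases n with _ | n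
    · have h1 := (h x s).2
      rw [he, map_zero, Finsupp.zero_apply,
        stringCoeff_eq_zero.mpr (Or.inr (by push_cast; ring)), zero_mul, zero_add, if_pos le_rfl,
        Nat.sub_self] at h1
      exact (mul_eq_zero.mp h1.symm).resolve_left hc
    · have h1 := (h x n).1
      rw [he, map_zero, Finsupp.zero_apply] at h1
      refine (mul_eq_zero.mp h1.symm).resolve_left ?_
      rw [stringCoeff_eq_zero]; omega
  have hinl : ∀ n, n ≠ 0 → n ≠ s + 1 → b.repr x (Sum.inl n) = 0 := by
    intro n hn hn'
    obtain ⟨n, rfl⟩ := Nat.exists_eq_succ_of_ne_zero hn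
    have h1 := (h x n).2
    rw [he, map_zero, Finsupp.zero_apply, ← hb, hinr, mul_zero, ite_self, add_zero] at h1
    refine (mul_eq_zero.mp h1.symm).resolve_left ?_
    rw [stringCoeff_eq_zero]; omega
  have hbw := tiltBasis_isWeightBasis s
  by_cases h1 : b.repr x (Sum.inl 0) = 0
  · have h2 : b.repr x (Sum.inl (s + 1)) ≠ 0 := by
      intro h2
      refine h0 (b.ext_elem ?_)
      rw [map_zero]
      rintro (n | n)
      · by_cases hn : n = 0
        · rw [hn, h1]; rfl
        · by_cases hn' : n = s + 1
          · rw [hn', h2]; rfl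
          · rw [hinl n hn hn']; rfl
      · rw [hinr]; rfl
    right
    constructor
    · by_contra hr
      refine h2 (hbw.repr_eq_zero hx.1 ?_)
      simp only [tw, Sum.elim_inl, mw]
      push_cast; omega
    · refine ⟨b.repr x (Sum.inl (s + 1)), b.ext_elem ?_⟩
      have h3 : Uq.f ^ (s + 1) • tiltTop s = b (Sum.inl (s + 1)) := by
        rw [hb, tiltBasis_apply]; rfl
      rw [h3, map_smul, b.repr_self]
      rintro (n | n)
      · by_cases hn' : n = s + 1
        · rw [hn']; simp
        · by_cases hn : n = 0
          · rw [hn, h1]; simp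
          · rw [hinl n hn hn']
            simp [Ne.symm hn']
      · rw [hinr]; simp
  · left
    have hr : r = s := by
      by_contra hr
      refine h1 (hbw.repr_eq_zero hx.1 ?_)
      simp only [tw, Sum.elim_inl, mw]
      push_cast; omega
    refine ⟨hr, b.repr x (Sum.inl 0), b.ext_elem ?_⟩
    have h3 : tiltTop s = b (Sum.inl 0) := by
      rw [hb, tiltBasis_apply]; simp [tiltVec]
    rw [h3, map_smul, b.repr_self]
    rintro (n | n)
    · by_cases hn : n = 0
      · rw [hn]; simp
      · by_cases hn' : n = s + 1
        · rw [hn', hbw.repr_eq_zero hx.1 (by simp only [tw, Sum.elim_inl, mw]; push_cast; omega)]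
          simp
        · rw [hinl n hn hn']
          simp [Ne.symm hn]
    · rw [hinr]; simp

/-! ### The module `M(r)^σ` as a quotient of `T(r)` -/

theorem prod_stringCoeff_ne_zero' {r : ℤ} {m n : ℕ} (h : m + n ≤ r ∨ r < m) :
    ∏ j ∈ Finset.range n, stringCoeff r (m + j + 1) ≠ 0 := by
  rw [Finset.prod_ne_zero_iff]
  intro j hj
  have := Finset.mem_range.mp hj
  rw [Ne, stringCoeff_eq_zero]
  omega

/-- The generator of `M(r)^σ`, of weight `-r-2`. -/
def coGen (r : ℕ) : RestrictedDual (Verma (r : ℤ)) := coBasis r (r + 1)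

theorem coGen_isGen (r : ℕ) : IsGen (-(r : ℤ) - 2) (coGen r) ∧
    Uq.casimir • coGen r = casimirValue r • coGen r := by
  have hw : coGen r ∈ weightSpace _ (-(r : ℤ) - 2) := by
    have := coBasis_isWeightBasis r (r + 1)
    unfold mw at this
    rwa [show (r : ℤ) - 2 * ((r + 1 : ℕ) : ℤ) = -r - 2 by push_cast; ring] at this
  have hcas : Uq.casimir • coGen r = casimirValue r • coGen r := by
    have h1 := f_e_smul hw
    rw [coGen, e_coBasis, f_coBasis, stringCoeff_eq_zero.mpr (Or.inr (by push_cast; ring)),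
      zero_smul, casimirValue_neg] at h1
    exact (sub_eq_zero.mp h1.symm)
  refine ⟨⟨hw, ?_⟩, hcas⟩
  rw [sq, map_mul, mul_smul, X_sub_C_smul _ (coGen r), hcas, casimirValue_neg, sub_self, smul_zero]

theorem e_pow_coGen (r : ℕ) : Uq.e ^ (r + 1) • coGen r = coBasis r 0 := by
  have := e_pow_coBasis r (r + 1) 0
  rwa [zero_add] at this

/-- The projection `T(r) → M(r)^σ`. -/
def tiltToCo (r : ℕ) : TiltMod r →ₗ[Uq] RestrictedDual (Verma (r : ℤ)) :=
  tiltLift (coGen_isGen r).1 (by rw [pow_succ', mul_smul, e_pow_coGen, e_coBasis_zero])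

theorem tiltToCo_inl (r n : ℕ) : tiltToCo r (tiltVec r (Sum.inl n)) =
    (∏ j ∈ Finset.range n, stringCoeff r (0 + j + 1)) • coBasis r n := by
  rw [tiltVec, Sum.elim_inl, tiltTop, map_smul, map_smul, tiltToCo, tiltLift_gen, e_pow_coGen,
    f_pow_coBasis, zero_add]

theorem tiltToCo_inr (r n : ℕ) : tiltToCo r (tiltVec r (Sum.inr n)) =
    (∏ j ∈ Finset.range n, stringCoeff r (r + 1 + j + 1)) • coBasis r (r + 1 + n) := by
  rw [tiltVec, Sum.elim_inr, map_smul, tiltToCo, tiltLift_gen, coGen, f_pow_coBasis]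

theorem tiltToCo_surjective (r : ℕ) : Function.Surjective (tiltToCo r) := by
  have : LinearMap.range ((tiltToCo r).restrictScalars Kq) = ⊤ := by
    rw [eq_top_iff, ← (coBasis r).span_eq, Submodule.span_le]
    rintro _ ⟨n, rfl⟩
    by_cases hn : n ≤ r
    · have hne := prod_stringCoeff_ne_zero' (r := r) (m := 0) (n := n)
        (Or.inl (by push_cast; omega))
      refine ⟨(∏ j ∈ Finset.range n, stringCoeff r (0 + j + 1))⁻¹ • tiltVec r (Sum.inl n), ?_⟩
      rw [map_smul]
      change _ • tiltToCo r _ = _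
      rw [tiltToCo_inl, smul_smul, inv_mul_cancel₀ hne, one_smul]
    · obtain ⟨m, rfl⟩ := Nat.exists_eq_add_of_le (show r + 1 ≤ n by omega)
      have hne := prod_stringCoeff_ne_zero' (r := r) (m := r + 1) (n := m)
        (Or.inr (by push_cast; omega))
      refine ⟨(∏ j ∈ Finset.range m, stringCoeff r (r + 1 + j + 1))⁻¹ • tiltVec r (Sum.inr m), ?_⟩
      rw [map_smul]
      change _ • tiltToCo r _ = _
      rw [tiltToCo_inr, smul_smul, inv_mul_cancel₀ hne, one_smul]
  intro y
  exact LinearMap.range_eq_top.mp this y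

theorem tiltToCo_ker {r : ℕ} {x : TiltMod r} (hx : tiltToCo r x = 0) :
    (∀ n ≤ r, (tiltBasis r).repr x (Sum.inl n) = 0) ∧
      ∀ n, (tiltBasis r).repr x (Sum.inr n) = 0 := by
  have hrep : ∀ m n, (coBasis r).repr (coBasis r m) n = if m = n then 1 else 0 := by
    intro m n
    rw [Module.Basis.repr_self, Finsupp.single_apply]
  constructor
  · intro n hn
    have : ((coBasis r).coord n).comp ((tiltToCo r).restrictScalars Kq) =
        (∏ j ∈ Finset.range n, stringCoeff r (0 + j + 1)) • (tiltBasis r).coord (Sum.inl n) := by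
      refine (tiltBasis r).ext ?_
      rintro (m | m)
      · change (coBasis r).repr (tiltToCo r (tiltBasis r (Sum.inl m))) n =
          _ * (tiltBasis r).repr (tiltBasis r (Sum.inl m)) (Sum.inl n)
        rw [Module.Basis.repr_self, tiltBasis_apply, tiltToCo_inl, map_smul, Finsupp.smul_apply,
          hrep, Finsupp.single_apply]
        by_cases h : m = n
        · simp [h]
        · simp [h]
      · change (coBasis r).repr (tiltToCo r (tiltBasis r (Sum.inr m))) n =
          _ * (tiltBasis r).repr (tiltBasis r (Sum.inr m)) (Sum.inl n)
        rw [Module.Basis.repr_self, tiltBasis_apply, tiltToCo_inr, map_smul, Finsupp.smul_apply,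
          hrep, if_neg (by omega)]
        simp
    have h2 := LinearMap.congr_fun this x
    change (coBasis r).repr (tiltToCo r x) n = _ * (tiltBasis r).repr x (Sum.inl n) at h2
    rw [hx, map_zero, Finsupp.zero_apply] at h2
    exact (mul_eq_zero.mp h2.symm).resolve_left
      (prod_stringCoeff_ne_zero' (Or.inl (by push_cast; omega)))
  · intro n
    have : ((coBasis r).coord (r + 1 + n)).comp ((tiltToCo r).restrictScalars Kq) =
        (∏ j ∈ Finset.range n, stringCoeff r (r + 1 + j + 1)) •
          (tiltBasis r).coord (Sum.inr n) := by
      refine (tiltBasis r).ext ?_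
      rintro (m | m)
      · change (coBasis r).repr (tiltToCo r (tiltBasis r (Sum.inl m))) (r + 1 + n) =
          _ * (tiltBasis r).repr (tiltBasis r (Sum.inl m)) (Sum.inr n)
        rw [Module.Basis.repr_self, tiltBasis_apply, tiltToCo_inl, map_smul, Finsupp.smul_apply,
          hrep, Finsupp.single_apply, if_neg (by simp : ¬ Sum.inl m = Sum.inr n)]
        by_cases h : m = r + 1 + n
        · -- `f ^ (r + 1)` kills the singular vector of `M(r)^σ`
          have h0 : ∏ j ∈ Finset.range m, stringCoeff r (0 + j + 1) = 0 :=
            Finset.prod_eq_zero (i := r) (Finset.mem_range.mpr (by omega))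
              (stringCoeff_eq_zero.mpr (Or.inr (by push_cast; ring)))
          rw [h0]
          simp
        · simp [h]
      · change (coBasis r).repr (tiltToCo r (tiltBasis r (Sum.inr m))) (r + 1 + n) =
          _ * (tiltBasis r).repr (tiltBasis r (Sum.inr m)) (Sum.inr n)
        rw [Module.Basis.repr_self, tiltBasis_apply, tiltToCo_inr, map_smul, Finsupp.smul_apply,
          hrep, Finsupp.single_apply]
        by_cases h : m = n
        · simp [h]
        · simp [h]
    have h2 := LinearMap.congr_fun this x
    change (coBasis r).repr (tiltToCo r x) (r + 1 + n) =
      _ * (tiltBasis r).repr x (Sum.inr n) at h2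
    rw [hx, map_zero, Finsupp.zero_apply] at h2
    exact (mul_eq_zero.mp h2.symm).resolve_left
      (prod_stringCoeff_ne_zero' (Or.inr (by push_cast; omega)))

/-- The universal property of `M(r)^σ`, as a quotient of `T(r)`: its generator has weight `-r-2` and
is killed by `f ^ (r + 1) e ^ (r + 1)`. -/
theorem exists_coLift {r : ℕ} {x : M} (hM : ENilpotent M) (hx : IsGen (-(r : ℤ) - 2) x)
    (h : Uq.f ^ (r + 1) • Uq.e ^ (r + 1) • x = 0) :
    ∃ φ : RestrictedDual (Verma (r : ℤ)) →ₗ[Uq] M, φ (coGen r) = x := by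
  set ψ := tiltLift hx (hx.e_pow hM) with hψ
  have hker : LinearMap.ker (tiltToCo r) ≤ LinearMap.ker ψ := by
    intro y hy
    obtain ⟨h1, h2⟩ := tiltToCo_ker hy
    rw [LinearMap.mem_ker, ← (tiltBasis r).linearCombination_repr y,
      Finsupp.linearCombination_apply, Finsupp.sum, map_sum]
    refine Finset.sum_eq_zero fun i hi => ?_
    rcases i with n | n
    · have hn : r + 1 ≤ n := by
        by_contra hn
        exact Finsupp.mem_support_iff.mp hi (h1 n (by omega))
      obtain ⟨m, rfl⟩ := Nat.exists_eq_add_of_le' hn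
      change (ψ.restrictScalars Kq) _ = 0
      rw [map_smul]
      change _ • ψ _ = 0
      rw [tiltBasis_apply, tiltVec, Sum.elim_inl, tiltTop, map_smul, map_smul, hψ, tiltLift_gen,
        pow_add, mul_smul, h, smul_zero, smul_zero]
    · exact absurd (h2 n) (Finsupp.mem_support_iff.mp hi)
  let eqv := (tiltToCo r).quotKerEquivOfSurjective (tiltToCo_surjective r)
  refine ⟨((LinearMap.ker (tiltToCo r)).liftQ ψ hker).comp eqv.symm.toLinearMap, ?_⟩
  have h1 : eqv ((LinearMap.ker (tiltToCo r)).mkQ (tiltGen r)) = coGen r := by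
    change tiltToCo r (tiltGen r) = _
    rw [tiltToCo, tiltLift_gen]
  change (LinearMap.ker (tiltToCo r)).liftQ ψ hker (eqv.symm (coGen r)) = x
  rw [← h1, eqv.symm_apply_apply]
  change ψ (tiltGen r) = x
  rw [hψ, tiltLift_gen]

end tables

/-! ### Pairs of linear maps `F : A → B` and `E : B → A` -/

section normalForm

variable {K A B : Type} [Field K] [AddCommGroup A] [Module K A] [AddCommGroup B] [Module K B]

/-- A family in `S'` that is a basis of `S'` modulo `S ⊓ S'`. -/
theorem exists_relative_basis [FiniteDimensional K A] (S S' : Submodule K A) :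
    ∃ (n : ℕ) (v : Fin n → A), (∀ i, v i ∈ S') ∧ (∀ c : Fin n → K, ∑ i, c i • v i ∈ S → c = 0) ∧
      ∀ x ∈ S', ∃ c : Fin n → K, x - ∑ i, c i • v i ∈ S := by
  set P := S.comap S'.subtype
  set b := Module.finBasis K (S' ⧸ P)
  choose y hy using fun i => P.mkQ_surjective (b i)
  have hmk : ∀ c : Fin _ → K, P.mkQ (∑ i, c i • y i) = ∑ i, c i • b i := fun c => by
    rw [map_sum]
    exact Finset.sum_congr rfl fun i _ => by rw [map_smul, hy]
  have hcoe : ∀ c : Fin _ → K, ∑ i, c i • (y i : A) = ((∑ i, c i • y i : S') : A) := fun c => by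
    simp
  refine ⟨_, fun i => y i, fun i => (y i).2, fun c hc => ?_, fun x hx => ?_⟩
  · have h0 : P.mkQ (∑ i, c i • y i) = 0 := by
      refine (Submodule.Quotient.mk_eq_zero P).mpr ?_
      change ((∑ i, c i • y i : S') : A) ∈ S
      rwa [← hcoe]
    rw [hmk] at h0
    exact funext (Fintype.linearIndependent_iff.mp b.linearIndependent c h0)
  · refine ⟨b.repr (P.mkQ ⟨x, hx⟩), ?_⟩
    have h0 : P.mkQ (⟨x, hx⟩ - ∑ i, b.repr (P.mkQ ⟨x, hx⟩) i • y i) = 0 := by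
      rw [map_sub, hmk, b.sum_repr, sub_self]
    have := (Submodule.Quotient.mk_eq_zero P).mp h0
    rw [hcoe]
    exact this

/-- Bases adapted to a pair of linear maps. If `E F = 0`, they split the pair into indecomposables
of five kinds, generated by the vectors `v`, `m`, `s`, `t`, `z`: the vectors `v`, `m`, `E s`, `E t`
form a basis of `A`, and `F m`, `F E t`, `z`, `s`, `t` one of `B`. Of the second basis only the
parts are stated that are used: the members in the kernel of `E` are independent, and all of them
span. -/
theorem exists_normalForm [FiniteDimensional K A] [FiniteDimensional K B] (F : A →ₗ[K] B)
    (E : B →ₗ[K] A) :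
    ∃ (nv nm ns nt nz : ℕ) (v : Fin nv → A) (m : Fin nm → A) (s : Fin ns → B) (t : Fin nt → B)
      (z : Fin nz → B), (∀ i, F (v i) = 0) ∧ (∀ i, F (E (s i)) = 0) ∧ (∀ i, E (z i) = 0) ∧
      LinearIndependent K (Sum.elim v (Sum.elim m (Sum.elim (E ∘ s) (E ∘ t)))) ∧
      LinearIndependent K (Sum.elim (F ∘ m) (Sum.elim (F ∘ E ∘ t) z)) ∧
      (∀ P : Submodule K A, (∀ i, v i ∈ P) → (∀ i, m i ∈ P) → (∀ i, E (s i) ∈ P) →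
        (∀ i, E (t i) ∈ P) → P = ⊤) ∧
      (∀ P : Submodule K B, (∀ a, F a ∈ P) → (∀ i, s i ∈ P) → (∀ i, t i ∈ P) →
        (∀ i, z i ∈ P) → P = ⊤) := by
  set I := LinearMap.range E
  set N := LinearMap.ker F
  -- choose complements along `I ⊓ N ≤ I`, `I ⊓ N ≤ N`, `I ⊔ N ≤ A` and `range F ⊓ ker E ≤ ker E`
  obtain ⟨ns, s', hs', hs1, hs2⟩ := exists_relative_basis ⊥ (I ⊓ N)
  obtain ⟨nt, t', ht', ht1, ht2⟩ := exists_relative_basis (I ⊓ N) I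
  obtain ⟨nv, v, hv, hv1, hv2⟩ := exists_relative_basis (I ⊓ N) N
  obtain ⟨nm, m, hm, hm1, hm2⟩ := exists_relative_basis (I ⊔ N) ⊤
  obtain ⟨nz, z, hz, hz1, hz2⟩ := exists_relative_basis (LinearMap.range F) (LinearMap.ker E)
  choose s hs using fun i => (hs' i).1
  choose t ht using ht'
  have hEs : E ∘ s = s' := funext hs
  have hEt : E ∘ t = t' := funext ht
  have hsum : ∀ {n : ℕ} {y : Fin n → A} (P : Submodule K A), (∀ i, y i ∈ P) →
      ∀ c : Fin n → K, ∑ i, c i • y i ∈ P := fun P hy c =>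
    Submodule.sum_mem _ fun i _ => P.smul_mem _ (hy i)
  have hsum' : ∀ {n : ℕ} {y : Fin n → B} (P : Submodule K B), (∀ i, y i ∈ P) →
      ∀ c : Fin n → K, ∑ i, c i • y i ∈ P := fun P hy c =>
    Submodule.sum_mem _ fun i _ => P.smul_mem _ (hy i)
  refine ⟨nv, nm, ns, nt, nz, v, m, s, t, z, fun i => hv i, fun i => ?_, fun i => hz i, ?_, ?_,
    ?_, ?_⟩
  · rw [hs]; exact (hs' i).2
  · rw [hEs, hEt, Fintype.linearIndependent_iff]
    intro g hg
    simp only [Fintype.sum_sum_type, Sum.elim_inl, Sum.elim_inr] at hg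
    have h1 := hsum N hv fun i => g (Sum.inl i)
    have h3 := hsum _ hs' fun i => g (Sum.inr (Sum.inr (Sum.inl i)))
    have h4 := hsum I (fun i => ⟨t i, ht i⟩ : ∀ i, t' i ∈ I)
      fun i => g (Sum.inr (Sum.inr (Sum.inr i)))
    have e2 : (fun i => g (Sum.inr (Sum.inl i))) = 0 := by
      refine hm1 _ ?_
      rw [add_left_comm] at hg
      rw [eq_neg_of_add_eq_zero_left hg, neg_mem_iff]
      exact add_mem (Submodule.mem_sup_right h1)
        (add_mem (Submodule.mem_sup_left h3.1) (Submodule.mem_sup_left h4))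
    have e2' := congrFun e2
    simp only [Pi.zero_apply] at e2'
    simp only [e2', zero_smul, Finset.sum_const_zero, zero_add] at hg
    have e1 : (fun i => g (Sum.inl i)) = 0 := by
      refine hv1 _ ⟨?_, h1⟩
      rw [eq_neg_of_add_eq_zero_left hg]
      exact neg_mem (add_mem h3.1 h4)
    have e1' := congrFun e1
    simp only [Pi.zero_apply] at e1'
    simp only [e1', zero_smul, Finset.sum_const_zero, zero_add] at hg
    have e4 : (fun i => g (Sum.inr (Sum.inr (Sum.inr i)))) = 0 := by
      refine ht1 _ ?_
      rw [eq_neg_of_add_eq_zero_right hg]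
      exact neg_mem h3
    have e4' := congrFun e4
    simp only [Pi.zero_apply] at e4'
    simp only [e4', zero_smul, Finset.sum_const_zero, add_zero] at hg
    have e3 := congrFun (hs1 (fun i => g (Sum.inr (Sum.inr (Sum.inl i))))
      ((Submodule.mem_bot K).mpr hg))
    rintro (i | i | i | i)
    · exact e1' i
    · exact e2' i
    · exact e3 i
    · exact e4' i
  · rw [hEt, Fintype.linearIndependent_iff]
    intro g hg
    simp only [Fintype.sum_sum_type, Sum.elim_inl, Sum.elim_inr, Function.comp_apply,
      ← map_smul, ← map_sum] at hg
    have e3 : (fun i => g (Sum.inr (Sum.inr i))) = 0 := by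
      refine hz1 _ ?_
      rw [← add_assoc, ← map_add] at hg
      rw [eq_neg_of_add_eq_zero_right hg]
      exact neg_mem ⟨_, rfl⟩
    have e3' := congrFun e3
    simp only [Pi.zero_apply] at e3'
    simp only [e3', zero_smul, Finset.sum_const_zero, add_zero, ← map_add] at hg
    have hN : ∑ i, g (Sum.inl i) • m i + ∑ i, g (Sum.inr (Sum.inl i)) • t' i ∈ N := hg
    have h4 := hsum I (fun i => ⟨t i, ht i⟩ : ∀ i, t' i ∈ I) fun i => g (Sum.inr (Sum.inl i))
    have e1 : (fun i => g (Sum.inl i)) = 0 := by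
      refine hm1 _ ?_
      have := Submodule.sub_mem (I ⊔ N) (Submodule.mem_sup_right hN) (Submodule.mem_sup_left h4)
      rwa [add_sub_cancel_right] at this
    have e1' := congrFun e1
    simp only [Pi.zero_apply] at e1'
    simp only [e1', zero_smul, Finset.sum_const_zero, zero_add] at hN
    have e2 := congrFun (ht1 (fun i => g (Sum.inr (Sum.inl i))) ⟨h4, hN⟩)
    rintro (i | i | i)
    · exact e1' i
    · exact e2 i
    · exact e3' i
  · intro P h1 h2 h3 h4
    have hI0 : I ⊓ N ≤ P := by
      intro x hx
      obtain ⟨c, hc⟩ := hs2 x hx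
      rw [(sub_eq_zero.mp ((Submodule.mem_bot K).mp hc))]
      exact hsum P (fun i => hs i ▸ h3 i) c
    have hN : N ≤ P := by
      intro x hx
      obtain ⟨c, hc⟩ := hv2 x hx
      have := add_mem (hI0 hc) (hsum P h1 c)
      rwa [sub_add_cancel] at this
    have hI : I ≤ P := by
      intro x hx
      obtain ⟨c, hc⟩ := ht2 x hx
      have := add_mem (hI0 hc) (hsum P (fun i => ht i ▸ h4 i) c)
      rwa [sub_add_cancel] at this
    rw [eq_top_iff]
    intro x hx
    obtain ⟨c, hc⟩ := hm2 x hx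
    have := add_mem (sup_le hI hN hc) (hsum P h2 c)
    rwa [sub_add_cancel] at this
  · intro P h1 h2 h3 h4
    have hker : LinearMap.ker E ≤ P := by
      intro x hx
      obtain ⟨c, hc⟩ := hz2 x hx
      have hr : LinearMap.range F ≤ P := by
        rintro _ ⟨a, rfl⟩
        exact h1 a
      have := add_mem (hr hc) (hsum' P h4 c)
      rwa [sub_add_cancel] at this
    rw [eq_top_iff]
    intro x _
    obtain ⟨c, hc⟩ := ht2 (E x) ⟨x, rfl⟩
    obtain ⟨d, hd⟩ := hs2 _ hc
    have hx : x - ∑ i, c i • t i - ∑ i, d i • s i ∈ LinearMap.ker E := by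
      rw [LinearMap.mem_ker, map_sub, map_sub, map_sum, map_sum, ← (Submodule.mem_bot K).mp hd]
      simp only [map_smul, hs, ht]
    have := add_mem (hker hx) (add_mem (hsum' P h3 c) (hsum' P h2 d))
    rwa [← add_sub_cancel_right x (∑ i, c i • t i + ∑ i, d i • s i), add_sub_assoc,
      show x + (∑ i, c i • t i + ∑ i, d i • s i - (∑ i, c i • t i + ∑ i, d i • s i)) =
        x - ∑ i, c i • t i - ∑ i, d i • s i + (∑ i, c i • t i + ∑ i, d i • s i) by abel]

end normalForm

/-! ### Direct sums of members of the family -/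

section labelSum

namespace Label

/-- The highest weight of the module with a given label. -/
def hw : Label → ℤ
  | V r => r
  | M s => s
  | Mσ r => r
  | T r => r

/-- A singular vector of the highest weight. -/
def top : ∀ l : Label, l.Mod
  | V r => simpleGen (r : ℤ)
  | M s => vermaGen s
  | Mσ r => coBasis (r : ℤ) 0
  | T r => tiltTop r

/-- A generator. -/
def gen : ∀ l : Label, l.Mod
  | V r => simpleGen (r : ℤ)
  | M s => vermaGen s
  | Mσ r => coGen r
  | T r => tiltGen r

/-- The labels of the modules with a nonzero singular vector of weight `r`. -/
def singSupp (r : ℤ) : Label → Prop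
  | V s => r = s
  | M s => r = s ∨ (0 ≤ s ∧ r = -s - 2)
  | Mσ s => r = s
  | T s => r = s ∨ r = -s - 2

/-- The singular vector of weight `r`, if there is one. -/
def singGen (r : ℤ) (l : Label) : l.Mod :=
  if r = l.hw then l.top else Uq.f ^ (l.hw + 1).toNat • l.top

/-- A nonzero singular vector of a member of the family is a multiple of `singGen`. -/
theorem sing (l : Label) {r : ℤ} {x : l.Mod} (hx : IsSing r x) :
    x = 0 ∨ (l.singSupp r ∧ ∃ c : Kq, x = c • l.singGen r) := by
  by_cases h0 : x = 0
  · exact Or.inl h0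
  right
  cases l with
  | V s =>
    obtain ⟨h, c, hc⟩ := simple_sing hx h0
    exact ⟨h, c, by rw [singGen, if_pos (show r = (V s).hw from h)]; exact hc⟩
  | M s =>
    rcases verma_sing hx h0 with ⟨h, c, hc⟩ | ⟨h1, h2, c, hc⟩
    · exact ⟨Or.inl h, c, by rw [singGen, if_pos (show r = (M s).hw from h)]; exact hc⟩
    · refine ⟨Or.inr ⟨h1, h2⟩, c, ?_⟩
      rw [singGen, if_neg (by change ¬ r = s; omega)]
      exact hc
  | Mσ s =>
    obtain ⟨h, c, hc⟩ := coVerma_sing hx h0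
    exact ⟨h, c, by rw [singGen, if_pos (show r = (Mσ s).hw from h)]; exact hc⟩
  | T s =>
    rcases tilt_sing hx h0 with ⟨h, c, hc⟩ | ⟨h2, c, hc⟩
    · exact ⟨Or.inl h, c, by rw [singGen, if_pos (show r = (T s).hw from h)]; exact hc⟩
    · refine ⟨Or.inr h2, c, ?_⟩
      rw [singGen, if_neg (by change ¬ r = s; omega)]
      exact hc

theorem inCatO : ∀ l : Label, InCatO l.Mod
  | V r => (simple_hasWeights r).inCatO
  | M s => (verma_hasWeights s).inCatO
  | Mσ r => (verma_dual_hasWeights r).inCatO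
  | T r => (tilt_hasWeights r).inCatO

end Label

variable {n : Label → ℕ}

instance : IsScalarTower Kq Uq (LabelSum n) where
  smul_assoc c u x := by
    ext1 i
    change (c • u) • x i = c • u • x i
    exact smul_assoc _ _ _

theorem labelSum_smul_apply (u : Uq) (x : LabelSum n) (i : Σ l : Label, Fin (n l)) :
    (u • x) i = u • x i := rfl

theorem labelSum_kq_smul_apply (c : Kq) (x : LabelSum n) (i : Σ l : Label, Fin (n l)) :
    (c • x) i = c • x i := rfl

open Classical in
/-- The inclusion of a summand. -/
def incl (i : Σ l : Label, Fin (n l)) : i.1.Mod →ₗ[Uq] LabelSum n :=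
  DirectSum.lof Uq (Σ l : Label, Fin (n l)) (fun i => i.1.Mod) i

theorem incl_same (i : Σ l : Label, Fin (n l)) (x : i.1.Mod) : incl i x i = x := by
  classical
  exact DirectSum.lof_apply (M := fun i : (Σ l : Label, Fin (n l)) => i.1.Mod) Uq i x

theorem incl_ne {i j : Σ l : Label, Fin (n l)} (h : j ≠ i) (x : i.1.Mod) : incl i x j = 0 := by
  classical
  exact DirectSum.of_eq_of_ne (β := fun i : (Σ l : Label, Fin (n l)) => i.1.Mod) i j x h

theorem incl_kq_smul (i : Σ l : Label, Fin (n l)) (c : Kq) (x : i.1.Mod) :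
    incl i (c • x) = c • incl i x := ((incl i).restrictScalars Kq).map_smul c x

theorem labelSum_induction {P : LabelSum n → Prop} (h0 : P 0) (hi : ∀ i x, P (incl i x))
    (hadd : ∀ x y, P x → P y → P (x + y)) (x : LabelSum n) : P x := by
  classical
  induction x using DirectSum.induction_on with
  | zero => exact h0
  | of i x => exact hi i x
  | add x y hx hy => exact hadd x y hx hy

theorem labelSum_spanned : WeightSpanned (LabelSum n) := by
  rw [WeightSpanned, eq_top_iff]
  intro x _
  induction x using labelSum_induction with
  | h0 => exact Submodule.zero_mem _
  | hadd x y hx hy => exact Submodule.add_mem _ (hx trivial) (hy trivial)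
  | hi i x =>
    obtain ⟨s, y, hy, rfl⟩ := i.1.inCatO.spanned.exists_sum x
    rw [map_sum]
    exact Submodule.sum_mem _ fun r _ => Submodule.mem_iSup_of_mem r (map_mem _ (hy r))

theorem labelSum_eNilpotent : ENilpotent (LabelSum n) := by
  intro x
  induction x using labelSum_induction with
  | h0 => exact ⟨0, smul_zero _⟩
  | hadd x y hx hy =>
    obtain ⟨a, ha⟩ := hx
    obtain ⟨b, hb⟩ := hy
    refine ⟨a + b, ?_⟩
    rw [smul_add, pow_add, mul_smul _ _ y, hb, smul_zero, add_zero, ← pow_add, add_comm, pow_add,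
      mul_smul, ha, smul_zero]
  | hi i x =>
    obtain ⟨a, ha⟩ := i.1.inCatO.eNilpotent x
    exact ⟨a, by rw [← map_smul, ha, map_zero]⟩

/-- If all components of `x` are multiples of given vectors `g`, then `x` is in the span of
these. -/
theorem mem_span_incl {S : Label → Prop} {g : ∀ l : Label, l.Mod} {x : LabelSum n}
    (h : ∀ i, x i = 0 ∨ (S i.1 ∧ ∃ c : Kq, x i = c • g i.1)) :
    x ∈ Submodule.span Kq
      (Set.range fun i : {i : Σ l : Label, Fin (n l) // S i.1} => incl i.1 (g i.1.1)) := by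
  classical
  rw [← DirectSum.sum_support_of x]
  refine Submodule.sum_mem _ fun i _ => ?_
  change incl i (x i) ∈ _
  rcases h i with h0 | ⟨hS, c, hc⟩
  · rw [h0, map_zero]; exact Submodule.zero_mem _
  · rw [hc, incl_kq_smul]
    exact Submodule.smul_mem _ _ (Submodule.subset_span ⟨⟨i, hS⟩, rfl⟩)

theorem incl_independent {S : Label → Prop} {g : ∀ l : Label, l.Mod} (h : ∀ l, S l → g l ≠ 0) :
    LinearIndependent Kq
      (fun i : {i : Σ l : Label, Fin (n l) // S i.1} => incl i.1 (g i.1.1)) := by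
  rw [linearIndependent_iff']
  intro s c hc i hi
  have h1 : (∑ j ∈ s, c j • incl j.1 (g j.1.1)) i.1 = c i • g i.1.1 := by
    have : ∀ j ∈ s, j ≠ i → (c j • incl j.1 (g j.1.1)) i.1 = 0 := fun j _ hj => by
      rw [labelSum_kq_smul_apply, incl_ne (fun h => hj (Subtype.ext h.symm)), smul_zero]
    rw [DFinsupp.finsetSum_apply, Finset.sum_eq_single i this (fun h => absurd hi h),
      labelSum_kq_smul_apply, incl_same]
  rw [hc] at h1
  exact (smul_eq_zero.mp h1.symm).resolve_right (h _ i.2)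

theorem eq_zero_of_independent {ι V W : Type} [AddCommGroup V] [Module Kq V] [AddCommGroup W]
    [Module Kq W] {v : ι → V} {φ : V →ₗ[Kq] W} (h : LinearIndependent Kq (φ ∘ v)) {x : V}
    (hx : x ∈ Submodule.span Kq (Set.range v)) (h0 : φ x = 0) : x = 0 := by
  obtain ⟨c, rfl⟩ := Finsupp.mem_span_range_iff_exists_finsupp.mp hx
  have : Finsupp.linearCombination Kq (φ ∘ v) c = 0 := by
    rw [← h0, map_finsuppSum, Finsupp.linearCombination_apply]
    simp
  rw [linearIndependent_iff.mp h c this]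
  simp

end labelSum

/-! ### Decomposition of the modules of the category -/

section decomposition

variable {V : Type} [AddCommGroup V] [Module Kq V] [Module Uq V] [IsScalarTower Kq Uq V]

/-- The singular vectors of weight `r`. -/
def singSpace (V : Type) [AddCommGroup V] [Module Kq V] [Module Uq V] [IsScalarTower Kq Uq V]
    (r : ℤ) : Submodule Kq V :=
  weightSpace V r ⊓ LinearMap.ker (Algebra.lsmul Kq Kq V Uq.e)

/-- The vectors of weight `r` in the generalized Casimir eigenspace of the Verma module `M(r)`. -/
def genSpace (V : Type) [AddCommGroup V] [Module Kq V] [Module Uq V] [IsScalarTower Kq Uq V]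
    (r : ℤ) : Submodule Kq V :=
  weightSpace V r ⊓
    LinearMap.ker (Algebra.lsmul Kq Kq V (aeval Uq.casimir ((X - C (casimirValue r)) ^ 2)))

/-- Multiplication by `f ^ (t + 1)`, from the singular vectors of weight `t`. -/
def fTop (V : Type) [AddCommGroup V] [Module Kq V] [Module Uq V] [IsScalarTower Kq Uq V]
    (t : ℕ) : singSpace V (t : ℤ) →ₗ[Kq] genSpace V (-(t : ℤ) - 2) :=
  ((Algebra.lsmul Kq Kq V (Uq.f ^ (t + 1))).comp (singSpace V (t : ℤ)).subtype).codRestrict _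
    fun x => (IsSing.f_pow x.2).isGen

/-- Multiplication by `e ^ (t + 1)`, onto the singular vectors of weight `t`. -/
def eTop (he : ENilpotent V) (t : ℕ) :
    genSpace V (-(t : ℤ) - 2) →ₗ[Kq] singSpace V (t : ℤ) :=
  ((Algebra.lsmul Kq Kq V (Uq.e ^ (t + 1))).comp (genSpace V (-(t : ℤ) - 2)).subtype).codRestrict _
    fun x => by
      refine ⟨?_, ?_⟩
      · have := e_pow_mem x.2.1 (t + 1)
        rw [show -(t : ℤ) - 2 + 2 * (t + 1 : ℕ) = t by push_cast; ring] at this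
        exact this
      · change Uq.e • Uq.e ^ (t + 1) • (x : V) = 0
        rw [← mul_smul, ← pow_succ']
        exact IsGen.e_pow he x.2

theorem fTop_apply (t : ℕ) (x : singSpace V (t : ℤ)) :
    (fTop V t x : V) = Uq.f ^ (t + 1) • (x : V) := rfl

theorem eTop_apply (he : ENilpotent V) (t : ℕ) (x : genSpace V (-(t : ℤ) - 2)) :
    (eTop he t x : V) = Uq.e ^ (t + 1) • (x : V) := rfl

theorem linearIndependent_of_surjective {ι κ : Type} {ψ : ι → κ} (hψ : Function.Surjective ψ)
    {g : ι → V} (hg : LinearIndependent Kq g) {y : κ → V} (h : ∀ i, y (ψ i) = g i) :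
    LinearIndependent Kq y := by
  have : y = g ∘ Function.surjInv hψ := funext fun k => by
    rw [Function.comp_apply, ← h, Function.surjInv_eq hψ]
  rw [this]
  exact hg.comp _ (Function.injective_surjInv hψ)

/-- Multiplicities assembled from those of `V(t)`, `M(t)`, `M(t)^σ`, `T(t)`, `M(-t-2)` for `t ≥ 0`
and of `M(-1)`. -/
def labelCount (nv nm ns nt nz : ℕ → ℕ) (d : ℕ) : Label → ℕ
  | .V t => nv t
  | .M (.ofNat t) => nm t
  | .M (.negSucc 0) => d
  | .M (.negSucc (t + 1)) => nz t
  | .Mσ t => ns t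
  | .T t => nt t

/-- The images of the generators of the summands, assembled as in `labelCount`. -/
def labelVec {nv nm ns nt nz : ℕ → ℕ} {d : ℕ} (v : ∀ t, Fin (nv t) → V) (m : ∀ t, Fin (nm t) → V)
    (s : ∀ t, Fin (ns t) → V) (t : ∀ t, Fin (nt t) → V) (z : ∀ t, Fin (nz t) → V)
    (y : Fin d → V) : ∀ l : Label, Fin (labelCount nv nm ns nt nz d l) → V
  | .V j => v j
  | .M (.ofNat j) => m j
  | .M (.negSucc 0) => y
  | .M (.negSucc (j + 1)) => z j
  | .Mσ j => s j
  | .T j => t j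

/-- A family of homomorphisms from the summands defines one from the direct sum. -/
theorem exists_labelSum_hom {n : Label → ℕ} {x : ∀ l : Label, Fin (n l) → V}
    (h : ∀ (l : Label) (j : Fin (n l)), ∃ φ : l.Mod →ₗ[Uq] V, φ l.gen = x l j) :
    ∃ Φ : LabelSum n →ₗ[Uq] V, ∀ l j, Φ (incl ⟨l, j⟩ l.gen) = x l j := by
  classical
  choose φ hφ using h
  refine ⟨DirectSum.toModule Uq _ V fun i => φ i.1 i.2, fun l j => ?_⟩
  rw [← hφ l j]
  exact DirectSum.toModule_lof (M := fun i : (Σ l : Label, Fin (n l)) => i.1.Mod) Uq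
    (φ := fun i => φ i.1 i.2) ⟨l, j⟩ l.gen

theorem Label.e_pow_gen_Mσ (t : ℕ) :
    Uq.e ^ (t + 1) • (Label.Mσ t).gen = (Label.Mσ t).top := e_pow_coGen t

theorem Label.e_pow_gen_T (t : ℕ) :
    Uq.e ^ (t + 1) • (Label.T t).gen = (Label.T t).top := rfl

theorem Label.singGen_hw (l : Label) {r : ℤ} (h : r = l.hw) : l.singGen r = l.top := if_pos h

theorem Label.singGen_ne (l : Label) {r : ℤ} {m : ℕ} (h : r ≠ l.hw) (hm : l.hw = m) :
    l.singGen r = Uq.f ^ (m + 1) • l.top := by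
  rw [Label.singGen, if_neg h, hm]
  rfl

open Label in
/-- Every module of the category is a direct sum of members of the family. For each `j ≥ 0` the maps
`F = f ^ (j + 1)` and `E = e ^ (j + 1)` between the singular vectors of weight `j` and the
generators of weight `-j-2` are brought to normal form; the five kinds of basis vectors generate the
summands `V(j)`, `M(j)`, `M(j)^σ`, `T(j)` and `M(-j-2)`, and the singular vectors of weight `-1` the
summands `M(-1)`. The resulting homomorphism from the direct sum is injective since it is so on
singular vectors, and surjective since its image contains all generators. -/
theorem exists_decomposition (hV : InCatO V) : ∃ n : Label → ℕ, Nonempty (V ≃ₗ[Uq] LabelSum n) := by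
  have he := hV.eNilpotent
  have := hV.finite
  have hA : ∀ r, FiniteDimensional Kq (singSpace V r) := fun r =>
    Submodule.finiteDimensional_of_le (inf_le_left : singSpace V r ≤ weightSpace V r)
  have hB : ∀ r, FiniteDimensional Kq (genSpace V r) := fun r =>
    Submodule.finiteDimensional_of_le (inf_le_left : genSpace V r ≤ weightSpace V r)
  choose nv nm ns nt nz v m s t z hv hs hz hindA hindB htopA htopB using
    fun j : ℕ => exists_normalForm (fTop V j) (eTop he j)
  set y := Module.finBasis Kq (singSpace V (-1))
  set n := labelCount nv nm ns nt nz (Module.finrank Kq (singSpace V (-1)))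
  -- the universal properties of the summands give the homomorphism
  obtain ⟨Φ, hΦ⟩ := exists_labelSum_hom (V := V) (n := n)
    (x := labelVec (fun j i => v j i) (fun j i => m j i) (fun j i => s j i) (fun j i => t j i)
      (fun j i => z j i) fun i => y i) (by
    rintro (j | (j | (_ | j)) | j | j) i
    · exact ⟨simpleLift (v j i).2 (congrArg Subtype.val (hv j i)), simpleLift_gen _ _⟩
    · exact ⟨vermaLift (m j i).2, vermaLift_gen _⟩
    · exact ⟨vermaLift (y i).2, vermaLift_gen _⟩
    · have h : IsSing (Int.negSucc (j + 1)) (z j i : V) := by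
        have h := IsGen.isSing_of_e_pow (z j i).2 (congrArg Subtype.val (hz j i))
        have hj : -(j : ℤ) - 2 = Int.negSucc (j + 1) := by omega
        exact Eq.subst (motive := fun r => IsSing r (z j i : V)) hj h
      exact ⟨vermaLift h, vermaLift_gen _⟩
    · exact exists_coLift he (s j i).2 (congrArg Subtype.val (hs j i))
    · exact ⟨tiltLift (t j i).2 (IsGen.e_pow he (t j i).2), tiltLift_gen _ _⟩)
  have hv' : ∀ j i, Φ (incl ⟨.V j, i⟩ (Label.V j).top) = v j i := fun j i => hΦ (.V j) i
  have hm' : ∀ (j : ℕ) i, Φ (incl ⟨.M (.ofNat j), i⟩ (Label.M (.ofNat j)).top) = m j i :=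
    fun j i => hΦ (.M (.ofNat j)) i
  have hy' : ∀ i, Φ (incl ⟨.M (.negSucc 0), i⟩ (Label.M (.negSucc 0)).top) = y i :=
    fun i => hΦ (.M (.negSucc 0)) i
  have hz' : ∀ (j : ℕ) i, Φ (incl ⟨.M (.negSucc (j + 1)), i⟩ (Label.M (.negSucc (j + 1))).top) =
    z j i := fun j i => hΦ (.M (.negSucc (j + 1))) i
  have hs' : ∀ j i, Φ (incl ⟨.Mσ j, i⟩ (Label.Mσ j).gen) = s j i := fun j i => hΦ (.Mσ j) i
  have ht' : ∀ j i, Φ (incl ⟨.T j, i⟩ (Label.T j).gen) = t j i := fun j i => hΦ (.T j) i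
  have hEs : ∀ j i, Φ (incl ⟨.Mσ j, i⟩ (Label.Mσ j).top) = eTop he j (s j i) := fun j i => by
    rw [← e_pow_gen_Mσ, map_smul, map_smul, hs', eTop_apply]
  have hEt : ∀ j i, Φ (incl ⟨.T j, i⟩ (Label.T j).top) = eTop he j (t j i) := fun j i => by
    rw [← e_pow_gen_T, map_smul, map_smul, ht', eTop_apply]
  have hFm : ∀ j i, Φ (incl ⟨.M (.ofNat j), i⟩ (Uq.f ^ (j + 1) • (Label.M (.ofNat j)).top)) =
    fTop V j (m j i) := fun j i => by rw [map_smul, map_smul, hm', fTop_apply]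
  have hFEt : ∀ j i, Φ (incl ⟨.T j, i⟩ (Uq.f ^ (j + 1) • (Label.T j).top)) =
    fTop V j (eTop he j (t j i)) := fun j i => by rw [map_smul, map_smul, hEt, fTop_apply]
  -- the images of the singular vectors of weight `r` of the summands are independent
  have hindep : ∀ r : ℤ, LinearIndependent Kq
      fun i : {i : Σ l : Label, Fin (n l) // singSupp r i.1} =>
        Φ (incl i.1 (i.1.1.singGen r)) := by
    intro r
    obtain ⟨j, rfl⟩ | rfl | ⟨j, rfl⟩ :
        (∃ j : ℕ, r = j) ∨ r = -1 ∨ ∃ j : ℕ, r = -(j : ℤ) - 2 := by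
      rcases le_or_gt 0 r with h | h
      · exact Or.inl ⟨r.toNat, by omega⟩
      · rcases eq_or_ne r (-1) with h' | h'
        · exact Or.inr (Or.inl h')
        · exact Or.inr (Or.inr ⟨(-r - 2).toNat, by omega⟩)
    · refine linearIndependent_of_surjective
        (ψ := Sum.elim (fun i => ⟨⟨.V j, i⟩, rfl⟩) (Sum.elim
          (fun i => ⟨⟨.M (.ofNat j), i⟩, Or.inl rfl⟩)
          (Sum.elim (fun i => ⟨⟨.Mσ j, i⟩, rfl⟩) (fun i => ⟨⟨.T j, i⟩, Or.inl rfl⟩)))) ?_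
        ((hindA j).map' (singSpace V j).subtype (Submodule.ker_subtype _)) ?_
      · rintro ⟨⟨j' | (j' | j') | j' | j', i⟩, hi⟩
        · obtain rfl : j = j' := Int.ofNat.inj hi
          exact ⟨Sum.inl i, rfl⟩
        · obtain rfl : j = j' := by
            rcases hi with h | ⟨h, h'⟩
            · exact Int.ofNat.inj h
            · simp only [Int.ofNat_eq_natCast] at h'; omega
          exact ⟨Sum.inr (Sum.inl i), rfl⟩
        · exact absurd hi (by simp only [singSupp]; omega)
        · obtain rfl : j = j' := Int.ofNat.inj hi
          exact ⟨Sum.inr (Sum.inr (Sum.inl i)), rfl⟩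
        · obtain rfl : j = j' := by
            rcases hi with h | h <;> omega
          exact ⟨Sum.inr (Sum.inr (Sum.inr i)), rfl⟩
      · rintro (i | i | i | i)
        · exact (congrArg _ (congrArg _ (singGen_hw (.V j) rfl))).trans (hv' j i)
        · exact (congrArg _ (congrArg _ (singGen_hw (.M (.ofNat j)) rfl))).trans (hm' j i)
        · exact (congrArg _ (congrArg _ (singGen_hw (.Mσ j) rfl))).trans (hEs j i)
        · exact (congrArg _ (congrArg _ (singGen_hw (.T j) rfl))).trans (hEt j i)
    · refine linearIndependent_of_surjective
        (ψ := fun i => ⟨⟨.M (.negSucc 0), i⟩, Or.inl rfl⟩) ?_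
        (y.linearIndependent.map' (singSpace V (-1)).subtype (Submodule.ker_subtype _)) ?_
      · rintro ⟨⟨j' | (j' | (_ | j')) | j' | j', i⟩, hi⟩
        · exact absurd hi (by simp only [singSupp]; omega)
        · exact absurd hi (by simp only [singSupp, Int.ofNat_eq_natCast]; omega)
        · exact ⟨i, rfl⟩
        · exact absurd hi (by simp only [singSupp]; omega)
        · exact absurd hi (by simp only [singSupp]; omega)
        · exact absurd hi (by simp only [singSupp]; omega)
      · intro i
        exact (congrArg _ (congrArg _ (singGen_hw (.M (.negSucc 0)) rfl))).trans (hy' i)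
    · have hj : -(j : ℤ) - 2 = Int.negSucc (j + 1) := by omega
      refine linearIndependent_of_surjective
        (ψ := Sum.elim (fun i => ⟨⟨.M (.ofNat j), i⟩, Or.inr ⟨Int.natCast_nonneg j, rfl⟩⟩)
          (Sum.elim (fun i => ⟨⟨.T j, i⟩, Or.inr rfl⟩)
            (fun i => ⟨⟨.M (.negSucc (j + 1)), i⟩, Or.inl hj⟩))) ?_
        ((hindB j).map' (genSpace V (-(j : ℤ) - 2)).subtype (Submodule.ker_subtype _)) ?_
      · rintro ⟨⟨j' | (j' | (_ | j')) | j' | j', i⟩, hi⟩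
        · exact absurd hi (by simp only [singSupp]; omega)
        · obtain rfl : j = j' := by
            rcases hi with h | ⟨h, h'⟩ <;> simp only [Int.ofNat_eq_natCast] at * <;> omega
          exact ⟨Sum.inl i, rfl⟩
        · exact absurd hi (by simp only [singSupp]; omega)
        · obtain rfl : j = j' := by
            rcases hi with h | ⟨h, h'⟩ <;> omega
          exact ⟨Sum.inr (Sum.inr i), rfl⟩
        · exact absurd hi (by simp only [singSupp]; omega)
        · obtain rfl : j = j' := by
            rcases hi with h | h <;> omega
          exact ⟨Sum.inr (Sum.inl i), rfl⟩
      · rintro (i | i | i)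
        · exact (congrArg _ (congrArg _ (singGen_ne (.M (.ofNat j))
            (by simp only [hw, Int.ofNat_eq_natCast]; omega) rfl))).trans (hFm j i)
        · exact (congrArg _ (congrArg _ (singGen_ne (.T j)
            (by simp only [hw]; omega) rfl))).trans (hFEt j i)
        · exact (congrArg _ (congrArg _ (singGen_hw (.M (.negSucc (j + 1))) hj))).trans (hz' j i)
  have hinj : Function.Injective Φ := by
    refine injective_of_sing labelSum_spanned labelSum_eNilpotent Φ fun r x hx h0 => ?_
    have hmem : x ∈ Submodule.span Kq (Set.range
        fun i : {i : Σ l : Label, Fin (n l) // singSupp r i.1} => incl i.1 (i.1.1.singGen r)) := by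
      refine mem_span_incl fun i => Label.sing i.1 ⟨?_, ?_⟩
      · have := congrArg (fun y : LabelSum n => y i) hx.1
        exact this
      · exact congrArg (fun y : LabelSum n => y i) hx.2
    exact eq_zero_of_independent (φ := Φ.restrictScalars Kq) (hindep r) hmem h0
  have hsurj : LinearMap.range Φ = ⊤ := by
    have hrA : ∀ (j : ℕ) (x : V), IsSing (j : ℤ) x → x ∈ LinearMap.range Φ := by
      intro j x hx
      have := htopA j (((LinearMap.range Φ).restrictScalars Kq).comap (singSpace V j).subtype)
        (fun i => ⟨_, hv' j i⟩) (fun i => ⟨_, hm' j i⟩) (fun i => ⟨_, hEs j i⟩)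
        (fun i => ⟨_, hEt j i⟩)
      have h : (⟨x, hx⟩ : singSpace V j) ∈ (⊤ : Submodule Kq (singSpace V j)) := trivial
      rw [← this] at h
      exact h
    refine submodule_eq_top hV.spanned he _ fun r x hx => ?_
    obtain ⟨j, rfl⟩ | rfl | ⟨j, rfl⟩ :
        (∃ j : ℕ, r = j) ∨ r = -1 ∨ ∃ j : ℕ, r = -(j : ℤ) - 2 := by
      rcases le_or_gt 0 r with h | h
      · exact Or.inl ⟨r.toNat, by omega⟩
      · rcases eq_or_ne r (-1) with h' | h'
        · exact Or.inr (Or.inl h')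
        · exact Or.inr (Or.inr ⟨(-r - 2).toNat, by omega⟩)
    · exact hrA j x (hx.isSing he (by omega))
    · have h := hx.isSing he le_rfl
      rw [show x = ((⟨x, h⟩ : singSpace V (-1)) : V) from rfl, ← y.sum_repr ⟨x, h⟩]
      rw [Submodule.coe_sum]
      refine Submodule.sum_mem _ fun i _ => ?_
      exact ((LinearMap.range Φ).restrictScalars Kq).smul_mem _ ⟨_, hy' i⟩
    · have := htopB j (((LinearMap.range Φ).restrictScalars Kq).comap
        (genSpace V (-(j : ℤ) - 2)).subtype)
        (fun a => (LinearMap.range Φ).smul_mem _ (hrA j a a.2)) (fun i => ⟨_, hs' j i⟩)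
        (fun i => ⟨_, ht' j i⟩) (fun i => ⟨_, hz' j i⟩)
      have h : (⟨x, hx⟩ : genSpace V (-(j : ℤ) - 2)) ∈
        (⊤ : Submodule Kq (genSpace V (-(j : ℤ) - 2))) := trivial
      rw [← this] at h
      exact h
  exact ⟨n, ⟨(LinearEquiv.ofBijective Φ ⟨hinj, LinearMap.range_eq_top.mp hsurj⟩).symm⟩⟩

end decomposition

/-! ### Numerical invariants and uniqueness of the decomposition -/

section invariants

variable {V W : Type} [AddCommGroup V] [Module Kq V] [Module Uq V] [IsScalarTower Kq Uq V]
  [AddCommGroup W] [Module Kq W] [Module Uq W] [IsScalarTower Kq Uq W]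

/-- The vectors of weight `r` that are killed by `f`. -/
def lowSpace (V : Type) [AddCommGroup V] [Module Kq V] [Module Uq V] [IsScalarTower Kq Uq V]
    (r : ℤ) : Submodule Kq V :=
  weightSpace V r ⊓ LinearMap.ker (Algebra.lsmul Kq Kq V Uq.f)

/-- The number of linearly independent singular vectors of weight `r`. -/
def singDim (V : Type) [AddCommGroup V] [Module Kq V] [Module Uq V] [IsScalarTower Kq Uq V]
    (r : ℤ) : ℕ := Module.finrank Kq (singSpace V r)

/-- The dimension of the kernel of `f` in weight `r`. -/
def lowDim (V : Type) [AddCommGroup V] [Module Kq V] [Module Uq V] [IsScalarTower Kq Uq V]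
    (r : ℤ) : ℕ := Module.finrank Kq (lowSpace V r)

/-- The dimension of `V_{r+2} / e V_r`. -/
def coDim (V : Type) [AddCommGroup V] [Module Kq V] [Module Uq V] [IsScalarTower Kq Uq V]
    (r : ℤ) : ℕ := Module.finrank Kq (weightSpace V (r + 2) ⧸ LinearMap.range (eMap V r))

theorem eMap_apply {r : ℤ} (x : weightSpace V r) : (eMap V r x : V) = Uq.e • (x : V) := rfl

/-- The rank formula for `e` on a weight space. -/
theorem singDim_add_wt (hV : InCatO V) (r : ℤ) :
    singDim V r + wt V (r + 2) = wt V r + coDim V r := by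
  have := hV.finite
  have h1 := (eMap V r).finrank_range_add_finrank_ker
  have h2 := (LinearMap.range (eMap V r)).finrank_quotient_add_finrank
  have h3 : Module.finrank Kq (LinearMap.ker (eMap V r)) = singDim V r := by
    refine LinearEquiv.finrank_eq (LinearEquiv.ofBijective
      (((weightSpace V r).subtype.comp (LinearMap.ker (eMap V r)).subtype).codRestrict
        (singSpace V r) fun x => ⟨x.1.2, congrArg Subtype.val x.2⟩) ⟨?_, ?_⟩)
    · intro x y h
      have h' : ((x : weightSpace V r) : V) = (y : weightSpace V r) :=
        congrArg (fun z : singSpace V r => (z : V)) h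
      exact Subtype.ext (Subtype.ext h')
    · rintro ⟨x, h1, h2⟩
      exact ⟨⟨⟨x, h1⟩, Subtype.ext h2⟩, rfl⟩
  unfold wt coDim
  omega

theorem finrank_congr (φ : V ≃ₗ[Uq] W) {P : Submodule Kq V} {Q : Submodule Kq W}
    (h : ∀ x, x ∈ P ↔ φ x ∈ Q) : Module.finrank Kq P = Module.finrank Kq Q := by
  refine LinearEquiv.finrank_eq (LinearEquiv.ofBijective
    ((((φ : V →ₗ[Uq] W).restrictScalars Kq).comp P.subtype).codRestrict Q
      fun x => (h x).mp x.2) ⟨?_, ?_⟩)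
  · intro x y hxy
    exact Subtype.ext (φ.injective (congrArg Subtype.val hxy))
  · rintro ⟨y, hy⟩
    refine ⟨⟨φ.symm y, (h _).mpr (by rwa [φ.apply_symm_apply])⟩, Subtype.ext ?_⟩
    exact φ.apply_symm_apply y

theorem mem_weightSpace_iff (φ : V ≃ₗ[Uq] W) {r : ℤ} {x : V} :
    x ∈ weightSpace V r ↔ φ x ∈ weightSpace W r := by
  refine ⟨fun h => map_mem (φ : V →ₗ[Uq] W) h, fun h => ?_⟩
  have := map_mem (φ.symm : W →ₗ[Uq] V) h
  exact φ.symm_apply_apply x ▸ this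

theorem smul_eq_zero_iff (φ : V ≃ₗ[Uq] W) (u : Uq) {x : V} : u • x = 0 ↔ u • φ x = 0 := by
  rw [← map_smul, LinearEquiv.map_eq_zero_iff]

theorem singDim_congr (φ : V ≃ₗ[Uq] W) : singDim V = singDim W := funext fun _ =>
  finrank_congr φ fun _ => and_congr (mem_weightSpace_iff φ) (smul_eq_zero_iff φ _)

theorem lowDim_congr (φ : V ≃ₗ[Uq] W) : lowDim V = lowDim W := funext fun _ =>
  finrank_congr φ fun _ => and_congr (mem_weightSpace_iff φ) (smul_eq_zero_iff φ _)

theorem IsWeightBasis.map {ι : Type} {b : Module.Basis ι Kq V} {w : ι → ℤ}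
    (hb : IsWeightBasis b w) (φ : V ≃ₗ[Uq] W) :
    IsWeightBasis (b.map (φ.restrictScalars Kq)) w := fun i =>
  map_mem (φ : V →ₗ[Uq] W) (hb i)

theorem HasWeights.congr {ι : Type} {w : ι → ℤ} (h : HasWeights V w) (φ : V ≃ₗ[Uq] W) :
    HasWeights W w := by
  obtain ⟨hw, b, hb⟩ := h
  exact ⟨hw, _, hb.map φ⟩

theorem InCatO.congr (hV : InCatO V) (φ : V ≃ₗ[Uq] W) : InCatO W := by
  obtain ⟨ι, w, h⟩ := hV
  exact ⟨ι, w, h.congr φ⟩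

theorem coDim_congr (hV : InCatO V) (φ : V ≃ₗ[Uq] W) : coDim V = coDim W := funext fun r => by
  have h1 := singDim_add_wt hV r
  have h2 := singDim_add_wt (hV.congr φ) r
  rw [singDim_congr φ, wt_congr φ] at h1
  omega

/-- A preimage of a weight vector under a graded map can be chosen to be a weight vector. -/
theorem exists_weight_preimage (hs : WeightSpanned V) {d : ℤ} (A : V →ₗ[Kq] W)
    (hA : ∀ r, ∀ x ∈ weightSpace V r, A x ∈ weightSpace W (r + d)) {r : ℤ} {x : W} {y : V}
    (hx : x ∈ weightSpace W (r + d)) (h : A y = x) : ∃ z ∈ weightSpace V r, A z = x := by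
  classical
  obtain ⟨s, v, hv, rfl⟩ := hs.exists_sum y
  have h0 := eq_zero_of_sum_weight (M := W) (s := (insert r s).image (· + d))
    (y := fun j => (if j - d ∈ s then A (v (j - d)) else 0) - if j - d = r then x else 0) ?_ ?_
    (r + d) (Finset.mem_image_of_mem _ (Finset.mem_insert_self r s))
  · simp only [add_sub_cancel_right, if_true] at h0
    refine ⟨if r ∈ s then v r else 0, by split_ifs; exacts [hv r, Submodule.zero_mem _], ?_⟩
    rw [apply_ite A, map_zero]
    exact sub_eq_zero.mp h0
  · intro j
    refine Submodule.sub_mem _ ?_ ?_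
    · split_ifs
      · have := hA _ _ (hv (j - d))
        rwa [sub_add_cancel] at this
      · exact Submodule.zero_mem _
    · split_ifs with hj
      · rw [← hj, sub_add_cancel] at hx
        exact hx
      · exact Submodule.zero_mem _
  · rw [Finset.sum_image fun _ _ _ _ h => add_right_cancel h]
    simp only [add_sub_cancel_right, Finset.sum_sub_distrib]
    rw [← Finset.sum_filter, Finset.sum_ite_eq', if_pos (Finset.mem_insert_self r s), sub_eq_zero,
      ← h, map_sum]
    refine Finset.sum_congr ?_ fun _ _ => rfl
    ext j
    simp only [Finset.mem_filter, Finset.mem_insert]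
    tauto

theorem exists_e_preimage (hs : WeightSpanned V) {r : ℤ} {x y : V}
    (hx : x ∈ weightSpace V (r + 2)) (h : Uq.e • y = x) :
    ∃ z ∈ weightSpace V r, Uq.e • z = x :=
  exists_weight_preimage hs (Algebra.lsmul Kq Kq V Uq.e) (fun _ _ => e_mem) hx h

theorem exists_weight_lift (hs : WeightSpanned V) (φ : V →ₗ[Uq] W) {r : ℤ} {x : W} {y : V}
    (hx : x ∈ weightSpace W r) (h : φ y = x) : ∃ z ∈ weightSpace V r, φ z = x :=
  exists_weight_preimage (d := 0) hs (φ.restrictScalars Kq)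
    (fun r x hx => by rw [add_zero]; exact map_mem φ hx) (by rwa [add_zero]) h

end invariants

section lowVectors

theorem f_simpleBasis_last (s : ℕ) : Uq.f • simpleBasis s (Fin.last s) = 0 := by
  rw [simpleBasis_apply, ← mul_smul, ← pow_succ', Fin.val_last]
  exact f_pow_simpleGen_eq_zero (Nat.lt_succ_self s)

theorem succ_lt_of_ne_last {s : ℕ} {i : Fin (s + 1)} (h : i ≠ Fin.last s) :
    (i : ℕ) + 1 < s + 1 := by
  have := Fin.val_lt_last h
  omega

theorem simple_low {s : ℕ} {r : ℤ} {x : SimpleMod (s : ℤ)} (hx : x ∈ weightSpace _ r)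
    (hf : Uq.f • x = 0) (h0 : x ≠ 0) :
    r = -s ∧ ∃ c : Kq, x = c • simpleBasis s (Fin.last s) := by
  obtain ⟨i, c, hc, hi, rfl⟩ := (simpleBasis_isWeightBasis s).eq_smul (vw_injective s) hx h0
  have hs : i = Fin.last s := by
    by_contra hne
    refine (simpleBasis s).ne_zero ⟨i + 1, succ_lt_of_ne_last hne⟩ ?_
    rw [e_smul_kq, smul_eq_zero_iff_right hc] at hf
    rw [simpleBasis_apply, ← hf, simpleBasis_apply, ← mul_smul, ← pow_succ']
  subst hs
  refine ⟨?_, c, rfl⟩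
  rw [← hi, vw, Fin.val_last]
  ring

theorem f_coBasis_self (s : ℕ) : Uq.f • coBasis (s : ℤ) s = 0 := by
  rw [f_coBasis, stringCoeff_eq_zero.mpr (Or.inr (by push_cast; rfl)), zero_smul]

theorem coVerma_low {s : ℕ} {r : ℤ} {x : RestrictedDual (Verma (s : ℤ))}
    (hx : x ∈ weightSpace _ r) (hf : Uq.f • x = 0) (h0 : x ≠ 0) :
    r = -s ∧ ∃ c : Kq, x = c • coBasis (s : ℤ) s := by
  obtain ⟨i, c, hc, hi, rfl⟩ := (coBasis_isWeightBasis s).eq_smul (mw_injective s) hx h0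
  have hs : i = s := by
    rw [e_smul_kq, smul_eq_zero_iff_right hc, f_coBasis] at hf
    have := (smul_eq_zero.mp hf).resolve_right ((coBasis (s : ℤ)).ne_zero _)
    rw [stringCoeff_eq_zero] at this
    omega
  subst hs
  refine ⟨?_, c, rfl⟩
  rw [← hi, mw]
  ring

theorem e_simpleBasis (s : ℕ) (n : Fin (s + 1)) : Uq.e • simpleBasis s n =
    stringCoeff s n • Uq.f ^ ((n : ℕ) - 1) • simpleGen (s : ℤ) := by
  rw [simpleBasis_apply, (simpleGen_sing _).e_f_pow']

/-- The lowest weight vector of `V(s)` is not in the image of `e`. -/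
theorem simple_coord_e (s : ℕ) (x : SimpleMod (s : ℤ)) :
    (simpleBasis s).coord (Fin.last s) (Uq.e • x) = 0 := by
  have : ((simpleBasis s).coord (Fin.last s)).comp
      (Algebra.lsmul Kq Kq (SimpleMod (s : ℤ)) Uq.e) = 0 := by
    refine (simpleBasis s).ext fun n => ?_
    change (simpleBasis s).coord (Fin.last s) (Uq.e • simpleBasis s n) = 0
    rw [e_simpleBasis, map_smul]
    by_cases h0 : (n : ℕ) = 0
    · rw [h0, stringCoeff_zero, zero_smul]
    · have hlt : (n : ℕ) - 1 < s + 1 := by omega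
      rw [← simpleBasis_apply s ⟨_, hlt⟩, Module.Basis.coord_apply, Module.Basis.repr_self,
        Finsupp.single_eq_of_ne, smul_zero]
      intro h
      have := congrArg Fin.val h
      simp only [Fin.val_last] at this
      omega
  exact LinearMap.congr_fun this x

theorem verma_coord_e {s : ℤ} (hs : 0 ≤ s) (x : Verma s) :
    (vermaBasis s).coord s.toNat (Uq.e • x) = 0 := by
  have : ((vermaBasis s).coord s.toNat).comp (Algebra.lsmul Kq Kq (Verma s) Uq.e) = 0 := by
    refine (vermaBasis s).ext fun n => ?_
    change (vermaBasis s).coord s.toNat (Uq.e • vermaBasis s n) = 0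
    rw [e_vermaBasis, map_smul, Module.Basis.coord_apply, Module.Basis.repr_self]
    by_cases h0 : n = 0 ∨ (n : ℤ) = s + 1
    · rw [stringCoeff_eq_zero.mpr h0, zero_smul]
    · rw [Finsupp.single_eq_of_ne, smul_zero]
      omega
  exact LinearMap.congr_fun this x

theorem simple_off {s : ℕ} {r : ℤ} {x : SimpleMod (s : ℤ)} (hx : x ∈ weightSpace _ (r + 2))
    (h0 : x ≠ 0) :
    (r = -s - 2 ∧ ∃ c : Kq, x = c • simpleBasis s (Fin.last s)) ∨ ∃ y, Uq.e • y = x := by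
  obtain ⟨i, c, hc, hi, rfl⟩ := (simpleBasis_isWeightBasis s).eq_smul (vw_injective s) hx h0
  by_cases his : i = Fin.last s
  · subst his
    refine Or.inl ⟨?_, c, rfl⟩
    rw [vw, Fin.val_last] at hi
    linarith
  · have hlt := succ_lt_of_ne_last his
    have hne : stringCoeff s (i + 1) ≠ 0 := by
      rw [Ne, stringCoeff_eq_zero]; omega
    refine Or.inr ⟨(c * (stringCoeff s (i + 1))⁻¹) • simpleBasis s ⟨i + 1, hlt⟩, ?_⟩
    rw [e_smul_kq, e_simpleBasis, smul_smul, inv_mul_cancel_right₀ hne, simpleBasis_apply]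
    rfl

theorem verma_off {s r : ℤ} (hs : 0 ≤ s) {x : Verma s} (hx : x ∈ weightSpace _ (r + 2))
    (h0 : x ≠ 0) :
    (r = -s - 2 ∧ ∃ c : Kq, x = c • vermaBasis s s.toNat) ∨ ∃ y, Uq.e • y = x := by
  obtain ⟨i, c, hc, hi, rfl⟩ := (vermaBasis_isWeightBasis s).eq_smul (mw_injective s) hx h0
  by_cases his : i = s.toNat
  · subst his
    refine Or.inl ⟨?_, c, rfl⟩
    rw [mw] at hi
    omega
  · have hne : stringCoeff s (i + 1) ≠ 0 := by
      rw [Ne, stringCoeff_eq_zero]; omega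
    refine Or.inr ⟨(c * (stringCoeff s (i + 1))⁻¹) • vermaBasis s (i + 1), ?_⟩
    rw [e_smul_kq, e_vermaBasis, smul_smul, inv_mul_cancel_right₀ hne, Nat.add_sub_cancel]

end lowVectors

namespace Label

theorem top_sing : ∀ l : Label, IsSing l.hw l.top
  | V r => simpleGen_sing r
  | M s => vermaGen_sing s
  | Mσ r => coBasis_sing r
  | T r => tiltTop_sing r

theorem top_ne_zero : ∀ l : Label, l.top ≠ 0
  | V r => by
    have := (simpleBasis r).ne_zero 0
    rwa [simpleBasis_apply, Fin.val_zero, pow_zero, one_smul] at this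
  | M s => by
    have := (vermaBasis s).ne_zero 0
    rwa [vermaBasis_apply, pow_zero, one_smul] at this
  | Mσ r => (coBasis (r : ℤ)).ne_zero 0
  | T r => by
    have := (tiltBasis r).ne_zero (Sum.inl 0)
    rw [tiltBasis_apply] at this
    exact fun h => this (by rw [tiltVec, show tiltTop r = 0 from h]; exact smul_zero _)

theorem singSupp_cases {l : Label} {r : ℤ} (h : l.singSupp r) :
    r = l.hw ∨ ∃ m : ℕ, l.hw = m ∧ r = -(m : ℤ) - 2 ∧ FInj l.Mod := by
  cases l with
  | V s => exact Or.inl h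
  | M s =>
    rcases h with h | ⟨h1, h2⟩
    · exact Or.inl h
    · exact Or.inr ⟨s.toNat, (Int.toNat_of_nonneg h1).symm, by omega, verma_fInj s⟩
  | Mσ s => exact Or.inl h
  | T s =>
    rcases h with h | h
    · exact Or.inl h
    · exact Or.inr ⟨s, rfl, h, tilt_fInj s⟩

theorem singGen_mem (l : Label) {r : ℤ} (h : l.singSupp r) : IsSing r (l.singGen r) := by
  rcases singSupp_cases h with rfl | ⟨m, hm, rfl, -⟩
  · rw [singGen_hw l rfl]
    exact l.top_sing
  · rw [singGen_ne l (by omega) hm]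
    exact IsSing.f_pow (hm ▸ l.top_sing)

theorem _root_.QuantumSl2.FInj.pow {M : Type} [AddCommGroup M] [Module Uq M] (h : FInj M) {x : M}
    (hx : x ≠ 0) : ∀ n : ℕ, Uq.f ^ n • x ≠ 0
  | 0 => by rwa [pow_zero, one_smul]
  | n + 1 => fun h0 => h.pow hx n (h _ (by rwa [pow_succ', mul_smul] at h0))

theorem singGen_ne_zero (l : Label) {r : ℤ} (h : l.singSupp r) : l.singGen r ≠ 0 := by
  rcases singSupp_cases h with rfl | ⟨m, hm, rfl, hf⟩
  · rw [singGen_hw l rfl]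
    exact l.top_ne_zero
  · rw [singGen_ne l (by omega) hm]
    exact hf.pow l.top_ne_zero _

/-- The labels of the modules with a nonzero vector of weight `r` killed by `f`. -/
def lowSupp (r : ℤ) : Label → Prop
  | V s => r = -s
  | Mσ s => r = -s
  | _ => False

/-- The vector killed by `f`, if there is one. -/
def lowGen : ∀ l : Label, l.Mod
  | V s => simpleBasis s (Fin.last s)
  | Mσ s => coBasis (s : ℤ) s
  | M _ => 0
  | T _ => 0

theorem low (l : Label) {r : ℤ} {x : l.Mod} (hx : x ∈ lowSpace l.Mod r) :
    x = 0 ∨ (l.lowSupp r ∧ ∃ c : Kq, x = c • l.lowGen) := by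
  by_cases h0 : x = 0
  · exact Or.inl h0
  right
  obtain ⟨hx, hf⟩ := hx
  cases l with
  | V s => exact simple_low hx hf h0
  | M s => exact absurd (verma_fInj s x hf) h0
  | Mσ s => exact coVerma_low hx hf h0
  | T s => exact absurd (tilt_fInj s x hf) h0

theorem lowGen_mem : ∀ (l : Label) {r : ℤ}, l.lowSupp r → l.lowGen ∈ lowSpace l.Mod r
  | V s, r, h => by
    refine ⟨(simpleBasis_isWeightBasis s).mem_of_eq (i := Fin.last s) ?_, f_simpleBasis_last s⟩
    rw [show r = -s from h, vw, Fin.val_last]; ring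
  | Mσ s, r, h => by
    refine ⟨(coBasis_isWeightBasis s).mem_of_eq (i := s) ?_, f_coBasis_self s⟩
    rw [show r = -s from h, mw]; ring

theorem lowGen_ne_zero : ∀ (l : Label) {r : ℤ}, l.lowSupp r → l.lowGen ≠ 0
  | V s, _, _ => (simpleBasis s).ne_zero _
  | Mσ s, _, _ => (coBasis (s : ℤ)).ne_zero _

/-- The labels of the modules `X` with `e X_r ≠ X_{r+2}`. -/
def coSupp (r : ℤ) : Label → Prop
  | V s => r = -s - 2
  | M s => 0 ≤ s ∧ r = -s - 2
  | _ => False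

/-- A vector that is not in the image of `e`, if there is one. -/
def offGen : ∀ l : Label, l.Mod
  | V s => simpleBasis s (Fin.last s)
  | M s => vermaBasis s s.toNat
  | Mσ _ => 0
  | T _ => 0

/-- A functional that vanishes on the image of `e`. -/
def offFun : ∀ l : Label, l.Mod →ₗ[Kq] Kq
  | V s => (simpleBasis s).coord (Fin.last s)
  | M s => (vermaBasis s).coord s.toNat
  | Mσ _ => 0
  | T _ => 0

theorem offGen_mem : ∀ (l : Label) {r : ℤ}, l.coSupp r → l.offGen ∈ weightSpace l.Mod (r + 2)
  | V s, r, h => (simpleBasis_isWeightBasis s).mem_of_eq (i := Fin.last s) (by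
      rw [show r = -s - 2 from h, vw, Fin.val_last]; ring)
  | M s, r, h => (vermaBasis_isWeightBasis s).mem_of_eq (i := s.toNat) (by
      rw [h.2, mw]; have := h.1; omega)

theorem offFun_offGen : ∀ (l : Label) {r : ℤ}, l.coSupp r → l.offFun l.offGen = 1
  | V s, _, _ => by
    change (simpleBasis s).coord (Fin.last s) (simpleBasis s (Fin.last s)) = 1
    simp
  | M s, _, _ => by
    change (vermaBasis s).coord s.toNat (vermaBasis s s.toNat) = 1
    simp

theorem offFun_e : ∀ (l : Label) {r : ℤ}, l.coSupp r → ∀ x : l.Mod, l.offFun (Uq.e • x) = 0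
  | V s, _, _ => simple_coord_e s
  | M _, _, h => verma_coord_e h.1

theorem eq_offGen_add (l : Label) {r : ℤ} {x : l.Mod} (hx : x ∈ weightSpace l.Mod (r + 2)) :
    (l.coSupp r ∧ ∃ c : Kq, x = c • l.offGen) ∨ ∃ y : l.Mod, Uq.e • y = x := by
  by_cases h0 : x = 0
  · exact Or.inr ⟨0, by rw [h0, smul_zero]⟩
  cases l with
  | V s => exact simple_off hx h0
  | M s =>
    by_cases hs : s < 0
    · exact Or.inr (verma_eSurj hs x)
    · rcases verma_off (not_lt.mp hs) hx h0 with ⟨h1, h2⟩ | h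
      · exact Or.inl ⟨⟨not_lt.mp hs, h1⟩, h2⟩
      · exact Or.inr h
  | Mσ s => exact Or.inr (verma_dual_eSurj s x)
  | T s => exact Or.inr (tilt_eSurj s x)

end Label

section labelSum

variable {n : Label → ℕ}

open Label

/-- If in every summand the vectors of a graded piece `P` are the multiples of `g l`, and only the
labels in `S` contribute, then the dimension of `P` counts the summands with label in `S`. -/
theorem finrank_labelSum {P : Submodule Kq (LabelSum n)} {S : Label → Prop}
    {g : ∀ l : Label, l.Mod} (h1 : ∀ x ∈ P, ∀ i, x i = 0 ∨ (S i.1 ∧ ∃ c : Kq, x i = c • g i.1))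
    (h2 : ∀ l, S l → g l ≠ 0)
    (h3 : ∀ i : (Σ l : Label, Fin (n l)), S i.1 → incl i (g i.1) ∈ P) :
    Module.finrank Kq P = Nat.card {i : Σ l : Label, Fin (n l) // S i.1} := by
  have hP : P = Submodule.span Kq
      (Set.range fun i : {i : Σ l : Label, Fin (n l) // S i.1} => incl i.1 (g i.1.1)) := by
    refine le_antisymm (fun x hx => mem_span_incl (h1 x hx)) (Submodule.span_le.mpr ?_)
    rintro _ ⟨i, rfl⟩
    exact h3 i.1 i.2
  rw [hP, Module.finrank_eq_nat_card_basis (Module.Basis.span (incl_independent h2))]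

theorem labelSum_singDim (r : ℤ) : singDim (LabelSum n) r =
    Nat.card {i : Σ l : Label, Fin (n l) // singSupp r i.1} :=
  finrank_labelSum (g := singGen r)
    (fun _ hx i => Label.sing i.1 ⟨congrArg (fun y : LabelSum n => y i) hx.1,
      congrArg (fun y : LabelSum n => y i) hx.2⟩)
    (fun l hl => l.singGen_ne_zero hl) fun i hi => (i.1.singGen_mem hi).map (incl i)

theorem labelSum_lowDim (r : ℤ) : lowDim (LabelSum n) r =
    Nat.card {i : Σ l : Label, Fin (n l) // lowSupp r i.1} :=
  finrank_labelSum (g := lowGen)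
    (fun _ hx i => Label.low i.1 ⟨congrArg (fun y : LabelSum n => y i) hx.1,
      congrArg (fun y : LabelSum n => y i) hx.2⟩)
    (fun l hl => l.lowGen_ne_zero hl) fun i hi => by
      obtain ⟨h1, h2⟩ := i.1.lowGen_mem hi
      refine ⟨map_mem _ h1, ?_⟩
      change Uq.f • incl i i.1.lowGen = 0
      rw [← map_smul, show Uq.f • i.1.lowGen = 0 from h2, map_zero]

theorem labelSum_coDim (r : ℤ) : coDim (LabelSum n) r =
    Nat.card {i : Σ l : Label, Fin (n l) // coSupp r i.1} := by
  classical
  set R := LinearMap.range (eMap (LabelSum n) r)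
  have hR : ∀ (x : weightSpace (LabelSum n) (r + 2)) (y : LabelSum n), Uq.e • y = x → x ∈ R := by
    intro x y hy
    obtain ⟨z, hz, hz'⟩ := exists_e_preimage labelSum_spanned x.2 hy
    exact ⟨⟨z, hz⟩, Subtype.ext hz'⟩
  set v : {i : Σ l : Label, Fin (n l) // coSupp r i.1} → weightSpace (LabelSum n) (r + 2) :=
    fun i => ⟨incl i.1 i.1.1.offGen, map_mem _ (i.1.1.offGen_mem i.2)⟩
  have hv : ∀ i, (v i : LabelSum n) = incl i.1 i.1.1.offGen := fun _ => rfl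
  have hli : LinearIndependent Kq fun i => R.mkQ (v i) := by
    rw [linearIndependent_iff']
    intro s c hc i hi
    simp only [← map_smul, ← map_sum] at hc
    obtain ⟨y, hy⟩ := (Submodule.Quotient.mk_eq_zero R).mp hc
    have h1 := congrArg (fun z : weightSpace (LabelSum n) (r + 2) =>
      i.1.1.offFun ((z : LabelSum n) i.1)) hy
    have h2 : (((∑ j ∈ s, c j • v j : weightSpace (LabelSum n) (r + 2)) : LabelSum n)) i.1 =
        c i • i.1.1.offGen := by
      rw [Submodule.coe_sum, DFinsupp.finsetSum_apply, Finset.sum_eq_single i]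
      · change (c i • incl i.1 i.1.1.offGen) i.1 = _
        rw [labelSum_kq_smul_apply, incl_same]
      · intro j _ hj
        change (c j • incl j.1 j.1.1.offGen) i.1 = _
        rw [labelSum_kq_smul_apply, incl_ne (fun h => hj (Subtype.ext h.symm)), smul_zero]
      · exact fun h => absurd hi h
    simp only [h2] at h1
    rw [map_smul, offFun_offGen _ i.2, smul_eq_mul, mul_one, eMap_apply, labelSum_smul_apply,
      offFun_e _ i.2] at h1
    exact h1.symm
  have hsp : ⊤ ≤ Submodule.span Kq (Set.range fun i => R.mkQ (v i)) := by
    intro x _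
    obtain ⟨x, rfl⟩ := R.mkQ_surjective x
    have hx : ∀ i, ∃ w y : LabelSum n, (∃ w' : weightSpace (LabelSum n) (r + 2), w' = w ∧
        R.mkQ w' ∈ Submodule.span Kq (Set.range fun i => R.mkQ (v i))) ∧
        incl i ((x : LabelSum n) i) = w + Uq.e • y := by
      intro i
      have hxi : (x : LabelSum n) i ∈ weightSpace i.1.Mod (r + 2) :=
        congrArg (fun y : LabelSum n => y i) x.2
      rcases i.1.eq_offGen_add hxi with ⟨hi, c, hc⟩ | ⟨y, hy⟩
      · refine ⟨incl i (c • i.1.offGen), 0, ⟨c • v ⟨i, hi⟩, ?_, ?_⟩, ?_⟩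
        · rw [Submodule.coe_smul, hv, incl_kq_smul]
        · rw [map_smul]
          exact Submodule.smul_mem _ _ (Submodule.subset_span ⟨_, rfl⟩)
        · rw [hc, smul_zero, add_zero]
      · refine ⟨0, incl i y, ⟨0, rfl, by rw [map_zero]; exact Submodule.zero_mem _⟩, ?_⟩
        rw [← map_smul, hy, zero_add]
    choose w y hw hxw using hx
    choose w' hw' hw'' using hw
    set s := DFinsupp.support (x : LabelSum n)
    have hsum : (x : LabelSum n) = ∑ i ∈ s, incl i ((x : LabelSum n) i) :=
      (DirectSum.sum_support_of (x : LabelSum n)).symm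
    have hdiff : x - ∑ i ∈ s, w' i ∈ R := by
      refine hR _ (∑ i ∈ s, y i) ?_
      rw [Submodule.coe_sub, hsum, Submodule.coe_sum, ← Finset.sum_sub_distrib, Finset.smul_sum]
      refine Finset.sum_congr rfl fun i _ => ?_
      rw [hw', hxw, add_sub_cancel_left]
    have : R.mkQ x = ∑ i ∈ s, R.mkQ (w' i) := by
      rw [← map_sum, ← sub_eq_zero, ← map_sub]
      exact (Submodule.Quotient.mk_eq_zero R).mpr hdiff
    rw [this]
    exact Submodule.sum_mem _ fun i _ => hw'' i
  exact Module.finrank_eq_nat_card_basis (Module.Basis.mk hli hsp)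

theorem card_labelSupp {S : Label → Prop} (L : Finset Label) (h : ∀ l, S l ↔ l ∈ L) :
    Nat.card {i : Σ l : Label, Fin (n l) // S i.1} = ∑ l ∈ L, n l := by
  rw [← Finset.sum_coe_sort]
  rw [Nat.card_congr (β := Σ l : L, Fin (n l))
    ⟨fun i => ⟨⟨i.1.1, (h _).mp i.2⟩, i.1.2⟩, fun i => ⟨⟨i.1.1, i.2⟩, (h _).mpr i.1.2⟩,
      fun _ => rfl, fun _ => rfl⟩]
  simp

end labelSum

section uniqueness

variable {V W : Type} [AddCommGroup V] [Module Kq V] [Module Uq V] [IsScalarTower Kq Uq V]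
  [AddCommGroup W] [Module Kq W] [Module Uq W] [IsScalarTower Kq Uq W]

section values

variable (n : Label → ℕ) (t : ℕ)

open Classical in
theorem labelSum_singDim_nat : singDim (LabelSum n) t =
    n (.V t) + n (.M t) + n (.Mσ t) + n (.T t) := by
  rw [labelSum_singDim, card_labelSupp {.V t, .M t, .Mσ t, .T t}]
  · simp [add_assoc]
  · rintro (s | s | s | s) <;> simp [Label.singSupp] <;> omega

open Classical in
theorem labelSum_singDim_neg_one : singDim (LabelSum n) (-1) = n (.M (-1)) := by
  rw [labelSum_singDim, card_labelSupp {.M (-1)}]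
  · simp
  · rintro (s | s | s | s) <;> simp [Label.singSupp] <;> omega

open Classical in
theorem labelSum_singDim_neg : singDim (LabelSum n) (-(t : ℤ) - 2) =
    n (.M t) + n (.T t) + n (.M (-(t : ℤ) - 2)) := by
  rw [labelSum_singDim, card_labelSupp {.M t, .T t, .M (-(t : ℤ) - 2)}]
  · rw [Finset.sum_insert, Finset.sum_insert, Finset.sum_singleton, add_assoc]
    · simp
    · simp; omega
  · rintro (s | s | s | s) <;> simp [Label.singSupp] <;> omega

open Classical in
theorem labelSum_lowDim_neg : lowDim (LabelSum n) (-(t : ℤ)) = n (.V t) + n (.Mσ t) := by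
  rw [labelSum_lowDim, card_labelSupp {.V t, .Mσ t}]
  · simp
  · rintro (s | s | s | s) <;> simp [Label.lowSupp] <;> omega

open Classical in
theorem labelSum_coDim_neg : coDim (LabelSum n) (-(t : ℤ) - 2) = n (.V t) + n (.M t) := by
  rw [labelSum_coDim, card_labelSupp {.V t, .M t}]
  · simp
  · rintro (s | s | s | s) <;> simp [Label.coSupp] <;> omega

open Classical in
theorem labelSum_coDim_nonneg {r : ℤ} (hr : -1 ≤ r) : coDim (LabelSum n) r = 0 := by
  rw [labelSum_coDim, card_labelSupp ∅]
  · simp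
  · rintro (s | s | s | s) <;> simp [Label.coSupp] <;> omega

end values

/-- The image of `e` contains all vectors of positive weight. -/
theorem coDim_nonneg (hV : InCatO V) {r : ℤ} (hr : -1 ≤ r) : coDim V r = 0 := by
  obtain ⟨n, ⟨φ⟩⟩ := exists_decomposition hV
  rw [coDim_congr hV φ, labelSum_coDim_nonneg n hr]

theorem Label.finiteDimensional : ∀ {l : Label}, FiniteDimensional Kq l.Mod → ∃ r, l = .V r
  | .V r, _ => ⟨r, rfl⟩
  | .M s, h => by
    have : FiniteDimensional Kq (Verma s) := h
    exact (not_finite_iff_infinite.mpr inferInstance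
      (Module.Finite.finite_basis (vermaBasis s))).elim
  | .Mσ s, h => by
    have : FiniteDimensional Kq (RestrictedDual (Verma (s : ℤ))) := h
    exact (not_finite_iff_infinite.mpr inferInstance
      (Module.Finite.finite_basis (coBasis (s : ℤ)))).elim
  | .T s, h => by
    have : FiniteDimensional Kq (TiltMod s) := h
    exact (not_finite_iff_infinite.mpr inferInstance
      (Module.Finite.finite_basis (tiltBasis s))).elim

theorem incl_injective {n : Label → ℕ} (i : Σ l : Label, Fin (n l)) :
    Function.Injective (incl i) := fun x y h => by
  have := congrArg (fun z : LabelSum n => z i) h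
  simpa only [incl_same] using this

theorem eq_zero_of_finiteDimensional {n : Label → ℕ} (h : FiniteDimensional Kq (LabelSum n))
    {l : Label} (hl : ∀ r, l ≠ .V r) : n l = 0 := by
  by_contra h0
  have := FiniteDimensional.of_injective
    ((incl (n := n) ⟨l, ⟨0, Nat.pos_of_ne_zero h0⟩⟩).restrictScalars Kq) (incl_injective _)
  obtain ⟨r, hr⟩ := Label.finiteDimensional this
  exact hl r hr

/-- Conditions under which the multiplicities are determined by dimensions alone. In general they
are not: `V(t) ⊕ T(t)` and `M(t) ⊕ M(t)^σ` have the same `wt`, `singDim`, `lowDim` and `coDim`. -/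
def Rigid (V : Type) [AddCommGroup V] [Module Kq V] [Module Uq V] [IsScalarTower Kq Uq V] : Prop :=
  (∀ t : ℕ, lowDim V (-(t : ℤ)) = 0) ∨ (∀ t : ℕ, coDim V (-(t : ℤ) - 2) = 0) ∨
    FiniteDimensional Kq V

theorem Rigid.labelSum {n : Label → ℕ} (hV : InCatO V) (h : Rigid V) (φ : V ≃ₗ[Uq] LabelSum n)
    (t : ℕ) : (n (.V t) = 0 ∧ n (.Mσ t) = 0) ∨ (n (.V t) = 0 ∧ n (.M t) = 0) ∨
      (n (.M t) = 0 ∧ n (.Mσ t) = 0) := by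
  rcases h with h | h | h
  · have := h t
    rw [lowDim_congr φ, labelSum_lowDim_neg] at this
    omega
  · have := h t
    rw [coDim_congr hV φ, labelSum_coDim_neg] at this
    omega
  · have := LinearEquiv.finiteDimensional (φ.restrictScalars Kq)
    exact Or.inr (Or.inr ⟨eq_zero_of_finiteDimensional this (by simp),
      eq_zero_of_finiteDimensional this (by simp)⟩)

/-- The multiplicities are determined by the dimensions as soon as, for every `t`, two of `V(t)`,
`M(t)`, `M(t)^σ` do not occur. -/
theorem multiplicities_eq {n n' : Label → ℕ}
    (hn : ∀ t, (n (.V t) = 0 ∧ n (.Mσ t) = 0) ∨ (n (.V t) = 0 ∧ n (.M t) = 0) ∨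
      (n (.M t) = 0 ∧ n (.Mσ t) = 0))
    (hn' : ∀ t, (n' (.V t) = 0 ∧ n' (.Mσ t) = 0) ∨ (n' (.V t) = 0 ∧ n' (.M t) = 0) ∨
      (n' (.M t) = 0 ∧ n' (.Mσ t) = 0))
    (h0 : n (.M (-1)) = n' (.M (-1)))
    (h1 : ∀ t : ℕ, n (.V t) + n (.M t) + n (.Mσ t) + n (.T t) =
      n' (.V t) + n' (.M t) + n' (.Mσ t) + n' (.T t))
    (h2 : ∀ t : ℕ, n (.M t) + n (.T t) + n (.M (-(t : ℤ) - 2)) =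
      n' (.M t) + n' (.T t) + n' (.M (-(t : ℤ) - 2)))
    (h3 : ∀ t : ℕ, n (.V t) + n (.Mσ t) = n' (.V t) + n' (.Mσ t))
    (h4 : ∀ t : ℕ, n (.V t) + n (.M t) = n' (.V t) + n' (.M t)) : n = n' := by
  have key : ∀ t, n (.V t) = n' (.V t) ∧ n (.M t) = n' (.M t) ∧ n (.Mσ t) = n' (.Mσ t) ∧
      n (.T t) = n' (.T t) ∧ n (.M (-(t : ℤ) - 2)) = n' (.M (-(t : ℤ) - 2)) := fun t => by
    have := hn t
    have := hn' t
    have := h1 t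
    have := h2 t
    have := h3 t
    have := h4 t
    omega
  funext l
  rcases l with t | (t | (_ | t)) | t | t
  · exact (key t).1
  · exact (key t).2.1
  · exact h0
  · have := (key t).2.2.2.2
    rwa [show -(t : ℤ) - 2 = Int.negSucc (t + 1) by omega] at this
  · exact (key t).2.2.1
  · exact (key t).2.2.2.1

theorem singDim_eq (hV : InCatO V) (hW : InCatO W) (h : wt V = wt W) (h' : coDim V = coDim W) :
    singDim V = singDim W := funext fun r => by
  have h1 := singDim_add_wt hV r
  have h2 := singDim_add_wt hW r
  rw [h, h'] at h1
  omega

theorem multiplicities_eq_of_rigid (hV : InCatO V) (hW : InCatO W) (rV : Rigid V) (rW : Rigid W)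
    (hd : wt V = wt W) (hK : lowDim V = lowDim W) (hC : coDim V = coDim W) :
    ∀ n n' : Label → ℕ, Nonempty (V ≃ₗ[Uq] LabelSum n) → Nonempty (W ≃ₗ[Uq] LabelSum n') →
      n = n' := by
  rintro n n' ⟨φ⟩ ⟨ψ⟩
  have hs := singDim_eq hV hW hd hC
  rw [singDim_congr φ, singDim_congr ψ] at hs
  rw [lowDim_congr φ, lowDim_congr ψ] at hK
  rw [coDim_congr hV φ, coDim_congr hW ψ] at hC
  refine multiplicities_eq (rV.labelSum hV φ) (rW.labelSum hW ψ) ?_ ?_ ?_ ?_ ?_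
  · rw [← labelSum_singDim_neg_one n, ← labelSum_singDim_neg_one n', hs]
  · intro t; rw [← labelSum_singDim_nat, ← labelSum_singDim_nat, hs]
  · intro t; rw [← labelSum_singDim_neg, ← labelSum_singDim_neg, hs]
  · intro t; rw [← labelSum_lowDim_neg, ← labelSum_lowDim_neg, hK]
  · intro t; rw [← labelSum_coDim_neg, ← labelSum_coDim_neg, hC]

/-- Rigid modules with the same dimensions are isomorphic. -/
theorem equiv_of_rigid (hV : InCatO V) (hW : InCatO W) (rV : Rigid V) (rW : Rigid W)
    (hd : wt V = wt W) (hK : lowDim V = lowDim W) (hC : coDim V = coDim W) :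
    Nonempty (V ≃ₗ[Uq] W) := by
  obtain ⟨n, ⟨φ⟩⟩ := exists_decomposition hV
  obtain ⟨n', ⟨ψ⟩⟩ := exists_decomposition hW
  obtain rfl := multiplicities_eq_of_rigid hV hW rV rW hd hK hC n n' ⟨φ⟩ ⟨ψ⟩
  exact ⟨φ.trans ψ.symm⟩

theorem exists_hasMultiplicities (hV : InCatO V) (rV : Rigid V) : ∃ n, HasMultiplicities V n := by
  obtain ⟨n, hn⟩ := exists_decomposition hV
  exact ⟨n, hn, fun n' hn' => multiplicities_eq_of_rigid hV hV rV rV rfl rfl rfl n' n hn' hn⟩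

/-- The multiplicities of a rigid module are those that are compatible with its dimensions. -/
theorem hasMultiplicities_of (hV : InCatO V) (rV : Rigid V) {n : Label → ℕ}
    (hn : ∀ t, (n (.V t) = 0 ∧ n (.Mσ t) = 0) ∨ (n (.V t) = 0 ∧ n (.M t) = 0) ∨
      (n (.M t) = 0 ∧ n (.Mσ t) = 0))
    (hK : ∀ t : ℕ, lowDim V (-(t : ℤ)) = n (.V t) + n (.Mσ t))
    (hC : ∀ t : ℕ, coDim V (-(t : ℤ) - 2) = n (.V t) + n (.M t))
    (h0 : wt V (-1) = wt V 1 + n (.M (-1)))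
    (h1 : ∀ t : ℕ, wt V t = wt V (t + 2) + (n (.V t) + n (.M t) + n (.Mσ t) + n (.T t)))
    (h2 : ∀ t : ℕ, wt V (-(t : ℤ) - 2) + (n (.V t) + n (.M t)) =
      wt V (-(t : ℤ)) + (n (.M t) + n (.T t) + n (.M (-(t : ℤ) - 2)))) :
    HasMultiplicities V n := by
  obtain ⟨n', ⟨φ⟩, hu⟩ := exists_hasMultiplicities hV rV
  suffices n' = n by subst this; exact ⟨⟨φ⟩, hu⟩
  have hs := singDim_add_wt hV
  have hc := fun r hr => coDim_nonneg hV (r := r) hr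
  rw [lowDim_congr φ] at hK
  rw [singDim_congr φ] at hs
  refine multiplicities_eq (rV.labelSum hV φ) hn ?_ ?_ ?_ ?_ ?_
  · rw [← labelSum_singDim_neg_one n']
    have h3 := hs (-1)
    rw [hc _ le_rfl, show (-1 : ℤ) + 2 = 1 by norm_num] at h3
    omega
  · intro t
    rw [← labelSum_singDim_nat]
    have h3 := hs t
    have h4 := h1 t
    rw [hc _ (by omega)] at h3
    omega
  · intro t
    rw [← labelSum_singDim_neg]
    have h3 := hs (-(t : ℤ) - 2)
    have h4 := h2 t
    have h5 := hC t
    rw [show -(t : ℤ) - 2 + 2 = -(t : ℤ) by ring] at h3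
    omega
  · intro t; rw [← labelSum_lowDim_neg, hK]
  · intro t; rw [← labelSum_coDim_neg, ← hC, coDim_congr hV φ]

end uniqueness

/-! ### Tensor products: weights, and the kernel of `f` and cokernel of `e` -/

section tensor

variable {M N M' N' : Type} [AddCommGroup M] [Module Kq M] [Module Uq M] [IsScalarTower Kq Uq M]
  [AddCommGroup N] [Module Kq N] [Module Uq N] [IsScalarTower Kq Uq N]
  [AddCommGroup M'] [Module Kq M'] [Module Uq M'] [IsScalarTower Kq Uq M']
  [AddCommGroup N'] [Module Kq N'] [Module Uq N'] [IsScalarTower Kq Uq N']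

theorem tens_mk_mem {r s : ℤ} {m : M} {n : N} (hm : m ∈ weightSpace M r)
    (hn : n ∈ weightSpace N s) : Tens.mk m n ∈ weightSpace (Tens M N) (r + s) := by
  rw [mem_weightSpace] at *
  rw [k_smul_tens, hm, hn, zpow_add₀ q_ne_zero, mul_smul]
  exact TensorProduct.smul_tmul_smul _ _ _ _ |>.trans (mul_smul _ _ _)

theorem Admissible.add {ι κ : Type} {w : ι → ℤ} {w' : κ → ℤ} (h : Admissible w)
    (h' : Admissible w') : Admissible fun p : ι × κ => w p.1 + w' p.2 := by
  obtain ⟨N, hN⟩ := h.bdd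
  obtain ⟨N', hN'⟩ := h'.bdd
  have hfin : ∀ {ι : Type} {w : ι → ℤ}, Admissible w → ∀ a b, {i | a ≤ w i ∧ w i ≤ b}.Finite := by
    intro ι w hw a b
    have : {i | a ≤ w i ∧ w i ≤ b} = ⋃ r ∈ Set.Icc a b, {i | w i = r} := by
      ext i; simp
    rw [this]
    exact (Set.finite_Icc a b).biUnion fun r _ => @Set.toFinite _ _ (hw.finite r)
  refine ⟨fun r => ?_, N + N', fun p => add_le_add (hN _) (hN' _)⟩
  refine Set.Finite.to_subtype (s := {p : ι × κ | w p.1 + w' p.2 = r}) ?_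
  refine ((hfin h (r - N') N).prod (hfin h' (r - N) N')).subset ?_
  rintro ⟨i, j⟩ hp
  have h1 := hN i
  have h2 := hN' j
  simp only [Set.mem_ofPred_eq] at hp
  refine ⟨⟨?_, h1⟩, ?_, h2⟩ <;> simp only <;> omega

theorem HasWeights.tens {ι κ : Type} {w : ι → ℤ} {w' : κ → ℤ} (h : HasWeights M w)
    (h' : HasWeights N w') : HasWeights (Tens M N) fun p : ι × κ => w p.1 + w' p.2 := by
  obtain ⟨hw, b, hb⟩ := h
  obtain ⟨hw', b', hb'⟩ := h'
  refine ⟨hw.add hw', (b.tensorProduct b' : Module.Basis (ι × κ) Kq (M ⊗[Kq] N)), ?_⟩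
  rintro ⟨i, j⟩
  have h : (b.tensorProduct b' : Module.Basis (ι × κ) Kq (M ⊗[Kq] N)) (i, j) =
    Tens.mk (b i) (b' j) := Module.Basis.tensorProduct_apply b b' i j
  change (b.tensorProduct b' : Module.Basis (ι × κ) Kq (M ⊗[Kq] N)) (i, j) ∈
    weightSpace (Tens M N) (w i + w' j)
  rw [h]
  exact tens_mk_mem (hb i) (hb' j)

theorem InCatO.tens (hM : InCatO M) (hN : InCatO N) : InCatO (Tens M N) := by
  obtain ⟨ι, w, h⟩ := hM
  obtain ⟨κ, w', h'⟩ := hN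
  exact (h.tens h').inCatO

/-- The top component of `f x`, with respect to a weight basis of the second factor, is a multiple
of `f` applied to the top component of `x`. -/
theorem FInj.tens_left (hM : FInj M) (hN : InCatO N) : FInj (Tens M N) := by
  classical
  obtain ⟨κ, w, hw, b, hb⟩ := hN
  intro x hx
  obtain ⟨a, rfl⟩ := TensorProduct.eq_repr_basis_right b (show M ⊗[Kq] N from x)
  by_contra h0
  have ha : a ≠ 0 := fun h => h0 (by rw [h]; exact Finsupp.sum_zero_index)
  obtain ⟨j, hj, hmax⟩ := a.support.exists_max_image w (Finsupp.support_nonempty_iff.mpr ha)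
  refine Finsupp.mem_support_iff.mp hj (hM _ ?_)
  have h1 : Uq.f • (a.sum fun i m => Tens.mk m (b i)) = 0 := hx
  rw [Finsupp.sum, Finset.smul_sum] at h1
  obtain ⟨A, hA⟩ : ∃ A : Tens M N →ₗ[Kq] M, ∀ m n, A (Tens.mk m n) = b.repr n j • m :=
    ⟨(TensorProduct.rid Kq M).toLinearMap ∘ₗ (b.coord j).lTensor M, fun m n => by
      refine Eq.trans ?_ (TensorProduct.rid_tmul m (b.coord j n))
      rfl⟩
  have hterm : ∀ i ∈ a.support, A (Uq.f • Tens.mk (a i) (b i)) =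
      if i = j then q ^ (-w j) • Uq.f • a j else 0 := by
    intro i hi
    have h3 : b.repr (Uq.f • b i) j = 0 :=
      hb.repr_eq_zero (f_mem (hb i)) (by have := hmax i hi; omega)
    rw [f_smul_tens, map_add, hA, hA, h3, zero_smul, add_zero, kinv_smul_mem (hb i), map_smul,
      b.repr_self, Finsupp.smul_apply]
    split_ifs with hij
    · rw [hij, Finsupp.single_eq_same, smul_eq_mul, mul_one]
    · rw [Finsupp.single_eq_of_ne (Ne.symm hij), smul_zero, zero_smul]
  have h5 := congrArg A h1
  rw [map_sum, map_zero] at h5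
  rw [Finset.sum_congr rfl hterm, Finset.sum_ite_eq', if_pos hj] at h5
  exact (smul_eq_zero.mp h5).resolve_left (zpow_ne_zero _ q_ne_zero)

theorem FInj.tens_right (hN : FInj N) (hM : InCatO M) : FInj (Tens M N) := by
  classical
  obtain ⟨κ, w, hw, b, hb⟩ := hM
  intro x hx
  obtain ⟨a, rfl⟩ := TensorProduct.eq_repr_basis_left b (show M ⊗[Kq] N from x)
  by_contra h0
  have ha : a ≠ 0 := fun h => h0 (by rw [h]; exact Finsupp.sum_zero_index)
  obtain ⟨j, hj, hmax⟩ := a.support.exists_max_image w (Finsupp.support_nonempty_iff.mpr ha)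
  refine Finsupp.mem_support_iff.mp hj (hN _ ?_)
  have h1 : Uq.f • (a.sum fun i m => Tens.mk (b i) m) = 0 := hx
  rw [Finsupp.sum, Finset.smul_sum] at h1
  obtain ⟨A, hA⟩ : ∃ A : Tens M N →ₗ[Kq] N, ∀ m n, A (Tens.mk m n) = b.repr m j • n :=
    ⟨(TensorProduct.lid Kq N).toLinearMap ∘ₗ (b.coord j).rTensor N, fun m n => by
      refine Eq.trans ?_ (TensorProduct.lid_tmul n (b.coord j m))
      rfl⟩
  have hterm : ∀ i ∈ a.support, A (Uq.f • Tens.mk (b i) (a i)) =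
      if i = j then Uq.f • a j else 0 := by
    intro i hi
    have h3 : b.repr (Uq.f • b i) j = 0 :=
      hb.repr_eq_zero (f_mem (hb i)) (by have := hmax i hi; omega)
    rw [f_smul_tens, map_add, hA, hA, h3, zero_smul, zero_add, b.repr_self]
    split_ifs with hij
    · rw [hij, Finsupp.single_eq_same, one_smul]
    · rw [Finsupp.single_eq_of_ne (Ne.symm hij), zero_smul]
  have h5 := congrArg A h1
  rw [map_sum, map_zero] at h5
  rwa [Finset.sum_congr rfl hterm, Finset.sum_ite_eq', if_pos hj] at h5

theorem tens_induction {P : Tens M N → Prop} (h0 : P 0) (hmk : ∀ m n, P (Tens.mk m n))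
    (hadd : ∀ x y, P x → P y → P (x + y)) (x : Tens M N) : P x :=
  TensorProduct.induction_on (motive := P) x h0 hmk hadd

theorem eSurj_tens_of_mk (h : ∀ (m : M) (n : N), ∃ y, Uq.e • y = Tens.mk m n) :
    ESurj (Tens M N) := by
  intro x
  induction x using tens_induction with
  | h0 => exact ⟨0, smul_zero _⟩
  | hmk m n => exact h m n
  | hadd x y hx hy =>
    obtain ⟨a, ha⟩ := hx
    obtain ⟨b, hb⟩ := hy
    exact ⟨a + b, (smul_add _ _ _).trans (congrArg₂ (· + ·) ha hb)⟩

/-- By induction on the power of `e` that kills `n`: if `e m' = m`, then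
`e (m' ⊗ n) = m ⊗ n + k m' ⊗ e n`, where the last term is in the image of `e` by induction. -/
theorem ESurj.tens_left (hM : ESurj M) (hN : InCatO N) : ESurj (Tens M N) := by
  have key : ∀ (p : ℕ) (m : M) (n : N), Uq.e ^ p • n = 0 → ∃ y, Uq.e • y = Tens.mk m n := by
    intro p
    induction p with
    | zero =>
      intro m n hn
      rw [pow_zero, one_smul] at hn
      exact ⟨0, by rw [smul_zero, hn]; exact (TensorProduct.tmul_zero _ _).symm⟩
    | succ p ih =>
      intro m n hn
      obtain ⟨m', hm'⟩ := hM m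
      obtain ⟨y, hy⟩ := ih (Uq.k • m') (Uq.e • n) (by rwa [← mul_smul, ← pow_succ])
      refine ⟨Tens.mk m' n - y, ?_⟩
      rw [smul_sub, e_smul_tens, hy, add_sub_cancel_right]
      exact congrArg (fun z => Tens.mk z n) hm'
  refine eSurj_tens_of_mk fun m n => ?_
  obtain ⟨p, hp⟩ := hN.eNilpotent n
  exact key p m n hp

theorem e_pow_kinv (p : ℕ) (m : M) (h : Uq.e ^ p • m = 0) : Uq.e ^ p • Uq.kinv • m = 0 := by
  have key : ∃ c : Kq, Uq.e ^ p * Uq.kinv = c • (Uq.kinv * Uq.e ^ p) := by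
    clear h
    induction p with
    | zero => exact ⟨1, by simp⟩
    | succ p ih =>
      obtain ⟨c, hc⟩ := ih
      refine ⟨q ^ (2 : ℤ) * c, ?_⟩
      rw [pow_succ, mul_assoc, Uq.e_mul_kinv, mul_smul_comm, ← mul_assoc, hc, smul_mul_assoc,
        smul_smul, mul_assoc]
  obtain ⟨c, hc⟩ := key
  rw [← mul_smul, hc, smul_assoc, mul_smul, h, smul_zero, smul_zero]

theorem ESurj.tens_right (hN : ESurj N) (hM : InCatO M) : ESurj (Tens M N) := by
  have key : ∀ (p : ℕ) (m : M) (n : N), Uq.e ^ p • m = 0 → ∃ y, Uq.e • y = Tens.mk m n := by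
    intro p
    induction p with
    | zero =>
      intro m n hm
      rw [pow_zero, one_smul] at hm
      exact ⟨0, by rw [smul_zero, hm]; exact (TensorProduct.zero_tmul _ _).symm⟩
    | succ p ih =>
      intro m n hm
      obtain ⟨n', hn'⟩ := hN n
      obtain ⟨y, hy⟩ := ih (Uq.e • Uq.kinv • m) n' (by
        rw [← mul_smul, ← pow_succ]
        exact e_pow_kinv _ _ hm)
      refine ⟨Tens.mk (Uq.kinv • m) n' - y, ?_⟩
      rw [smul_sub, e_smul_tens, hy, add_sub_cancel_left, ← mul_smul Uq.k, Uq.k_mul_kinv, one_smul]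
      exact congrArg (fun z => Tens.mk m z) hn'
  refine eSurj_tens_of_mk fun m n => ?_
  obtain ⟨p, hp⟩ := hM.eNilpotent m
  exact key p m n hp

theorem kinv_smul_tens (m : M) (n : N) :
    Uq.kinv • Tens.mk m n = Tens.mk (Uq.kinv • m) (Uq.kinv • n) := by
  have h : Uq.kinv • Uq.k • Tens.mk (Uq.kinv • m) (Uq.kinv • n) =
      Tens.mk (Uq.kinv • m) (Uq.kinv • n) := by rw [← mul_smul, Uq.kinv_mul_k, one_smul]
  rwa [k_smul_tens, ← mul_smul, ← mul_smul, Uq.k_mul_kinv, one_smul, one_smul] at h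

/-- The tensor product of two homomorphisms. -/
def tensMap (φ : M →ₗ[Uq] M') (ψ : N →ₗ[Uq] N') : Tens M N →ₗ[Uq] Tens M' N' where
  toFun := TensorProduct.map (φ.restrictScalars Kq) (ψ.restrictScalars Kq)
  map_add' x y := map_add (TensorProduct.map (φ.restrictScalars Kq) (ψ.restrictScalars Kq)) x y
  map_smul' u x := by
    set T : Tens M N →ₗ[Kq] Tens M' N' :=
      TensorProduct.map (φ.restrictScalars Kq) (ψ.restrictScalars Kq)
    have hT : ∀ m n, T (Tens.mk m n) = Tens.mk (φ m) (ψ n) := fun m n =>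
      TensorProduct.map_tmul _ _ _ _
    change T (u • x) = u • T x
    have hmk : ∀ {u : Uq}, (∀ m n, T (u • Tens.mk m n) = u • T (Tens.mk m n)) →
        ∀ x, T (u • x) = u • T x := by
      intro u h x
      induction x using tens_induction with
      | h0 => rw [smul_zero, map_zero, smul_zero]
      | hmk m n => exact h m n
      | hadd x y hx hy => rw [smul_add, map_add, map_add, smul_add, hx, hy]
    induction u using Uq.induction generalizing x with
    | hc c => rw [algebraMap_smul, algebraMap_smul, map_smul]
    | he =>
      refine hmk (fun m n => ?_) x
      rw [e_smul_tens, map_add, hT, hT, hT, e_smul_tens, map_smul, map_smul, map_smul]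
    | hf =>
      refine hmk (fun m n => ?_) x
      rw [f_smul_tens, map_add, hT, hT, hT, f_smul_tens, map_smul, map_smul, map_smul]
    | hk =>
      refine hmk (fun m n => ?_) x
      rw [k_smul_tens, hT, hT, k_smul_tens, map_smul, map_smul]
    | hk' =>
      refine hmk (fun m n => ?_) x
      rw [kinv_smul_tens, hT, hT, kinv_smul_tens, map_smul, map_smul]
    | hadd a b ha hb => rw [add_smul, map_add, ha, hb, add_smul]
    | hmul a b ha hb => rw [mul_smul, ha, hb, mul_smul]

/-! ### Submodules and quotients that do not contribute -/

/-- If `φ` is injective and `f` is injective modulo the image of `φ`, then the kernels of `f`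
agree. -/
theorem lowDim_eq_of_injective (φ : M →ₗ[Uq] N) (hφ : Function.Injective φ)
    (h : ∀ x : N, Uq.f • x = 0 → x ∈ LinearMap.range φ) : lowDim M = lowDim N := funext fun r => by
  refine LinearEquiv.finrank_eq (LinearEquiv.ofBijective
    (((φ.restrictScalars Kq).comp (lowSpace M r).subtype).codRestrict (lowSpace N r)
      fun x => ⟨map_mem φ x.2.1, ?_⟩) ⟨?_, ?_⟩)
  · change Uq.f • φ x = 0
    rw [← map_smul, show Uq.f • (x : M) = 0 from x.2.2, map_zero]
  · intro x y hxy
    exact Subtype.ext (hφ (congrArg (fun z : lowSpace N r => (z : N)) hxy))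
  · rintro ⟨y, hy, hf⟩
    obtain ⟨x, rfl⟩ := h y hf
    have hk : φ (Uq.k • x) = φ (q ^ r • x) := by
      rw [map_smul, mem_weightSpace.mp hy]
      exact ((φ.restrictScalars Kq).map_smul _ _).symm
    exact ⟨⟨x, hφ hk, hφ (by
      change φ (Uq.f • x) = φ 0
      rw [map_smul, map_zero]
      exact hf)⟩, rfl⟩

/-- If `φ` is surjective and its kernel is contained in the image of `e`, then the cokernels of `e`
agree. -/
theorem coDim_eq_of_surjective (hM : WeightSpanned M) (φ : M →ₗ[Uq] N)
    (hφ : Function.Surjective φ) (h : ∀ x : M, φ x = 0 → ∃ y, Uq.e • y = x) :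
    coDim M = coDim N := funext fun r => by
  have hle : LinearMap.range (eMap M r) ≤
      (LinearMap.range (eMap N r)).comap (weightMap φ (r + 2)) := by
    rintro _ ⟨x, rfl⟩
    refine ⟨weightMap φ r x, Subtype.ext ?_⟩
    rw [eMap_apply, weightMap_apply, weightMap_apply, eMap_apply, map_smul]
  refine LinearEquiv.finrank_eq (LinearEquiv.ofBijective
    (Submodule.mapQ _ _ (weightMap φ (r + 2)) hle) ⟨?_, ?_⟩)
  · rw [injective_iff_map_eq_zero]
    intro x hx
    obtain ⟨x, rfl⟩ := Submodule.mkQ_surjective _ x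
    rw [Submodule.mkQ_apply, Submodule.mapQ_apply, Submodule.Quotient.mk_eq_zero] at hx
    obtain ⟨y, hy⟩ := hx
    obtain ⟨z, hz⟩ := hφ y
    have h1 : Uq.e • (y : N) = φ x := by
      rw [← eMap_apply, hy, weightMap_apply]
    obtain ⟨y', hy'⟩ := h (x - Uq.e • z) (by rw [map_sub, map_smul, hz, h1, sub_self])
    obtain ⟨v, hv, hv'⟩ := exists_e_preimage hM x.2 (y := y' + z) (by
      rw [smul_add, hy', sub_add_cancel])
    exact (Submodule.Quotient.mk_eq_zero _).mpr ⟨⟨v, hv⟩, Subtype.ext hv'⟩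
  · intro y
    obtain ⟨y, rfl⟩ := Submodule.mkQ_surjective _ y
    obtain ⟨x', hx'⟩ := hφ y
    obtain ⟨x, hx, hxy⟩ := exists_weight_lift hM φ y.2 hx'
    exact ⟨Submodule.mkQ _ ⟨x, hx⟩, congrArg (Submodule.mkQ _) (Subtype.ext hxy)⟩

end tensor

section cores

variable {M N M' L : Type} [AddCommGroup M] [Module Kq M] [Module Uq M] [IsScalarTower Kq Uq M]
  [AddCommGroup N] [Module Kq N] [Module Uq N] [IsScalarTower Kq Uq N]
  [AddCommGroup M'] [Module Kq M'] [Module Uq M'] [IsScalarTower Kq Uq M']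
  [AddCommGroup L] [Module Kq L] [Module Uq L] [IsScalarTower Kq Uq L]

theorem FInj.lowDim_eq_zero (h : FInj M) (r : ℤ) : lowDim M r = 0 := by
  have : lowSpace M r = ⊥ := by
    rw [eq_bot_iff]
    exact fun x hx => (Submodule.mem_bot Kq).mpr (h x hx.2)
  rw [lowDim, this, finrank_bot]

theorem ESurj.coDim_eq_zero (h : ESurj M) (hM : WeightSpanned M) (r : ℤ) : coDim M r = 0 := by
  have : LinearMap.range (eMap M r) = ⊤ := by
    rw [eq_top_iff]
    intro x _
    obtain ⟨y, hy⟩ := h x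
    obtain ⟨z, hz, hz'⟩ := exists_e_preimage hM x.2 hy
    exact ⟨⟨z, hz⟩, Subtype.ext hz'⟩
  rw [coDim, this]
  exact Module.finrank_zero_of_subsingleton

/-- For an exact sequence `0 → M → M' → L → 0` with `f` injective on `L`, the kernels of `f` on
`M ⊗ N` and `M' ⊗ N` agree. -/
theorem lowDim_tens_left {φ : M →ₗ[Uq] M'} {π : M' →ₗ[Uq] L} (hex : Function.Exact φ π)
    (hφ : Function.Injective φ) (hπ : Function.Surjective π) (hL : FInj L) (hN : InCatO N) :
    lowDim (Tens M N) = lowDim (Tens M' N) := by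
  refine lowDim_eq_of_injective (tensMap φ (LinearMap.id : N →ₗ[Uq] N))
    (Module.Flat.rTensor_preserves_injective_linearMap (φ.restrictScalars Kq) hφ) fun x hx => ?_
  have h0 : tensMap π (LinearMap.id : N →ₗ[Uq] N) x = 0 :=
    hL.tens_left hN _ (by rw [← map_smul, hx, map_zero])
  exact (rTensor_exact (f := φ.restrictScalars Kq) (g := π.restrictScalars Kq) N hex hπ x).mp h0

theorem lowDim_tens_right {φ : M →ₗ[Uq] M'} {π : M' →ₗ[Uq] L} (hex : Function.Exact φ π)
    (hφ : Function.Injective φ) (hπ : Function.Surjective π) (hL : FInj L) (hN : InCatO N) :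
    lowDim (Tens N M) = lowDim (Tens N M') := by
  refine lowDim_eq_of_injective (tensMap (LinearMap.id : N →ₗ[Uq] N) φ)
    (Module.Flat.lTensor_preserves_injective_linearMap (φ.restrictScalars Kq) hφ) fun x hx => ?_
  have h0 : tensMap (LinearMap.id : N →ₗ[Uq] N) π x = 0 :=
    hL.tens_right hN _ (by rw [← map_smul, hx, map_zero])
  exact (lTensor_exact (f := φ.restrictScalars Kq) (g := π.restrictScalars Kq) N hex hπ x).mp h0

/-- For an exact sequence `L → M → M' → 0` with `e` surjective on `L`, the cokernels of `e` on
`M ⊗ N` and `M' ⊗ N` agree. -/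
theorem coDim_tens_left {φ : L →ₗ[Uq] M} {π : M →ₗ[Uq] M'} (hex : Function.Exact φ π)
    (hπ : Function.Surjective π) (hL : ESurj L) (hM : InCatO M) (hN : InCatO N) :
    coDim (Tens M N) = coDim (Tens M' N) := by
  refine coDim_eq_of_surjective (hM.tens hN).spanned (tensMap π (LinearMap.id : N →ₗ[Uq] N))
    (LinearMap.rTensor_surjective (g := π.restrictScalars Kq) N hπ) fun x hx => ?_
  obtain ⟨y, hy⟩ := (rTensor_exact (f := φ.restrictScalars Kq) (g := π.restrictScalars Kq)
    N hex hπ x).mp hx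
  obtain ⟨z, hz⟩ := hL.tens_left hN y
  refine ⟨tensMap φ (LinearMap.id : N →ₗ[Uq] N) z, ?_⟩
  rw [← map_smul]
  exact (congrArg (tensMap φ (LinearMap.id : N →ₗ[Uq] N)) hz).trans hy

theorem coDim_tens_right {φ : L →ₗ[Uq] M} {π : M →ₗ[Uq] M'} (hex : Function.Exact φ π)
    (hπ : Function.Surjective π) (hL : ESurj L) (hM : InCatO M) (hN : InCatO N) :
    coDim (Tens N M) = coDim (Tens N M') := by
  refine coDim_eq_of_surjective (hN.tens hM).spanned (tensMap (LinearMap.id : N →ₗ[Uq] N) π)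
    (LinearMap.lTensor_surjective (g := π.restrictScalars Kq) N hπ) fun x hx => ?_
  obtain ⟨y, hy⟩ := (lTensor_exact (f := φ.restrictScalars Kq) (g := π.restrictScalars Kq)
    N hex hπ x).mp hx
  obtain ⟨z, hz⟩ := hL.tens_right hN y
  refine ⟨tensMap (LinearMap.id : N →ₗ[Uq] N) φ z, ?_⟩
  rw [← map_smul]
  exact (congrArg (tensMap (LinearMap.id : N →ₗ[Uq] N) φ) hz).trans hy

/-- The embedding of `V(r)` in `M(r)^σ`. -/
def simpleToCo (r : ℕ) : SimpleMod (r : ℤ) →ₗ[Uq] RestrictedDual (Verma (r : ℤ)) :=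
  simpleLift (coBasis_sing r) (by
    rw [f_pow_coBasis, Finset.prod_eq_zero (Finset.self_mem_range_succ r), zero_smul]
    rw [stringCoeff_eq_zero]
    right
    push_cast
    ring)

theorem simpleToCo_basis (r : ℕ) (n : Fin (r + 1)) : simpleToCo r (simpleBasis r n) =
    (∏ j ∈ Finset.range n, stringCoeff r (0 + j + 1)) • coBasis (r : ℤ) n := by
  rw [simpleBasis_apply, map_smul, simpleToCo, simpleLift_gen, f_pow_coBasis, zero_add]

theorem simpleToCo_injective (r : ℕ) : Function.Injective (simpleToCo r) := by
  refine injective_of_sing (simpleBasis_isWeightBasis r).spanned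
    (simple_hasWeights r).inCatO.eNilpotent _ fun s x hx h0 => ?_
  by_contra hne
  obtain ⟨-, c, rfl⟩ := simple_sing hx hne
  have h1 : c • simpleToCo r (simpleGen (r : ℤ)) = 0 :=
    (((simpleToCo r).restrictScalars Kq).map_smul c _).symm.trans h0
  rw [simpleToCo, simpleLift_gen] at h1
  rcases smul_eq_zero.mp h1 with h | h
  · exact hne (by rw [h, zero_smul])
  · exact (coBasis (r : ℤ)).ne_zero 0 h

theorem coBasis_repr_f (r : ℤ) (x : RestrictedDual (Verma r)) (n : ℕ) :
    (coBasis r).repr (Uq.f • x) (n + 1) = stringCoeff r (n + 1) * (coBasis r).repr x n := by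
  have : ((coBasis r).coord (n + 1)).comp (Algebra.lsmul Kq Kq _ Uq.f) =
      stringCoeff r (n + 1) • (coBasis r).coord n := by
    refine (coBasis r).ext fun m => ?_
    change (coBasis r).coord (n + 1) (Uq.f • coBasis r m) =
      stringCoeff r (n + 1) * (coBasis r).coord n (coBasis r m)
    rw [f_coBasis, map_smul, Module.Basis.coord_apply, Module.Basis.coord_apply,
      Module.Basis.repr_self, Module.Basis.repr_self]
    by_cases h : m = n
    · rw [h, Finsupp.single_eq_same, Finsupp.single_eq_same, smul_eq_mul]
    · rw [Finsupp.single_eq_of_ne (by omega), Finsupp.single_eq_of_ne (by omega), smul_zero,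
        mul_zero]
  exact LinearMap.congr_fun this x

theorem mem_range_simpleToCo {r : ℕ} {x : RestrictedDual (Verma (r : ℤ))} :
    x ∈ LinearMap.range (simpleToCo r) ↔ ∀ n, r < n → (coBasis (r : ℤ)).repr x n = 0 := by
  constructor
  · rintro ⟨y, rfl⟩ n hn
    have : ((coBasis (r : ℤ)).coord n).comp ((simpleToCo r).restrictScalars Kq) = 0 := by
      refine (simpleBasis r).ext fun m => ?_
      change (coBasis (r : ℤ)).coord n (simpleToCo r (simpleBasis r m)) = 0
      rw [simpleToCo_basis, map_smul, Module.Basis.coord_apply, Module.Basis.repr_self,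
        Finsupp.single_eq_of_ne (by omega), smul_zero]
    exact LinearMap.congr_fun this y
  · intro h
    rw [← (coBasis (r : ℤ)).linearCombination_repr x, Finsupp.linearCombination_apply, Finsupp.sum]
    refine Submodule.sum_mem ((LinearMap.range (simpleToCo r)).restrictScalars Kq) fun n hn => ?_
    refine Submodule.smul_mem _ _ ?_
    have hnr : n < r + 1 := by
      by_contra hlt
      exact Finsupp.mem_support_iff.mp hn (h n (by omega))
    have hne : ∏ j ∈ Finset.range n, stringCoeff r (0 + j + 1) ≠ 0 :=
      prod_stringCoeff_ne_zero' (Or.inl (by omega))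
    have hb := simpleToCo_basis r ⟨n, hnr⟩
    rw [← inv_smul_eq_iff₀ hne] at hb
    rw [← hb]
    exact Submodule.smul_mem _ _ ⟨_, rfl⟩

/-- The quotient `M(r)^σ / V(r)` does not contribute to the kernel of `f`. -/
theorem simpleToCo_quotient_fInj (r : ℕ) :
    FInj (RestrictedDual (Verma (r : ℤ)) ⧸ LinearMap.range (simpleToCo r)) := by
  intro x hx
  obtain ⟨x, rfl⟩ := Submodule.mkQ_surjective _ x
  rw [← map_smul] at hx
  have h1 := mem_range_simpleToCo.mp ((Submodule.Quotient.mk_eq_zero _).mp hx)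
  refine (Submodule.Quotient.mk_eq_zero _).mpr (mem_range_simpleToCo.mpr fun n hn => ?_)
  have h2 := h1 (n + 1) (by omega)
  rw [coBasis_repr_f] at h2
  refine (mul_eq_zero.mp h2).resolve_left ?_
  rw [stringCoeff_eq_zero]
  omega

/-- The embedding of `M(-r-2)` in `M(r)`. -/
def vermaToVerma (r : ℕ) : Verma (-(r : ℤ) - 2) →ₗ[Uq] Verma (r : ℤ) :=
  vermaLift (IsSing.f_pow (vermaGen_sing r))

theorem vermaToVerma_basis (r n : ℕ) :
    vermaToVerma r (vermaBasis _ n) = vermaBasis (r : ℤ) (n + (r + 1)) := by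
  rw [vermaBasis_apply, map_smul, vermaToVerma, vermaLift_gen, vermaBasis_apply, ← mul_smul,
    ← pow_add]

theorem vermaToVerma_exact (r : ℕ) :
    Function.Exact (vermaToVerma r) (vermaMax (r : ℤ)).mkQ := by
  intro x
  constructor
  · intro h
    have h1 := mem_vermaMax.mp ((Submodule.Quotient.mk_eq_zero _).mp h)
    change x ∈ (LinearMap.range (vermaToVerma r)).restrictScalars Kq
    rw [← (vermaBasis (r : ℤ)).linearCombination_repr x, Finsupp.linearCombination_apply,
      Finsupp.sum]
    refine Submodule.sum_mem _ fun n hn => Submodule.smul_mem _ _ ?_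
    have hnr : r < n := by
      by_contra hlt
      exact Finsupp.mem_support_iff.mp hn (h1 n (by omega))
    refine ⟨vermaBasis _ (n - (r + 1)), ?_⟩
    rw [vermaToVerma_basis, Nat.sub_add_cancel hnr]
  · rintro ⟨y, rfl⟩
    have : (vermaMax (r : ℤ)).mkQ ∘ₗ vermaToVerma r = 0 := verma_hom_ext (by
      change (vermaMax (r : ℤ)).mkQ (vermaToVerma r (vermaGen _)) = 0
      rw [vermaToVerma, vermaLift_gen, ← vermaBasis_apply, ← f_pow_simpleGen]
      exact f_pow_simpleGen_eq_zero (Nat.lt_succ_self r))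
    exact LinearMap.congr_fun this y

end cores

namespace Label

/-- The index of the finite-dimensional submodule of `X` on which the kernel of `f` is supported,
if this is not zero. -/
def lowCore : Label → Option ℕ
  | V r => some r
  | Mσ r => some r
  | M _ => none
  | T _ => none

/-- The index of the finite-dimensional quotient of `X` on which the cokernel of `e` is supported,
if this is not zero. -/
def coCore : Label → Option ℕ
  | V r => some r
  | M (.ofNat r) => some r
  | M (.negSucc _) => none
  | Mσ _ => none
  | T _ => none

theorem coCore_dual : ∀ l : Label, l.dual.coCore = l.lowCore
  | V _ => rfl
  | M (.ofNat _) => rfl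
  | M (.negSucc _) => rfl
  | Mσ _ => rfl
  | T _ => rfl

theorem lowCore_dual : ∀ l : Label, l.dual.lowCore = l.coCore
  | V _ => rfl
  | M (.ofNat _) => rfl
  | M (.negSucc _) => rfl
  | Mσ _ => rfl
  | T _ => rfl

theorem fInj : ∀ l : Label, l.lowCore = none → FInj l.Mod
  | M s, _ => verma_fInj s
  | T r, _ => tilt_fInj r

theorem eSurj : ∀ l : Label, l.coCore = none → ESurj l.Mod
  | M (.negSucc s), _ => verma_eSurj (Int.negSucc_lt_zero s)
  | Mσ r, _ => verma_dual_eSurj r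
  | T r, _ => tilt_eSurj r

end Label

section cores

variable {N V : Type} [AddCommGroup N] [Module Kq N] [Module Uq N] [IsScalarTower Kq Uq N]
  [AddCommGroup V] [Module Kq V] [Module Uq V] [IsScalarTower Kq Uq V]

theorem Label.lowDim_tens_left (hN : InCatO N) {r : ℕ} : ∀ l : Label, l.lowCore = some r →
    lowDim (Tens l.Mod N) = lowDim (Tens (SimpleMod (r : ℤ)) N)
  | .V s, h => by cases h; rfl
  | .Mσ s, h => by
    cases h
    exact (QuantumSl2.lowDim_tens_left (φ := simpleToCo r)
      (π := (LinearMap.range (simpleToCo r)).mkQ)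
      (fun _ => Submodule.Quotient.mk_eq_zero _) (simpleToCo_injective r)
      (Submodule.mkQ_surjective _) (simpleToCo_quotient_fInj r) hN).symm

theorem Label.lowDim_tens_right (hN : InCatO N) {r : ℕ} : ∀ l : Label, l.lowCore = some r →
    lowDim (Tens N l.Mod) = lowDim (Tens N (SimpleMod (r : ℤ)))
  | .V s, h => by cases h; rfl
  | .Mσ s, h => by
    cases h
    exact (QuantumSl2.lowDim_tens_right (φ := simpleToCo r)
      (π := (LinearMap.range (simpleToCo r)).mkQ)
      (fun _ => Submodule.Quotient.mk_eq_zero _) (simpleToCo_injective r)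
      (Submodule.mkQ_surjective _) (simpleToCo_quotient_fInj r) hN).symm

theorem Label.coDim_tens_left (hN : InCatO N) {r : ℕ} : ∀ l : Label, l.coCore = some r →
    coDim (Tens l.Mod N) = coDim (Tens (SimpleMod (r : ℤ)) N)
  | .V s, h => by cases h; rfl
  | .M (.ofNat s), h => by
    cases h
    change coDim (Tens (Verma (r : ℤ)) N) = _
    exact QuantumSl2.coDim_tens_left (vermaToVerma_exact r) (Submodule.mkQ_surjective _)
      (verma_eSurj (by omega)) (verma_hasWeights r).inCatO hN

theorem Label.coDim_tens_right (hN : InCatO N) {r : ℕ} : ∀ l : Label, l.coCore = some r →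
    coDim (Tens N l.Mod) = coDim (Tens N (SimpleMod (r : ℤ)))
  | .V s, h => by cases h; rfl
  | .M (.ofNat s), h => by
    cases h
    change coDim (Tens N (Verma (r : ℤ))) = _
    exact QuantumSl2.coDim_tens_right (vermaToVerma_exact r) (Submodule.mkQ_surjective _)
      (verma_eSurj (by omega)) (verma_hasWeights r).inCatO hN

theorem eq_V_of_finiteDimensional {n : Label → ℕ} (h : FiniteDimensional Kq (LabelSum n))
    (i : Σ l : Label, Fin (n l)) : ∃ r, i.1 = .V r := by
  by_contra hne
  have h0 := eq_zero_of_finiteDimensional h (l := i.1) fun r hr => hne ⟨r, hr⟩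
  have := i.2.isLt
  omega

/-- In a finite-dimensional module the summands are all of the form `V(t)`, and both sides count
those with lowest weight `r`. -/
theorem lowDim_eq_coDim [FiniteDimensional Kq V] (hV : InCatO V) (r : ℤ) :
    lowDim V r = coDim V (r - 2) := by
  obtain ⟨n, ⟨φ⟩⟩ := exists_decomposition hV
  have := LinearEquiv.finiteDimensional (φ.restrictScalars Kq)
  rw [lowDim_congr φ, coDim_congr hV φ, labelSum_lowDim, labelSum_coDim]
  refine Nat.card_congr (Equiv.subtypeEquivRight fun i => ?_)
  obtain ⟨s, hs⟩ := eq_V_of_finiteDimensional this i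
  rw [hs]
  simp only [Label.lowSupp, Label.coSupp]
  omega

theorem lowDim_add_wt [FiniteDimensional Kq V] (hV : InCatO V) (t : ℕ) :
    lowDim V (-(t : ℤ)) + wt V (t + 2) = wt V t := by
  obtain ⟨n, ⟨φ⟩⟩ := exists_decomposition hV
  have := LinearEquiv.finiteDimensional (φ.restrictScalars Kq)
  have h0 : ∀ {l : Label}, (∀ r, l ≠ .V r) → n l = 0 := fun hl =>
    eq_zero_of_finiteDimensional this hl
  have h1 := singDim_add_wt hV t
  rw [coDim_nonneg hV (by omega), singDim_congr φ, labelSum_singDim_nat, h0 (l := .M t) (by simp),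
    h0 (l := .Mσ t) (by simp), h0 (l := .T t) (by simp)] at h1
  rw [lowDim_congr φ, labelSum_lowDim_neg, h0 (l := .Mσ t) (by simp)]
  omega

end cores

/-! ### Tensor products of two members of the family -/

section pairs

/-- The dimensions of the kernel of `f` in the weight spaces of `V(r) ⊗ V(s)`, and `0` if one of the
indices is missing. -/
def coreDim : Option ℕ → Option ℕ → ℤ → ℕ
  | some r, some s => lowDim (Tens (SimpleMod (r : ℤ)) (SimpleMod (s : ℤ)))
  | _, _ => 0

theorem simple_tens_inCatO (r s : ℕ) : InCatO (Tens (SimpleMod (r : ℤ)) (SimpleMod (s : ℤ))) :=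
  (simple_hasWeights r).inCatO.tens (simple_hasWeights s).inCatO

instance (r s : ℕ) : FiniteDimensional Kq (Tens (SimpleMod (r : ℤ)) (SimpleMod (s : ℤ))) := by
  obtain ⟨-, b, -⟩ := (simple_hasWeights r).tens (simple_hasWeights s)
  exact Module.Finite.of_basis b

theorem tens_lowDim (l l' : Label) :
    lowDim (Tens l.Mod l'.Mod) = coreDim l.lowCore l'.lowCore := by
  rcases h : l.lowCore with _ | r
  · exact funext ((l.fInj h).tens_left l'.inCatO).lowDim_eq_zero
  rcases h' : l'.lowCore with _ | s
  · exact funext ((l'.fInj h').tens_right l.inCatO).lowDim_eq_zero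
  rw [Label.lowDim_tens_left l'.inCatO l h,
    Label.lowDim_tens_right (simple_hasWeights r).inCatO l' h']
  rfl

theorem tens_coDim (l l' : Label) (r : ℤ) :
    coDim (Tens l.Mod l'.Mod) r = coreDim l.coCore l'.coCore (r + 2) := by
  rcases h : l.coCore with _ | a
  · exact ((l.eSurj h).tens_left l'.inCatO).coDim_eq_zero (l.inCatO.tens l'.inCatO).spanned r
  rcases h' : l'.coCore with _ | b
  · exact ((l'.eSurj h').tens_right l.inCatO).coDim_eq_zero (l.inCatO.tens l'.inCatO).spanned r
  rw [Label.coDim_tens_left l'.inCatO l h,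
    Label.coDim_tens_right (simple_hasWeights a).inCatO l' h']
  have := lowDim_eq_coDim (simple_tens_inCatO a b) (r + 2)
  rw [add_sub_cancel_right] at this
  exact this.symm

theorem tens_rigid (l l' : Label) : Rigid (Tens l.Mod l'.Mod) := by
  rcases l with r | (r | r) | r | r <;> rcases l' with s | (s | s) | s | s
  case V.V => exact Or.inr (Or.inr (inferInstanceAs
    (FiniteDimensional Kq (Tens (SimpleMod (r : ℤ)) (SimpleMod (s : ℤ))))))
  all_goals
    first
    | exact Or.inl fun t => congrFun (tens_lowDim _ _) _
    | exact Or.inr (Or.inl fun t => tens_coDim _ _ _)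

theorem cnt_equiv {ι κ : Type} {w : ι → ℤ} {w' : κ → ℤ} (e : ι ≃ κ) (h : ∀ i, w' (e i) = w i) :
    cnt w = cnt w' := funext fun r => Nat.card_congr (e.subtypeEquiv fun i => by rw [h])

theorem wt_tens_comm {M N : Type} [AddCommGroup M] [Module Kq M] [Module Uq M]
    [IsScalarTower Kq Uq M] [AddCommGroup N] [Module Kq N] [Module Uq N] [IsScalarTower Kq Uq N]
    (hM : InCatO M) (hN : InCatO N) : wt (Tens M N) = wt (Tens N M) := by
  obtain ⟨ι, w, h⟩ := hM
  obtain ⟨κ, w', h'⟩ := hN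
  rw [(h.tens h').wt_eq, (h'.tens h).wt_eq]
  exact cnt_equiv (Equiv.prodComm ι κ) fun p => add_comm _ _

theorem coreDim_comm : ∀ a b : Option ℕ, coreDim a b = coreDim b a
  | none, none => rfl
  | none, some _ => rfl
  | some _, none => rfl
  | some r, some s => funext fun m => by
    change lowDim (Tens (SimpleMod (r : ℤ)) (SimpleMod (s : ℤ))) m =
      lowDim (Tens (SimpleMod (s : ℤ)) (SimpleMod (r : ℤ))) m
    rcases le_or_gt m 0 with hm | hm
    · have h1 := lowDim_add_wt (simple_tens_inCatO r s) (-m).toNat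
      have h2 := lowDim_add_wt (simple_tens_inCatO s r) (-m).toNat
      rw [wt_tens_comm (simple_hasWeights r).inCatO (simple_hasWeights s).inCatO] at h1
      rw [show (-((-m).toNat : ℤ)) = m by omega] at h1 h2
      omega
    · rw [lowDim_eq_coDim (simple_tens_inCatO r s), lowDim_eq_coDim (simple_tens_inCatO s r),
        coDim_nonneg (simple_tens_inCatO r s) (by omega),
        coDim_nonneg (simple_tens_inCatO s r) (by omega)]

/-- The two tensor products have the same dimensions, so the universal `R`-matrix is not needed. -/
theorem tens_comm (l l' : Label) : Nonempty (Tens l.Mod l'.Mod ≃ₗ[Uq] Tens l'.Mod l.Mod) := by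
  refine equiv_of_rigid (l.inCatO.tens l'.inCatO) (l'.inCatO.tens l.inCatO) (tens_rigid l l')
    (tens_rigid l' l) (wt_tens_comm l.inCatO l'.inCatO) ?_ (funext fun r => ?_)
  · rw [tens_lowDim, tens_lowDim, coreDim_comm]
  · rw [tens_coDim, tens_coDim, coreDim_comm]

theorem Label.exists_hasWeights : ∀ l : Label, ∃ (ι : Type) (w : ι → ℤ),
    HasWeights l.Mod w ∧ HasWeights l.dual.Mod w
  | .V r => ⟨_, _, simple_hasWeights r, simple_hasWeights r⟩
  | .M (.ofNat s) => ⟨_, _, verma_hasWeights s, verma_dual_hasWeights s⟩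
  | .M (.negSucc _) => ⟨_, _, verma_hasWeights _, verma_hasWeights _⟩
  | .Mσ r => ⟨_, _, verma_dual_hasWeights r, verma_hasWeights r⟩
  | .T r => ⟨_, _, tilt_hasWeights r, tilt_hasWeights r⟩

theorem wt_tens_dual (l l' : Label) :
    wt (Tens l.dual.Mod l'.dual.Mod) = wt (Tens l.Mod l'.Mod) := by
  obtain ⟨ι, w, h, hd⟩ := l.exists_hasWeights
  obtain ⟨κ, w', h', hd'⟩ := l'.exists_hasWeights
  rw [(h.tens h').wt_eq, (hd.tens hd').wt_eq]

theorem Label.dual_M_neg (t : ℕ) :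
    (Label.M (-(t : ℤ) - 2)).dual = .M (-(t : ℤ) - 2) := by
  rw [show -(t : ℤ) - 2 = Int.negSucc (t + 1) by omega]
  rfl

/-- The decomposition of a tensor product of duals: duality preserves the weights and exchanges the
dimensions of the kernel of `f` and the cokernel of `e`. -/
theorem tens_dual (l l' : Label) (n : Label → ℕ) (h : HasMultiplicities (Tens l.Mod l'.Mod) n) :
    HasMultiplicities (Tens l.dual.Mod l'.dual.Mod) (fun x => n x.dual) := by
  obtain ⟨⟨φ⟩, -⟩ := h
  have hO := l.inCatO.tens l'.inCatO
  have hs := singDim_add_wt hO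
  have hK : ∀ t : ℕ, lowDim (Tens l.Mod l'.Mod) (-(t : ℤ)) = n (.V t) + n (.Mσ t) := fun t => by
    rw [lowDim_congr φ, labelSum_lowDim_neg]
  have hC : ∀ t : ℕ, coDim (Tens l.Mod l'.Mod) (-(t : ℤ) - 2) = n (.V t) + n (.M t) := fun t => by
    rw [coDim_congr hO φ, labelSum_coDim_neg]
  have hc := fun r hr => coDim_nonneg hO (r := r) hr
  rw [singDim_congr φ] at hs
  refine hasMultiplicities_of (l.dual.inCatO.tens l'.dual.inCatO) (tens_rigid _ _) (fun t => ?_)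
    (fun t => ?_) (fun t => ?_) ?_ (fun t => ?_) (fun t => ?_)
  · have := (tens_rigid l l').labelSum hO φ t
    simp only [Label.dual]
    tauto
  · rw [tens_lowDim, Label.lowCore_dual, Label.lowCore_dual]
    have := hC t
    rw [tens_coDim, sub_add_cancel] at this
    exact this
  · rw [tens_coDim, Label.coCore_dual, Label.coCore_dual, sub_add_cancel, ← tens_lowDim, hK]
    rfl
  · rw [wt_tens_dual]
    have h3 := hs (-1)
    rw [hc _ le_rfl, show (-1 : ℤ) + 2 = 1 by norm_num, labelSum_singDim_neg_one] at h3
    change _ = _ + n (.M (-1))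
    omega
  · rw [wt_tens_dual]
    have h3 := hs t
    rw [hc _ (by omega), labelSum_singDim_nat] at h3
    change _ = _ + (n (.V t) + n (.Mσ t) + n (.M t) + n (.T t))
    omega
  · rw [wt_tens_dual, Label.dual_M_neg]
    have h3 := hs (-(t : ℤ) - 2)
    rw [hC, labelSum_singDim_neg, show -(t : ℤ) - 2 + 2 = -(t : ℤ) by ring] at h3
    change _ + (n (.V t) + n (.Mσ t)) = _ + (n (.Mσ t) + n (.T t) + n (.M (-(t : ℤ) - 2)))
    omega

end pairs

/-! ### Duality and indecomposability -/

section duality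

variable {M N : Type} [AddCommGroup M] [Module Kq M] [Module Uq M] [IsScalarTower Kq Uq M]
  [AddCommGroup N] [Module Kq N] [Module Uq N] [IsScalarTower Kq Uq N]

theorem equiv_of_fInj_eSurj (hM : InCatO M) (hN : InCatO N) (h : wt M = wt N) (fM : FInj M)
    (fN : FInj N) (eM : ESurj M) (eN : ESurj N) : Nonempty (M ≃ₗ[Uq] N) := by
  refine equiv_of_rigid hM hN (Or.inl fun _ => fM.lowDim_eq_zero _)
    (Or.inl fun _ => fN.lowDim_eq_zero _) h (funext fun r => ?_) (funext fun r => ?_)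
  · rw [fM.lowDim_eq_zero, fN.lowDim_eq_zero]
  · rw [eM.coDim_eq_zero hM.spanned, eN.coDim_eq_zero hN.spanned]

theorem equiv_of_finiteDimensional [FiniteDimensional Kq M] [FiniteDimensional Kq N]
    (hM : InCatO M) (hN : InCatO N) (h : wt M = wt N) : Nonempty (M ≃ₗ[Uq] N) := by
  have hK : lowDim M = lowDim N := funext fun r => by
    rcases le_or_gt r 0 with hr | hr
    · have h1 := lowDim_add_wt hM (-r).toNat
      have h2 := lowDim_add_wt hN (-r).toNat
      rw [show (-((-r).toNat : ℤ)) = r by omega] at h1 h2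
      rw [h] at h1
      omega
    · rw [lowDim_eq_coDim hM, lowDim_eq_coDim hN, coDim_nonneg hM (by omega),
        coDim_nonneg hN (by omega)]
  refine equiv_of_rigid hM hN (Or.inr (Or.inr ‹_›)) (Or.inr (Or.inr ‹_›)) h hK
    (funext fun r => ?_)
  have h1 := lowDim_eq_coDim hM (r + 2)
  have h2 := lowDim_eq_coDim hN (r + 2)
  rw [add_sub_cancel_right] at h1 h2
  rw [← h1, ← h2, hK]

/-- A module with the weights of `M(s)` on which `f` is injective is isomorphic to `M(s)`. -/
theorem verma_equiv_of_fInj {s : ℤ} (h : HasWeights M (mw s)) (hf : FInj M) :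
    Nonempty (Verma s ≃ₗ[Uq] M) := by
  have hO := h.inCatO
  obtain ⟨-, b, hb⟩ := h
  have hv : IsSing s (b 0) := by
    refine ⟨hb.mem_of_eq (by simp [mw]), b.repr.map_eq_zero_iff.mp (Finsupp.ext fun i => ?_)⟩
    refine hb.repr_eq_zero (r := s + 2) (e_mem (hb.mem_of_eq (by simp [mw]))) ?_
    rw [mw]
    omega
  have hinj : Function.Injective (vermaLift hv) := by
    refine injective_of_sing (verma_hasWeights s).inCatO.spanned
      (verma_hasWeights s).inCatO.eNilpotent _ fun r x hx h0 => ?_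
    by_contra hne
    have key : ∀ (n : ℕ) (c : Kq), x ≠ c • Uq.f ^ n • vermaGen s := by
      rintro n c rfl
      have h1 : c • vermaLift hv (Uq.f ^ n • vermaGen s) = 0 :=
        (((vermaLift hv).restrictScalars Kq).map_smul c _).symm.trans h0
      rw [map_smul, vermaLift_gen] at h1
      rcases smul_eq_zero.mp h1 with h | h
      · exact hne (by rw [h, zero_smul])
      · exact hf.pow (b.ne_zero 0) n h
    rcases verma_sing hx hne with ⟨-, c, h⟩ | ⟨-, -, c, h⟩
    · exact key 0 c (by rwa [pow_zero, one_smul])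
    · exact key _ c h
  exact ⟨LinearEquiv.ofBijective _ (bijective_of_wt_eq hO
    ((verma_hasWeights s).wt_eq.trans hb.wt_eq.symm) _ hinj)⟩

theorem Label.dual_equiv : ∀ l : Label, Nonempty (RestrictedDual l.Mod ≃ₗ[Uq] l.dual.Mod)
  | .V r => by
    have h := (simple_hasWeights r).dual
    have : FiniteDimensional Kq (RestrictedDual (SimpleMod (r : ℤ))) :=
      h.2.elim fun b _ => Module.Finite.of_basis b
    have : FiniteDimensional Kq (SimpleMod (r : ℤ)) :=
      Module.Finite.of_basis (simpleBasis r)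
    change Nonempty (RestrictedDual (SimpleMod (r : ℤ)) ≃ₗ[Uq] SimpleMod (r : ℤ))
    exact equiv_of_finiteDimensional h.inCatO (simple_hasWeights r).inCatO
      (wt_dual (simple_hasWeights r).inCatO)
  | .M (.ofNat s) => ⟨LinearEquiv.refl Uq _⟩
  | .M (.negSucc s) => by
    have h := (verma_hasWeights (Int.negSucc s)).inCatO
    change Nonempty (RestrictedDual (Verma (Int.negSucc s)) ≃ₗ[Uq] Verma (Int.negSucc s))
    exact equiv_of_fInj_eSurj h.dual h (wt_dual h)
      (verma_eSurj (Int.negSucc_lt_zero s)).dual (verma_fInj _) ((verma_fInj _).dual h)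
      (verma_eSurj (Int.negSucc_lt_zero s))
  | .Mσ r => by
    obtain ⟨φ⟩ := verma_equiv_of_fInj (verma_dual_hasWeights r).dual (verma_dual_eSurj r).dual
    exact ⟨φ.symm⟩
  | .T r => by
    have h := (tilt_hasWeights r).inCatO
    change Nonempty (RestrictedDual (TiltMod r) ≃ₗ[Uq] TiltMod r)
    exact equiv_of_fInj_eSurj h.dual h (wt_dual h) (tilt_eSurj r).dual (tilt_fInj r)
      ((tilt_fInj r).dual h) (tilt_eSurj r)

/-- Every member of the family has a smallest nonzero submodule, which is generated by a singular
vector. -/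
theorem Label.exists_socle (l : Label) :
    ∃ v : l.Mod, v ≠ 0 ∧ ∀ P : Submodule Uq l.Mod, P ≠ ⊥ → v ∈ P := by
  have key : ∀ P : Submodule Uq l.Mod, P ≠ ⊥ → ∃ r, l.singSupp r ∧ l.singGen r ∈ P := by
    intro P hP
    by_contra! hne
    refine hP (submodule_eq_bot l.inCatO.spanned l.inCatO.eNilpotent P fun r x hx hxP => ?_)
    rcases l.sing hx with h | ⟨hr, c, rfl⟩
    · exact h
    by_cases hc : c = 0
    · rw [hc, zero_smul]
    · refine absurd ?_ (hne r hr)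
      have := (P.restrictScalars Kq).smul_mem c⁻¹ hxP
      rwa [inv_smul_smul₀ hc] at this
  by_cases h : ∃ m : ℕ, l.hw = m ∧ FInj l.Mod
  · obtain ⟨m, hm, hf⟩ := h
    refine ⟨Uq.f ^ (m + 1) • l.top, hf.pow l.top_ne_zero _, fun P hP => ?_⟩
    obtain ⟨r, hr, hP⟩ := key P hP
    by_cases hrl : r = l.hw
    · rw [singGen_hw l hrl] at hP
      exact P.smul_mem _ hP
    · rwa [singGen_ne l hrl hm] at hP
  · refine ⟨l.top, l.top_ne_zero, fun P hP => ?_⟩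
    obtain ⟨r, hr, hP⟩ := key P hP
    rcases singSupp_cases hr with hrl | ⟨m, hm, -, hf⟩
    · rwa [singGen_hw l hrl] at hP
    · exact absurd ⟨m, hm, hf⟩ h

theorem Label.isIndecomposable (l : Label) : IsIndecomposable l.Mod := by
  obtain ⟨v, hv, h⟩ := l.exists_socle
  refine ⟨⟨v, 0, hv⟩, fun N₁ N₂ hN => ?_⟩
  by_contra! hne
  exact hv (Submodule.disjoint_def.mp hN.disjoint v (h N₁ hne.1) (h N₂ hne.2))

end duality

/-! ### Counting weights -/

section counting

variable {M N : Type} [AddCommGroup M] [Module Kq M] [Module Uq M] [IsScalarTower Kq Uq M]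
  [AddCommGroup N] [Module Kq N] [Module Uq N] [IsScalarTower Kq Uq N]

theorem cnt_sum {ι κ : Type} {w : ι → ℤ} {w' : κ → ℤ} (h : Admissible w) (h' : Admissible w')
    (r : ℤ) : cnt (Sum.elim w w') r = cnt w r + cnt w' r := by
  have := h.finite r
  have := h'.finite r
  unfold cnt
  rw [← Nat.card_sum]
  exact Nat.card_congr (Equiv.subtypeSum (p := fun x => Sum.elim w w' x = r))

theorem cnt_eq_cnt {ι : Type} {w w' : ι → ℤ} {r s : ℤ} (h : ∀ i, w i = r ↔ w' i = s) :
    cnt w r = cnt w' s := Nat.card_congr (Equiv.subtypeEquivRight h)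

theorem HasWeights.prod {ι κ : Type} {w : ι → ℤ} {w' : κ → ℤ} (h : HasWeights M w)
    (h' : HasWeights N w') : HasWeights (M × N) (Sum.elim w w') := by
  obtain ⟨hw, b, hb⟩ := h
  obtain ⟨hw', b', hb'⟩ := h'
  refine ⟨hw.sum hw', b.prod b', ?_⟩
  rintro (i | i)
  · rw [Module.Basis.prod_apply]
    refine Prod.ext (hb i) ?_
    change Uq.k • (0 : N) = q ^ w i • (0 : N)
    rw [smul_zero, smul_zero]
  · rw [Module.Basis.prod_apply]
    refine Prod.ext ?_ (hb' i)
    change Uq.k • (0 : M) = q ^ w' i • (0 : M)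
    rw [smul_zero, smul_zero]

theorem FInj.prod (hM : FInj M) (hN : FInj N) : FInj (M × N) := fun _ hx =>
  Prod.ext (hM _ (congrArg Prod.fst hx)) (hN _ (congrArg Prod.snd hx))

theorem ESurj.prod (hM : ESurj M) (hN : ESurj N) : ESurj (M × N) := fun x => by
  obtain ⟨a, ha⟩ := hM x.1
  obtain ⟨b, hb⟩ := hN x.2
  exact ⟨(a, b), Prod.ext ha hb⟩

theorem wt_prod (hM : InCatO M) (hN : InCatO N) (r : ℤ) : wt (M × N) r = wt M r + wt N r := by
  obtain ⟨ι, w, h⟩ := hM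
  obtain ⟨κ, w', h'⟩ := hN
  rw [(h.prod h').wt_eq, h.wt_eq, h'.wt_eq, cnt_sum h.1 h'.1]

theorem InCatO.prod (hM : InCatO M) (hN : InCatO N) : InCatO (M × N) := by
  obtain ⟨ι, w, h⟩ := hM
  obtain ⟨κ, w', h'⟩ := hN
  exact (h.prod h').inCatO

/-- Weight multiplicities of tensor products are additive in the first factor. -/
theorem wt_tens_add {ι ι₁ ι₂ : Type} {w : ι → ℤ} {w₁ : ι₁ → ℤ} {w₂ : ι₂ → ℤ} {M₁ M₂ : Type}
    [AddCommGroup M₁] [Module Kq M₁] [Module Uq M₁] [IsScalarTower Kq Uq M₁]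
    [AddCommGroup M₂] [Module Kq M₂] [Module Uq M₂] [IsScalarTower Kq Uq M₂]
    (h : HasWeights M w) (h₁ : HasWeights M₁ w₁) (h₂ : HasWeights M₂ w₂) (hN : InCatO N)
    (e : ι₁ ⊕ ι₂ ≃ ι) (he : ∀ i, w (e i) = Sum.elim w₁ w₂ i) (r : ℤ) :
    wt (Tens M N) r = wt (Tens M₁ N) r + wt (Tens M₂ N) r := by
  obtain ⟨κ, w', h'⟩ := hN
  rw [(h.tens h').wt_eq, (h₁.tens h').wt_eq, (h₂.tens h').wt_eq,
    ← cnt_sum (h₁.tens h').1 (h₂.tens h').1]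
  refine congrFun (cnt_equiv ((Equiv.sumProdDistrib _ _ _).symm.trans
    (e.prodCongr (Equiv.refl κ))) ?_).symm r
  rintro (p | p)
  · exact congrArg (· + w' p.2) (he (Sum.inl p.1))
  · exact congrArg (· + w' p.2) (he (Sum.inr p.1))

/-- The first vector of the basis of `M(r)`, and the others. -/
def succSplit (ι : Type) : ι ⊕ ℕ × ι ≃ ℕ × ι where
  toFun := Sum.elim (fun i => (0, i)) fun p => (p.1 + 1, p.2)
  invFun
    | (0, i) => Sum.inl i
    | (n + 1, i) => Sum.inr (n, i)
  left_inv := by rintro (i | ⟨n, i⟩) <;> rfl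
  right_inv := by rintro ⟨_ | n, i⟩ <;> rfl

/-- The basis of `M(r)` consists of a vector of weight `r` and of the others, which have the weights
of `M(r)` shifted by `-2`. -/
theorem wt_verma_tens (r : ℤ) (hN : InCatO N) (m : ℤ) :
    wt (Tens (Verma r) N) m = wt (Tens (Verma r) N) (m + 2) + wt N (m - r) := by
  obtain ⟨κ, w', h'⟩ := hN
  have hT := (verma_hasWeights r).tens h'
  rw [hT.wt_eq, h'.wt_eq]
  have h1 : Admissible fun i => w' i + r := ⟨fun s => by
    have := h'.1.finite (s - r)
    exact Finite.of_equiv {i // w' i = s - r} (Equiv.subtypeEquivRight fun i => by omega), by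
    obtain ⟨b, hb⟩ := h'.1.bdd
    exact ⟨b + r, fun i => by have := hb i; omega⟩⟩
  have h2 : Admissible fun p : ℕ × κ => mw r p.1 + w' p.2 - 2 := ⟨fun s => by
    have := hT.1.finite (s + 2)
    exact Finite.of_equiv {i : ℕ × κ // mw r i.1 + w' i.2 = s + 2}
      (Equiv.subtypeEquivRight fun i => by omega), by
    obtain ⟨b, hb⟩ := hT.1.bdd
    exact ⟨b, fun i => by have := hb i; omega⟩⟩
  have h3 := congrFun (cnt_equiv (w := Sum.elim (fun i => w' i + r)
    fun p : ℕ × κ => mw r p.1 + w' p.2 - 2) (w' := fun p : ℕ × κ => mw r p.1 + w' p.2)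
    (succSplit κ) (by
      rintro (i | ⟨n, i⟩)
      · change mw r 0 + w' i = w' i + r
        simp [mw, add_comm]
      · change mw r (n + 1) + w' i = mw r n + w' i - 2
        simp only [mw]; push_cast; ring)) m
  rw [← h3, cnt_sum h1 h2, add_comm]
  congr 1
  · exact cnt_eq_cnt fun i => by omega
  · exact cnt_eq_cnt fun i => by omega

theorem wt_tilt_tens (r : ℕ) (hN : InCatO N) (m : ℤ) :
    wt (Tens (TiltMod r) N) m =
      wt (Tens (Verma (r : ℤ)) N) m + wt (Tens (Verma (-(r : ℤ) - 2)) N) m :=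
  wt_tens_add (tilt_hasWeights r) (verma_hasWeights _) (verma_hasWeights _) hN (Equiv.refl _)
    (fun _ => rfl) m

/-- `M(r)` has the weights of `V(r)` and of `M(-r-2)`. -/
theorem wt_simple_tens (r : ℕ) (hN : InCatO N) (m : ℤ) :
    wt (Tens (Verma (r : ℤ)) N) m =
      wt (Tens (SimpleMod (r : ℤ)) N) m + wt (Tens (Verma (-(r : ℤ) - 2)) N) m :=
  wt_tens_add (verma_hasWeights r) (simple_hasWeights r) (verma_hasWeights _) hN
    (finSumNatEquiv (r + 1))
    (by
      rintro (i | n)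
      · rfl
      · change mw r (r + 1 + n) = mw _ n
        simp only [mw]; push_cast; ring) m

theorem cnt_of_injective {ι : Type} {w : ι → ℤ} (hw : Function.Injective w) (r : ℤ)
    [Decidable (∃ i, w i = r)] : cnt w r = if ∃ i, w i = r then 1 else 0 := by
  have : Subsingleton {i // w i = r} :=
    ⟨fun i j => Subtype.ext (hw (i.2.trans j.2.symm))⟩
  split_ifs with h
  · obtain ⟨i, hi⟩ := h
    have : Nonempty {i // w i = r} := ⟨⟨i, hi⟩⟩
    exact Nat.card_eq_one_iff_unique.mpr ⟨inferInstance, inferInstance⟩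
  · have : IsEmpty {i // w i = r} := ⟨fun i => h ⟨i.1, i.2⟩⟩
    exact Nat.card_of_isEmpty

theorem cnt_mw (s m : ℤ) : cnt (mw s) m = if m ≤ s ∧ (s - m) % 2 = 0 then 1 else 0 := by
  classical
  rw [cnt_of_injective (mw_injective s)]
  refine if_congr ⟨?_, fun h => ⟨((s - m) / 2).toNat, ?_⟩⟩ rfl rfl
  · rintro ⟨n, rfl⟩
    rw [mw]; omega
  · rw [mw]; omega

theorem wt_verma (s m : ℤ) : wt (Verma s) m = if m ≤ s ∧ (s - m) % 2 = 0 then 1 else 0 := by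
  rw [(verma_hasWeights s).wt_eq, cnt_mw]

theorem wt_verma_dual (s m : ℤ) :
    wt (RestrictedDual (Verma s)) m = if m ≤ s ∧ (s - m) % 2 = 0 then 1 else 0 := by
  rw [(verma_dual_hasWeights s).wt_eq, cnt_mw]

theorem wt_simple (r : ℕ) (m : ℤ) : wt (SimpleMod (r : ℤ)) m =
    if m ≤ r ∧ -(r : ℤ) ≤ m ∧ (r - m) % 2 = 0 then 1 else 0 := by
  classical
  rw [(simple_hasWeights r).wt_eq, cnt_of_injective (vw_injective r)]
  refine if_congr ⟨?_, fun h => ⟨⟨((r - m) / 2).toNat, ?_⟩, ?_⟩⟩ rfl rfl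
  · rintro ⟨n, rfl⟩
    rw [vw]; omega
  · omega
  · rw [vw]; simp only; omega

end counting

/-! ### The multiplicities -/

section multiplicities

/-- An index `j` of the formal sum `∑_p a(p) [d - 2 p]` is either `d - 2 p` for some `p`, or has
coefficient `0`. -/
theorem coeff_cases (d j : ℤ) : (∃ p : ℕ, j = d - 2 * p ∧ ∀ a, coeff d a j = a p) ∨
    ((d < j ∨ (d - j) % 2 = 1) ∧ ∀ a, coeff d a j = 0) := by
  by_cases h : j ≤ d ∧ Even (d - j)
  · have h2 := Int.even_iff.mp h.2
    exact Or.inl ⟨((d - j) / 2).toNat, by omega, fun a => if_pos h⟩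
  · refine Or.inr ⟨?_, fun a => if_neg h⟩
    rw [Int.even_iff] at h
    omega

theorem sumT_M_nat (d : ℤ) (a : ℕ → ℕ) (t : ℕ) : sumT d a (.M t) = 0 := by
  rw [sumT, if_neg (by omega)]

theorem sumT_M_neg (d : ℤ) (a : ℕ → ℕ) (t : ℕ) : sumT d a (.M (-(t : ℤ) - 2)) = 0 :=
  if_neg (by omega)

theorem sumT_M_neg_one (d : ℤ) (a : ℕ → ℕ) : sumT d a (.M (-1)) = coeff d a (-1) := rfl

theorem sumT_T (d : ℤ) (a : ℕ → ℕ) (t : ℕ) : sumT d a (.T t) = coeff d a t := rfl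

theorem sumM_M (d : ℤ) (a : ℕ → ℕ) (s : ℤ) : sumM d a (.M s) = coeff d a s := rfl

theorem sumM_T (d : ℤ) (a : ℕ → ℕ) (t : ℕ) : sumM d a (.T t) = 0 := rfl

variable {V : Type} [AddCommGroup V] [Module Kq V] [Module Uq V] [IsScalarTower Kq Uq V]

theorem hasMultiplicities_of_fInj (hV : InCatO V) (hf : FInj V) {n : Label → ℕ}
    (hn : ∀ t : ℕ, n (.V t) = 0 ∧ n (.Mσ t) = 0)
    (hC : ∀ t : ℕ, coDim V (-(t : ℤ) - 2) = n (.M t))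
    (h0 : wt V (-1) = wt V 1 + n (.M (-1)))
    (h1 : ∀ t : ℕ, wt V t = wt V (t + 2) + (n (.M t) + n (.T t)))
    (h2 : ∀ t : ℕ, wt V (-(t : ℤ) - 2) = wt V (-(t : ℤ)) + (n (.T t) + n (.M (-(t : ℤ) - 2)))) :
    HasMultiplicities V n := by
  refine hasMultiplicities_of hV (Or.inl fun _ => hf.lowDim_eq_zero _) (fun t => Or.inl (hn t))
    (fun t => ?_) (fun t => ?_) h0 (fun t => ?_) (fun t => ?_)
  · rw [hf.lowDim_eq_zero, (hn t).1, (hn t).2]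
  · rw [hC, (hn t).1, zero_add]
  · rw [h1, (hn t).1, (hn t).2]; omega
  · rw [h2, (hn t).1]; omega

/-- If `f` is injective and `e` surjective, then only the summands `T(t)` and `M(s)`, `s < 0`, can
occur, and their multiplicities can be read off from the weights. -/
theorem hasMultiplicities_of_fInj_eSurj (hV : InCatO V) (hf : FInj V) (he : ESurj V)
    {n : Label → ℕ} (hn : ∀ t : ℕ, n (.V t) = 0 ∧ n (.Mσ t) = 0 ∧ n (.M t) = 0)
    (h0 : wt V (-1) = wt V 1 + n (.M (-1)))
    (h1 : ∀ t : ℕ, wt V t = wt V (t + 2) + n (.T t))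
    (h2 : ∀ t : ℕ, wt V (-(t : ℤ) - 2) = wt V (-(t : ℤ)) + (n (.T t) + n (.M (-(t : ℤ) - 2)))) :
    HasMultiplicities V n :=
  hasMultiplicities_of_fInj hV hf (fun t => ⟨(hn t).1, (hn t).2.1⟩)
    (fun t => by rw [he.coDim_eq_zero hV.spanned, (hn t).2.2]) h0
    (fun t => by rw [h1, (hn t).2.2, zero_add]) h2

theorem wt_tens_verma {N : Type} [AddCommGroup N] [Module Kq N] [Module Uq N]
    [IsScalarTower Kq Uq N] (s : ℤ) (hN : InCatO N) (m : ℤ) :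
    wt (Tens N (Verma s)) m = wt (Tens N (Verma s)) (m + 2) + wt N (m - s) := by
  rw [wt_tens_comm hN (verma_hasWeights s).inCatO, wt_verma_tens s hN]

theorem simple_simple_lowDim (r s t : ℕ) :
    lowDim (Tens (SimpleMod (r : ℤ)) (SimpleMod (s : ℤ))) (-(t : ℤ)) =
      if (t : ℤ) ≤ r + s ∧ (r : ℤ) - s ≤ t ∧ (s : ℤ) - r ≤ t ∧ ((r : ℤ) + s - t) % 2 = 0
        then 1 else 0 := by
  have hN := (simple_hasWeights s).inCatO
  have h := lowDim_add_wt (simple_tens_inCatO r s) t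
  have h1 := wt_simple_tens r hN t
  have h2 := wt_simple_tens r hN (t + 2)
  have h3 := wt_verma_tens r hN t
  have h4 := wt_verma_tens (-(r : ℤ) - 2) hN t
  rw [wt_simple] at h3 h4
  split_ifs at h3 h4 ⊢ <;> omega

theorem coreDim_some (r s t : ℕ) : coreDim (some r) (some s) (-(t : ℤ)) =
    if (t : ℤ) ≤ r + s ∧ (r : ℤ) - s ≤ t ∧ (s : ℤ) - r ≤ t ∧ ((r : ℤ) + s - t) % 2 = 0
      then 1 else 0 := simple_simple_lowDim r s t

theorem simple_tens_simple (r s : ℕ) :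
    HasMultiplicities (Tens (SimpleMod (r : ℤ)) (SimpleMod (s : ℤ)))
      (sumV (r + s) (fun p => if p ≤ min r s then 1 else 0)) := by
  have hK : ∀ t : ℕ, lowDim (Tens (SimpleMod (r : ℤ)) (SimpleMod (s : ℤ))) (-(t : ℤ)) =
      sumV (r + s) (fun p => if p ≤ min r s then 1 else 0) (.V t) := fun t => by
    rw [simple_simple_lowDim]
    simp only [sumV, coeff, Int.even_iff]
    split_ifs <;> omega
  have hN := (simple_hasWeights s).inCatO
  refine hasMultiplicities_of (simple_tens_inCatO r s) (Or.inr (Or.inr inferInstance))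
    (fun t => Or.inr (Or.inr ⟨rfl, rfl⟩)) hK
    (fun t => (lowDim_eq_coDim (simple_tens_inCatO r s) _).symm.trans (hK t)) ?_ (fun t => ?_)
    (fun t => ?_)
  · have h1 := wt_simple_tens r hN (-1)
    have h2 := wt_simple_tens r hN 1
    have h3 := wt_verma_tens r hN (-1)
    have h4 := wt_verma_tens (-(r : ℤ) - 2) hN (-1)
    rw [wt_simple, show (-1 : ℤ) + 2 = 1 by norm_num] at h3 h4
    change _ = _ + 0
    split_ifs at h3 h4 <;> omega
  · rw [← lowDim_add_wt (simple_tens_inCatO r s) t, hK]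
    change _ = _ + (_ + 0 + 0 + 0)
    omega
  · have h1 := wt_simple_tens r hN (-(t : ℤ) - 2)
    have h2 := wt_simple_tens r hN (-(t : ℤ))
    have h3 := wt_verma_tens r hN (-(t : ℤ) - 2)
    have h4 := wt_verma_tens (-(r : ℤ) - 2) hN (-(t : ℤ) - 2)
    rw [wt_simple, show -(t : ℤ) - 2 + 2 = -(t : ℤ) by ring] at h3 h4
    rw [← hK, simple_simple_lowDim]
    change _ + (_ + 0) = _ + (0 + 0 + 0)
    split_ifs at h3 h4 ⊢ <;> omega

/-- Here `e` is not surjective: its cokernel is the one on `V(r) ⊗ V(s)`, which accounts for the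
summands `M(t)` with `t ≥ 0`. -/
theorem verma_tens_verma_nat (r s : ℕ) :
    HasMultiplicities (Tens (Verma (r : ℤ)) (Verma (s : ℤ)))
      (sumM (r + s) (fun p => if p ≤ min r s then 1 else 0) +
        sumT (r + s) (fun p => if min r s + 1 ≤ p ∧ p ≤ (r + s + 1) / 2 then 1 else 0) +
        sumM (r + s) (fun p => if max r s + 1 ≤ p then 1 else 0)) := by
  have hN := (verma_hasWeights s).inCatO
  have hd := wt_verma_tens r hN
  refine hasMultiplicities_of_fInj ((verma_hasWeights r).inCatO.tens hN)
    ((verma_fInj _).tens_left hN) (fun t => ⟨rfl, rfl⟩) (fun t => ?_) ?_ (fun t => ?_) (fun t => ?_)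
  · refine (tens_coDim (.M (Int.ofNat r)) (.M (Int.ofNat s)) _).trans ?_
    rw [sub_add_cancel]
    refine (coreDim_some r s t).trans ?_
    simp only [Pi.add_apply, sumT_M_nat, sumM_M]
    rcases coeff_cases (r + s) t with ⟨p, hp, h⟩ | ⟨hp, h⟩ <;> simp only [h]
    · split_ifs <;> omega
    · rw [if_neg (by omega)]
  · rw [hd, wt_verma]
    simp only [Pi.add_apply, sumT_M_neg_one, sumM_M]
    rcases coeff_cases (r + s) (-1) with ⟨p, hp, h⟩ | ⟨hp, h⟩ <;> simp only [h]
    · rw [show (-1 : ℤ) + 2 = 1 by norm_num]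
      split_ifs <;> omega
    · rw [if_neg (by omega)]; rfl
  · rw [hd, wt_verma]
    simp only [Pi.add_apply, sumT_M_nat, sumM_M, sumT_T, sumM_T]
    rcases coeff_cases (r + s) t with ⟨p, hp, h⟩ | ⟨hp, h⟩ <;> simp only [h]
    · split_ifs <;> omega
    · rw [if_neg (by omega)]
  · rw [hd, wt_verma, sub_add_cancel]
    simp only [Pi.add_apply, sumT_M_neg, sumM_M, sumT_T, sumM_T]
    rcases coeff_cases (r + s) (-(t : ℤ) - 2) with ⟨p, hp, h⟩ | ⟨hp, h⟩ <;>
      rcases coeff_cases (r + s) t with ⟨p', hp', h'⟩ | ⟨hp', h'⟩ <;> simp only [h, h']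
    · split_ifs <;> omega
    · split_ifs <;> omega
    · split_ifs <;> omega
    · rw [if_neg (by omega)]

end multiplicities

section multiplicities

/-- As for `M(r) ⊗ M(s)`, the cokernel of `e` is the one on `V(r) ⊗ V(s)`. -/
theorem simple_tens_verma_nat (r s : ℕ) :
    HasMultiplicities (Tens (SimpleMod (r : ℤ)) (Verma (s : ℤ)))
      (sumM (r + s) (fun p => if p ≤ min r s then 1 else 0) +
        sumT (r + s) (fun p => if s < r ∧ s + 1 ≤ p ∧ p ≤ (r + s + 1) / 2 then 1 else 0)) := by
  have hN := (simple_hasWeights r).inCatO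
  have hd := wt_tens_verma s hN
  refine hasMultiplicities_of_fInj (hN.tens (verma_hasWeights s).inCatO)
    ((verma_fInj _).tens_right hN) (fun t => ⟨rfl, rfl⟩) (fun t => ?_) ?_ (fun t => ?_)
    (fun t => ?_)
  · refine (tens_coDim (.V r) (.M (Int.ofNat s)) _).trans ?_
    rw [sub_add_cancel]
    refine (coreDim_some r s t).trans ?_
    simp only [Pi.add_apply, sumT_M_nat, sumM_M]
    rcases coeff_cases (r + s) t with ⟨p, hp, h⟩ | ⟨hp, h⟩ <;> simp only [h]
    · split_ifs <;> omega
    · rw [if_neg (by omega)]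
  · rw [hd, wt_simple]
    simp only [Pi.add_apply, sumT_M_neg_one, sumM_M]
    rcases coeff_cases (r + s) (-1) with ⟨p, hp, h⟩ | ⟨hp, h⟩ <;> simp only [h]
    · rw [show (-1 : ℤ) + 2 = 1 by norm_num]
      split_ifs <;> omega
    · rw [show (-1 : ℤ) + 2 = 1 by norm_num]
      split_ifs <;> omega
  · rw [hd, wt_simple]
    simp only [Pi.add_apply, sumT_M_nat, sumM_M, sumT_T, sumM_T]
    rcases coeff_cases (r + s) t with ⟨p, hp, h⟩ | ⟨hp, h⟩ <;> simp only [h]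
    · split_ifs <;> omega
    · split_ifs <;> omega
  · rw [hd, sub_add_cancel, wt_simple]
    simp only [Pi.add_apply, sumT_M_neg, sumM_M, sumT_T, sumM_T]
    rcases coeff_cases (r + s) (-(t : ℤ) - 2) with ⟨p, hp, h⟩ | ⟨hp, h⟩ <;>
      rcases coeff_cases (r + s) t with ⟨p', hp', h'⟩ | ⟨hp', h'⟩ <;> simp only [h, h']
    all_goals split_ifs <;> omega

theorem simple_tens_verma_neg (r : ℕ) (s : ℤ) (hs : s < 0) :
    HasMultiplicities (Tens (SimpleMod (r : ℤ)) (Verma s))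
      (sumT (r + s) (fun p => if 2 * (p : ℤ) ≤ r + s + 1 then 1 else 0) +
        sumM (r + s) (fun p => if (r : ℤ) + s + 2 ≤ p ∧ p ≤ r then 1 else 0)) := by
  have hN := (simple_hasWeights r).inCatO
  have hd := wt_tens_verma s hN
  refine hasMultiplicities_of_fInj_eSurj (hN.tens (verma_hasWeights s).inCatO)
    ((verma_fInj _).tens_right hN) ((verma_eSurj hs).tens_right hN) (fun t => ?_) ?_ (fun t => ?_)
    (fun t => ?_)
  · refine ⟨rfl, rfl, ?_⟩
    simp only [Pi.add_apply, sumT_M_nat, sumM_M]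
    rcases coeff_cases (r + s) t with ⟨p, hp, h⟩ | ⟨hp, h⟩ <;> simp only [h]
    split_ifs <;> omega
  · rw [hd, wt_simple]
    simp only [Pi.add_apply, sumT_M_neg_one, sumM_M]
    rcases coeff_cases (r + s) (-1) with ⟨p, hp, h⟩ | ⟨hp, h⟩ <;> simp only [h]
    · rw [show (-1 : ℤ) + 2 = 1 by norm_num]
      split_ifs <;> omega
    · rw [show (-1 : ℤ) + 2 = 1 by norm_num]
      split_ifs <;> omega
  · rw [hd, wt_simple]
    simp only [Pi.add_apply, sumT_T, sumM_T]
    rcases coeff_cases (r + s) t with ⟨p, hp, h⟩ | ⟨hp, h⟩ <;> simp only [h]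
    · split_ifs <;> omega
    · split_ifs <;> omega
  · rw [hd, sub_add_cancel, wt_simple]
    simp only [Pi.add_apply, sumT_M_neg, sumM_M, sumT_T, sumM_T]
    rcases coeff_cases (r + s) (-(t : ℤ) - 2) with ⟨p, hp, h⟩ | ⟨hp, h⟩ <;>
      rcases coeff_cases (r + s) t with ⟨p', hp', h'⟩ | ⟨hp', h'⟩ <;> simp only [h, h']
    all_goals split_ifs <;> omega

theorem verma_tens_verma_neg (r s : ℤ) (hrs : r < 0 ∨ s < 0) :
    HasMultiplicities (Tens (Verma r) (Verma s))
      (sumT (r + s) (fun p => if 2 * (p : ℤ) ≤ r + s + 1 then 1 else 0) +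
        sumM (r + s) (fun p => if r + s + 2 ≤ (p : ℤ) then 1 else 0)) := by
  have hM := (verma_hasWeights r).inCatO
  have hN := (verma_hasWeights s).inCatO
  have hd := wt_verma_tens r hN
  refine hasMultiplicities_of_fInj_eSurj (hM.tens hN) ((verma_fInj _).tens_left hN)
    (hrs.elim (fun h => (verma_eSurj h).tens_left hN) fun h => (verma_eSurj h).tens_right hM)
    (fun t => ?_) ?_ (fun t => ?_) (fun t => ?_)
  · refine ⟨rfl, rfl, ?_⟩
    simp only [Pi.add_apply, sumT_M_nat, sumM_M]
    rcases coeff_cases (r + s) t with ⟨p, hp, h⟩ | ⟨hp, h⟩ <;> simp only [h]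
    split_ifs <;> omega
  · rw [hd, wt_verma]
    simp only [Pi.add_apply, sumT_M_neg_one, sumM_M]
    rcases coeff_cases (r + s) (-1) with ⟨p, hp, h⟩ | ⟨hp, h⟩ <;> simp only [h]
    · rw [show (-1 : ℤ) + 2 = 1 by norm_num]
      split_ifs <;> omega
    · rw [show (-1 : ℤ) + 2 = 1 by norm_num]
      split_ifs <;> omega
  · rw [hd, wt_verma]
    simp only [Pi.add_apply, sumT_T, sumM_T]
    rcases coeff_cases (r + s) t with ⟨p, hp, h⟩ | ⟨hp, h⟩ <;> simp only [h]
    · split_ifs <;> omega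
    · split_ifs <;> omega
  · rw [hd, sub_add_cancel, wt_verma]
    simp only [Pi.add_apply, sumT_M_neg, sumM_M, sumT_T, sumM_T]
    rcases coeff_cases (r + s) (-(t : ℤ) - 2) with ⟨p, hp, h⟩ | ⟨hp, h⟩ <;>
      rcases coeff_cases (r + s) t with ⟨p', hp', h'⟩ | ⟨hp', h'⟩ <;> simp only [h, h']
    all_goals split_ifs <;> omega

theorem verma_tens_verma_dual (r s : ℤ) :
    HasMultiplicities (Tens (Verma r) (RestrictedDual (Verma s)))
      (sumT (r + s) (fun p => if 2 * (p : ℤ) ≤ r + s + 1 then 1 else 0) +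
        sumM (r + s) (fun p => if r + s + 2 ≤ (p : ℤ) then 1 else 0)) := by
  have hM := (verma_hasWeights r).inCatO
  have hN := (verma_dual_hasWeights s).inCatO
  have hd := wt_verma_tens r hN
  refine hasMultiplicities_of_fInj_eSurj (hM.tens hN) ((verma_fInj _).tens_left hN)
    ((verma_dual_eSurj s).tens_right hM) (fun t => ?_) ?_ (fun t => ?_) (fun t => ?_)
  · refine ⟨rfl, rfl, ?_⟩
    simp only [Pi.add_apply, sumT_M_nat, sumM_M]
    rcases coeff_cases (r + s) t with ⟨p, hp, h⟩ | ⟨hp, h⟩ <;> simp only [h]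
    split_ifs <;> omega
  · rw [hd, wt_verma_dual]
    simp only [Pi.add_apply, sumT_M_neg_one, sumM_M]
    rcases coeff_cases (r + s) (-1) with ⟨p, hp, h⟩ | ⟨hp, h⟩ <;> simp only [h]
    · rw [show (-1 : ℤ) + 2 = 1 by norm_num]
      split_ifs <;> omega
    · rw [show (-1 : ℤ) + 2 = 1 by norm_num]
      split_ifs <;> omega
  · rw [hd, wt_verma_dual]
    simp only [Pi.add_apply, sumT_T, sumM_T]
    rcases coeff_cases (r + s) t with ⟨p, hp, h⟩ | ⟨hp, h⟩ <;> simp only [h]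
    · split_ifs <;> omega
    · split_ifs <;> omega
  · rw [hd, sub_add_cancel, wt_verma_dual]
    simp only [Pi.add_apply, sumT_M_neg, sumM_M, sumT_T, sumM_T]
    rcases coeff_cases (r + s) (-(t : ℤ) - 2) with ⟨p, hp, h⟩ | ⟨hp, h⟩ <;>
      rcases coeff_cases (r + s) t with ⟨p', hp', h'⟩ | ⟨hp', h'⟩ <;> simp only [h, h']
    all_goals split_ifs <;> omega

theorem wt_tens_tilt {N : Type} [AddCommGroup N] [Module Kq N] [Module Uq N]
    [IsScalarTower Kq Uq N] (r : ℕ) (hN : InCatO N) (m : ℤ) : wt (Tens (TiltMod r) N) m =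
      wt (Tens (TiltMod r) N) (m + 2) + (wt N (m - r) + wt N (m - (-(r : ℤ) - 2))) := by
  rw [wt_tilt_tens r hN, wt_tilt_tens r hN, wt_verma_tens _ hN m, wt_verma_tens (-(r : ℤ) - 2) hN m]
  omega

theorem simple_tens_tilt (r s : ℕ) : HasMultiplicities (Tens (SimpleMod (r : ℤ)) (TiltMod s))
    (sumT (r + s) (fun p => if p ≤ min r s then 1
      else if 2 * s + 2 ≤ 2 * p ∧ 2 * p ≤ r + s + 1 then 2 else 0)) := by
  have hM := (simple_hasWeights r).inCatO
  have hN := (tilt_hasWeights s).inCatO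
  have hd := wt_tens_tilt s hM
  rw [wt_tens_comm hN hM] at hd
  refine hasMultiplicities_of_fInj_eSurj (hM.tens hN) ((tilt_fInj s).tens_right hM)
    ((tilt_eSurj s).tens_right hM) (fun t => ⟨rfl, rfl, sumT_M_nat _ _ t⟩) ?_ (fun t => ?_)
    (fun t => ?_)
  · rw [hd, wt_simple, wt_simple]
    simp only [sumT_M_neg_one]
    rcases coeff_cases (r + s) (-1) with ⟨p, hp, h⟩ | ⟨hp, h⟩ <;> simp only [h]
    · rw [show (-1 : ℤ) + 2 = 1 by norm_num]
      split_ifs <;> omega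
    · rw [show (-1 : ℤ) + 2 = 1 by norm_num]
      split_ifs <;> omega
  · rw [hd, wt_simple, wt_simple]
    simp only [sumT_T]
    rcases coeff_cases (r + s) t with ⟨p, hp, h⟩ | ⟨hp, h⟩ <;> simp only [h]
    · split_ifs <;> omega
    · split_ifs <;> omega
  · rw [hd, sub_add_cancel, wt_simple, wt_simple]
    simp only [sumT_M_neg, sumT_T]
    rcases coeff_cases (r + s) (-(t : ℤ) - 2) with ⟨p, hp, h⟩ | ⟨hp, h⟩ <;>
      rcases coeff_cases (r + s) t with ⟨p', hp', h'⟩ | ⟨hp', h'⟩ <;> simp only [h']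
    all_goals split_ifs <;> omega

/-- `n` solves the equations which the weight multiplicities `c` of a module in the category
impose on the multiplicities of its summands when `f` is injective and `e` is surjective. -/
def SolvesWt (c : ℤ → ℕ) (n : Label → ℕ) : Prop :=
  (∀ t : ℕ, n (.V t) = 0 ∧ n (.Mσ t) = 0 ∧ n (.M t) = 0) ∧ c (-1) = c 1 + n (.M (-1)) ∧
    (∀ t : ℕ, c t = c (t + 2) + n (.T t)) ∧
    ∀ t : ℕ, c (-(t : ℤ) - 2) = c (-(t : ℤ)) + (n (.T t) + n (.M (-(t : ℤ) - 2)))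

theorem SolvesWt.add {c c' : ℤ → ℕ} {n n' : Label → ℕ} (h : SolvesWt c n) (h' : SolvesWt c' n') :
    SolvesWt (fun m => c m + c' m) (n + n') := by
  refine ⟨fun t => ?_, ?_, fun t => ?_, fun t => ?_⟩
  · have := h.1 t
    have := h'.1 t
    simp only [Pi.add_apply]
    omega
  · have := h.2.1
    have := h'.2.1
    simp only [Pi.add_apply]
    omega
  · have := h.2.2.1 t
    have := h'.2.2.1 t
    simp only [Pi.add_apply]
    omega
  · have := h.2.2.2 t
    have := h'.2.2.2 t
    simp only [Pi.add_apply]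
    omega

theorem solvesWt_tilt_tens_verma (r : ℕ) (s : ℤ) :
    SolvesWt (wt (Tens (TiltMod r) (Verma s))) (multTM r s) := by
  have hN := (verma_hasWeights s).inCatO
  have hd := wt_tens_tilt r hN
  unfold multTM
  refine ⟨fun t => ?_, ?_, fun t => ?_, fun t => ?_⟩
  · refine ⟨rfl, rfl, ?_⟩
    simp only [Pi.add_apply, sumT_M_nat, sumM_M]
    rcases coeff_cases (r + s) t with ⟨p, hp, h⟩ | ⟨hp, h⟩ <;> simp only [h]
    split_ifs <;> omega
  · rw [hd, wt_verma, wt_verma]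
    simp only [Pi.add_apply, sumT_M_neg_one, sumM_M]
    rcases coeff_cases (r + s) (-1) with ⟨p, hp, h⟩ | ⟨hp, h⟩ <;> simp only [h]
    · rw [show (-1 : ℤ) + 2 = 1 by norm_num]
      split_ifs <;> omega
    · rw [show (-1 : ℤ) + 2 = 1 by norm_num]
      split_ifs <;> omega
  · rw [hd, wt_verma, wt_verma]
    simp only [Pi.add_apply, sumT_T, sumM_T]
    rcases coeff_cases (r + s) t with ⟨p, hp, h⟩ | ⟨hp, h⟩ <;> simp only [h]
    · split_ifs <;> omega
    · split_ifs <;> omega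
  · rw [hd, sub_add_cancel, wt_verma, wt_verma]
    simp only [Pi.add_apply, sumT_M_neg, sumM_M, sumT_T, sumM_T]
    rcases coeff_cases (r + s) (-(t : ℤ) - 2) with ⟨p, hp, h⟩ | ⟨hp, h⟩ <;>
      rcases coeff_cases (r + s) t with ⟨p', hp', h'⟩ | ⟨hp', h'⟩ <;> simp only [h, h']
    all_goals split_ifs <;> omega

theorem tilt_tens_verma (r : ℕ) (s : ℤ) :
    HasMultiplicities (Tens (TiltMod r) (Verma s)) (multTM r s) := by
  have hM := (tilt_hasWeights r).inCatO
  have hN := (verma_hasWeights s).inCatO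
  obtain ⟨hn, h0, h1, h2⟩ := solvesWt_tilt_tens_verma r s
  exact hasMultiplicities_of_fInj_eSurj (hM.tens hN) ((tilt_fInj r).tens_left hN)
    ((tilt_eSurj r).tens_left hN) hn h0 h1 h2

theorem wt_tilt_tens_tilt (r s : ℕ) (m : ℤ) : wt (Tens (TiltMod r) (TiltMod s)) m =
    wt (Tens (TiltMod r) (Verma s)) m + wt (Tens (TiltMod r) (Verma (-(s : ℤ) - 2))) m := by
  have hM := (tilt_hasWeights r).inCatO
  rw [wt_tens_comm hM (tilt_hasWeights s).inCatO, wt_tilt_tens s hM,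
    wt_tens_comm (verma_hasWeights (s : ℤ)).inCatO hM,
    wt_tens_comm (verma_hasWeights (-(s : ℤ) - 2)).inCatO hM]

theorem tilt_tens_tilt (r s : ℕ) :
    Nonempty (Tens (TiltMod r) (TiltMod s) ≃ₗ[Uq]
        Tens (TiltMod r) (Verma s) × Tens (TiltMod r) (Verma (-(s : ℤ) - 2))) ∧
      HasMultiplicities (Tens (TiltMod r) (TiltMod s)) (multTM r s + multTM r (-(s : ℤ) - 2)) := by
  have hM := (tilt_hasWeights r).inCatO
  have hN := (tilt_hasWeights s).inCatO
  have h₁ := (verma_hasWeights (s : ℤ)).inCatO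
  have h₂ := (verma_hasWeights (-(s : ℤ) - 2)).inCatO
  constructor
  · refine equiv_of_fInj_eSurj (hM.tens hN) ((hM.tens h₁).prod (hM.tens h₂)) (funext fun m => ?_)
      ((tilt_fInj r).tens_left hN) (((tilt_fInj r).tens_left h₁).prod ((tilt_fInj r).tens_left h₂))
      ((tilt_eSurj r).tens_left hN)
      (((tilt_eSurj r).tens_left h₁).prod ((tilt_eSurj r).tens_left h₂))
    rw [wt_tilt_tens_tilt, wt_prod (hM.tens h₁) (hM.tens h₂)]
  · have h := (solvesWt_tilt_tens_verma r s).add (solvesWt_tilt_tens_verma r (-(s : ℤ) - 2))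
    rw [← funext (wt_tilt_tens_tilt r s)] at h
    obtain ⟨hn, h0, h1, h2⟩ := h
    exact hasMultiplicities_of_fInj_eSurj (hM.tens hN) ((tilt_fInj r).tens_left hN)
      ((tilt_eSurj r).tens_left hN) hn h0 h1 h2

end multiplicities

end

end QuantumSl2

theorem mainTheorem5 :
    -- the modules `V(r)`, `M(s)`, `M(r)^σ`, `T(r)` are indecomposable
    (∀ l : Label, IsIndecomposable l.Mod) ∧
    -- `V(r) ⊗ V(s)`
    (∀ r s : ℕ, HasMultiplicities (Tens (SimpleMod r) (SimpleMod s))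
      (sumV (r + s) (fun p => if p ≤ min r s then 1 else 0))) ∧
    -- `M(r) ⊗ M(s)`, `r, s ≥ 0`
    (∀ r s : ℕ, HasMultiplicities (Tens (Verma r) (Verma s))
      (sumM (r + s) (fun p => if p ≤ min r s then 1 else 0) +
        sumT (r + s) (fun p => if min r s + 1 ≤ p ∧ p ≤ (r + s + 1) / 2 then 1 else 0) +
        sumM (r + s) (fun p => if max r s + 1 ≤ p then 1 else 0))) ∧
    -- `V(r) ⊗ M(s)`, `r, s ≥ 0`
    (∀ r s : ℕ, HasMultiplicities (Tens (SimpleMod r) (Verma s))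
      (sumM (r + s) (fun p => if p ≤ min r s then 1 else 0) +
        sumT (r + s) (fun p => if s < r ∧ s + 1 ≤ p ∧ p ≤ (r + s + 1) / 2 then 1 else 0))) ∧
    -- `V(r) ⊗ M(s)`, `s < 0`
    (∀ (r : ℕ) (s : ℤ), s < 0 → HasMultiplicities (Tens (SimpleMod r) (Verma s))
      (sumT (r + s) (fun p => if 2 * (p : ℤ) ≤ r + s + 1 then 1 else 0) +
        sumM (r + s) (fun p => if (r : ℤ) + s + 2 ≤ p ∧ p ≤ r then 1 else 0))) ∧
    -- `M(r) ⊗ M(s)`, `r < 0` or `s < 0`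
    (∀ r s : ℤ, r < 0 ∨ s < 0 → HasMultiplicities (Tens (Verma r) (Verma s))
      (sumT (r + s) (fun p => if 2 * (p : ℤ) ≤ r + s + 1 then 1 else 0) +
        sumM (r + s) (fun p => if r + s + 2 ≤ (p : ℤ) then 1 else 0))) ∧
    -- `V(r) ⊗ T(s)`
    (∀ r s : ℕ, HasMultiplicities (Tens (SimpleMod r) (TiltMod s))
      (sumT (r + s) (fun p => if p ≤ min r s then 1
        else if 2 * s + 2 ≤ 2 * p ∧ 2 * p ≤ r + s + 1 then 2 else 0))) ∧
    -- `M(r) ⊗ M(s)^σ`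
    (∀ r s : ℤ, HasMultiplicities (Tens (Verma r) (RestrictedDual (Verma s)))
      (sumT (r + s) (fun p => if 2 * (p : ℤ) ≤ r + s + 1 then 1 else 0) +
        sumM (r + s) (fun p => if r + s + 2 ≤ (p : ℤ) then 1 else 0))) ∧
    -- `T(r) ⊗ M(s)`
    (∀ (r : ℕ) (s : ℤ), HasMultiplicities (Tens (TiltMod r) (Verma s)) (multTM r s)) ∧
    -- `T(r) ⊗ T(s)`
    (∀ r s : ℕ,
      Nonempty (Tens (TiltMod r) (TiltMod s) ≃ₗ[Uq]
        Tens (TiltMod r) (Verma s) × Tens (TiltMod r) (Verma (-(s : ℤ) - 2))) ∧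
      HasMultiplicities (Tens (TiltMod r) (TiltMod s)) (multTM r s + multTM r (-(s : ℤ) - 2))) ∧
    -- the remaining pairs: reversing the order of the factors, and applying `σ`
    (∀ l : Label, Nonempty (RestrictedDual l.Mod ≃ₗ[Uq] l.dual.Mod)) ∧
    (∀ l l' : Label, Nonempty (Tens l.Mod l'.Mod ≃ₗ[Uq] Tens l'.Mod l.Mod)) ∧
    (∀ (l l' : Label) (n : Label → ℕ), HasMultiplicities (Tens l.Mod l'.Mod) n →
      HasMultiplicities (Tens l.dual.Mod l'.dual.Mod) (fun x => n x.dual)) :=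
  ⟨Label.isIndecomposable, simple_tens_simple, verma_tens_verma_nat, simple_tens_verma_nat,
    simple_tens_verma_neg, verma_tens_verma_neg, simple_tens_tilt, verma_tens_verma_dual,
    tilt_tens_verma, tilt_tens_tilt, Label.dual_equiv, tens_comm, tens_dual⟩
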